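/- **Setting.** A single bit register is named by a focus $r{:}i$ with a role $r\in\{in,inout,out0,out1,aux0,aux1\}$ and a number $i$; its methods are the 16 methods $y/e$ with $y,e\in\{0,1,i,c\}$ (constants, identity, complement), which reply $y(b)$ and change the content $b$ to $e(b)$. A PGLB instruction sequence is a non-empty finite sequence of instructions $a$, $+a$, $-a$ (perform the basic action $a=f.m$; after $+a$ resp. $-a$ the next instruction is skipped if the reply is $0$ resp. $1$), $\#k$ and $\backslash\#k$ (jump $k$ positions forward resp. backward) and $!$ (terminate); leaving the range of positions and jumps by $0$ count as non-termination. A finite PGA (single pass) instruction sequence is one without backward jumps. $\mathsf{LLOC}(X)$ is the number of instructions of $X$. $X$ has low register indices if, for each role, the numbers of the registers occurring in $X$ form an initial segment of the positive integers. $X$ computes a partial function from the initial contents of the $in$ and $inout$ registers to the final contents of the $inout$, $out0$, $out1$ registers, where $out0,aux0$ registers start with $0$ and $out1,aux1$ registers with $1$. **Proposition.** Suppose there are a map $\Psi$ and a polynomial $p$ such that for each PGLB instruction sequence $X$ for single bit registers with low register indices, $\Psi(X)$ is a finite PGA instruction sequence with low register indices which uses only registers of $X$ and possibly further auxiliary registers,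 $\Psi(X)$ computes the same partial function as $X$, and $\mathsf{LLOC}(\Psi(X))\le p(\mathsf{LLOC}(X))$. Then 1. $\mathrm{NP}\subseteq \mathrm{P/poly}$; 2. in fact $\mathrm{NP}\subseteq \mathrm{P}/O(n\log n)$, where $n$ is the LLOC of single pass instruction sequences for the problem. Precisely: call a finite PGA instruction sequence $Y$ with low register indices a decider for $L$ at length $m$ if it uses only registers $in{:}1,\dots,in{:}m$, $out0{:}1$ and auxiliary ones and, for each $x\in\{0,1\}^m$ placed in $in{:}1,\dots,in{:}m$, terminates with $1$ in $out0{:}1$ if and only if $x\in L$ (and with $0$ otherwise). Then for every $L\in\mathrm{NP}$ there are deciders $Y_m$ for $L$ at all lengths $m$ with $\mathsf{LLOC}(Y_m)$ bounded by a polynomial in $m$, and $L$ is decidable in polynomial time with advice strings $a_m$ depending only on the input length $m$ such that, for a constant $c$, $|a_m|\le c\,(n\log_2 n+1)$ whenever $n$ is the LLOC of any decider for $L$ at length $m$ (in particular of a shortest one). -/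

import Mathlib

namespace InstrSeq

/-! ### Single bit registers -/

/-- The four functions on one bit, written `0`, `1`, `i` (identity), `c` (complement). -/
inductive BitFn
  | zero
  | one
  | ident
  | compl

def BitFn.apply : BitFn → Bool → Bool
  | .zero, _ => false
  | .one, _ => true
  | .ident, b => b
  | .compl, b => !b

/-- The 16 methods `y/e` of a single bit register: applied to content `b`, the method yields the
reply `y b` and changes the content to `e b`. -/
structure Method where
  yield : BitFn
  effect : BitFn

/-- The roles (kinds) of single bit registers. -/
inductive Role
  | inp
  | inout
  | out0
  | out1
  | aux0
  | aux1

/-- Registers of this role carry the arguments of the computed function. -/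
def Role.isInput : Role → Bool
  | .inp | .inout => true
  | _ => false

/-- Registers of this role carry the results of the computed function. -/
def Role.isOutput : Role → Bool
  | .inout | .out0 | .out1 => true
  | _ => false

def Role.isAux : Role → Bool
  | .aux0 | .aux1 => true
  | _ => false

/-- Initial content of the registers that are not input registers. -/
def Role.initial : Role → Bool
  | .out1 | .aux1 => true
  | _ => false

/-- A focus `role:index`, naming a single bit register. -/
@[ext] structure Focus where
  role : Role
  index : ℕ

/-- A basic action `f.m`. -/
structure Action where
  focus : Focus
  method : Method

/-! ### Instruction sequences -/

/-- PGLB instructions: `a`, `+a`, `-a`, `#k`, `\#k`, `!`. -/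
inductive Instr
  | basic (a : Action)
  | pos (a : Action)
  | neg (a : Action)
  | jump (k : ℕ)
  | bjump (k : ℕ)
  | term

/-- The focus that occurs in an instruction, if any. -/
def Instr.focus? : Instr → Option Focus
  | .basic a | .pos a | .neg a => some a.focus
  | _ => none

def Instr.IsBackwardJump : Instr → Prop
  | .bjump _ => True
  | _ => False

/-- PGLB instruction sequences `u₁;…;uₙ`, with `n ≥ 1`. -/
def IsPGLB (X : List Instr) : Prop := X ≠ []

/-- Finite PGA instruction sequences (single pass instruction sequences): no backward jumps,
no iteration. -/
def IsFinitePGA (X : List Instr) : Prop := X ≠ [] ∧ ∀ u ∈ X, ¬ u.IsBackwardJump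

/-- Logical lines of code: the number of instructions. -/
def LLOC (X : List Instr) : ℕ := X.length

/-- The register named by `f` is involved in a basic action of `X`. -/
def Uses (X : List Instr) (f : Focus) : Prop := ∃ u ∈ X, u.focus? = some f

/-- For each kind of register, the register numbers in use form an initial segment of the
positive natural numbers. -/
def LowRegisterIndices (X : List Instr) : Prop :=
  ∀ r : Role, ∃ k : ℕ, {i : ℕ | Uses X ⟨r, i⟩} = Set.Icc 1 k

/-! ### Execution -/

/-- Contents of the registers. -/
abbrev Memory := Focus → Bool

open Classical in
/-- Memory after performing a basic action. -/
noncomputable def Action.perform (a : Action) (M : Memory) : Memory :=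
  Function.update M a.focus (a.method.effect.apply (M a.focus))

/-- Reply to a basic action. -/
def Action.reply (a : Action) (M : Memory) : Bool := a.method.yield.apply (M a.focus)

/-- Execution of `X` during at most `t` instructions, from position `pc` (counted from `0`) and
memory `M`: the final memory if `!` has been reached within this bound. Leaving the range of
positions, by a jump or otherwise, is inaction, i.e. no termination; so is a jump by `0`, which is
repeated forever. -/
noncomputable def exec (X : List Instr) : ℕ → ℕ → Memory → Option Memory
  | 0, _, _ => none
  | t + 1, pc, M =>
    match X[pc]? with
    | none => none
    | some .term => some M
    | some (.basic a) => exec X t (pc + 1) (a.perform M)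
    | some (.pos a) => exec X t (if a.reply M then pc + 1 else pc + 2) (a.perform M)
    | some (.neg a) => exec X t (if a.reply M then pc + 2 else pc + 1) (a.perform M)
    | some (.jump k) => exec X t (pc + k) M
    | some (.bjump k) => if k ≤ pc then exec X t (pc - k) M else none

abbrev InReg := {f : Focus // f.role.isInput = true}

abbrev OutReg := {f : Focus // f.role.isOutput = true}

/-- Input registers hold the arguments, the other ones their initial contents. -/
def initMemory (ρ : InReg → Bool) : Memory := fun f =>
  if h : f.role.isInput = true then ρ ⟨f, h⟩ else f.role.initial

/-- The partial function computed by `X`: from the initial contents of the input registers to the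
final contents of the output registers, undefined where `X` does not terminate. -/
noncomputable def computed (X : List Instr) : (InReg → Bool) →. (OutReg → Bool) := fun ρ =>
  (Nat.rfindOpt fun t => exec X t 0 (initMemory ρ)).map fun M g => M g.1

/-- `Ψ` translates every PGLB instruction sequence with low register indices into a finite PGA
instruction sequence with low register indices that works on the same registers, apart from
auxiliary ones, and computes the same function. -/
def IsTranslation (Ψ : List Instr → List Instr) : Prop :=
  ∀ X, IsPGLB X → LowRegisterIndices X →
    IsFinitePGA (Ψ X) ∧ LowRegisterIndices (Ψ X) ∧
      (∀ f, Uses (Ψ X) f → f.role.isAux = true ∨ Uses X f) ∧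
      computed (Ψ X) = computed X

/-! ### Complexity classes -/

/-- Decidability in polynomial time by a Turing machine. -/
def PolyTimeDecidable {α Γ : Type} (e : Computability.Encoding α Γ) (S : Set α) : Prop :=
  ∃ χ : α → Bool, (∀ a, χ a = true ↔ a ∈ S) ∧
    Nonempty (Turing.TM2ComputableInPolyTime e.encode Computability.encodingBoolBool.encode χ)

/-- Encoding of pairs of bit strings. -/
def pairEncoding : Computability.Encoding (List Bool × List Bool) (Bool ⊕ Bool) :=
  Computability.encodingProd (Computability.encodingList Bool) (Computability.encodingList Bool)

/-- NP: polynomial time verifiable witnesses of polynomial length. -/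
def NP : Set (Language Bool) :=
  {L | ∃ (V : Set (List Bool × List Bool)) (q : Polynomial ℕ), PolyTimeDecidable pairEncoding V ∧
    ∀ x, x ∈ L ↔ ∃ w : List Bool, w.length ≤ q.eval x.length ∧ (x, w) ∈ V}

/-- `P/F` for a class `F` of functions: polynomial time with an advice string that depends on the
length of the input only, and whose length is a function in `F` of the length of the input. -/
def PAdvice (F : Set (ℕ → ℕ)) : Set (Language Bool) :=
  {L | ∃ a : ℕ → List Bool, (fun m => (a m).length) ∈ F ∧
    ∃ V : Set (List Bool × List Bool), PolyTimeDecidable pairEncoding V ∧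
      ∀ x, x ∈ L ↔ (x, a x.length) ∈ V}

def PPoly : Set (Language Bool) :=
  PAdvice {f | ∃ q : Polynomial ℕ, ∀ m, f m ≤ q.eval m}

/-- The bits of `x` as contents of `in:1, in:2, …`. -/
def inputBits (x : List Bool) : InReg → Bool := fun f => x.getD (f.1.index - 1) false

/-- `Y` is a finite PGA instruction sequence with low register indices that decides `L` on inputs
of length `m`, found in `in:1, …, in:m`, with its answer in `out0:1`; auxiliary registers are
allowed. -/
def DecidesAt (Y : List Instr) (L : Language Bool) (m : ℕ) : Prop :=
  IsFinitePGA Y ∧ LowRegisterIndices Y ∧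
    (∀ f, Uses Y f →
      (f.role = Role.inp ∧ f.index ≤ m) ∨ f = ⟨Role.out0, 1⟩ ∨ f.role.isAux = true) ∧
    ∀ x : List Bool, x.length = m →
      ∃ β ∈ computed Y (inputBits x), (β ⟨⟨Role.out0, 1⟩, rfl⟩ = true ↔ x ∈ L)

/-- `P/O(n log n)`, where `n` is the LLOC of single pass instruction sequences for the problem:
`L` has single pass instruction sequences of LLOC polynomial in the input length, and `L` can be
decided in polynomial time with advice of length `O(n log n)`, whenever `n` is the LLOC of a
single pass instruction sequence that decides `L` on the inputs of the given length (in
particular for the shortest one). The summand `1` is there because `n log n = 0` for `n = 1`. -/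
def PNLogN : Set (Language Bool) :=
  {L | (∃ (Y : ℕ → List Instr) (q : Polynomial ℕ),
      ∀ m, DecidesAt (Y m) L m ∧ LLOC (Y m) ≤ q.eval m) ∧
    L ∈ PAdvice {f | ∃ c : ℕ, ∀ m Y, DecidesAt Y L m →
      f m ≤ c * (LLOC Y * Nat.log 2 (LLOC Y) + 1)}}

end InstrSeq

/-!
A verifier for a language in NP is a stack machine with polynomial running time. On inputs of a
fixed length, backward jumps allow an instruction sequence with polynomially many instructions to
simulate the machine on one witness candidate after another: only its running time is exponential,
and running time does not count. The translation `Ψ` turns it into a single pass instruction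
sequence which is still of polynomial length.

A single pass instruction sequence of length `n` is in turn executed from left to right by marking
the position that is to be executed next. Each instruction then amounts to at most four operations
on a memory with `O(n)` bits, so that a list of operations with addresses of `O(log n)` bits serves
as advice. In order to execute such a list in polynomial time, a stack machine keeps the memory as a
log of all writes and searches it for the most recent entry at an address.
-/

namespace InstrSeq

open Turing

/-! ### Structured programs and their flat code -/

section Structured

variable {A C S : Type}

/-- Structured programs with basic actions from `A` and tests from `C`. They are the common source
language for PGLB instruction sequences and for stack machines. -/
inductive Prog (A C : Type)
  | skip
  | act (a : A)
  | seq (p q : Prog A C)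
  | ite (c : C) (p q : Prog A C)
  | loop (c : C) (p : Prog A C)

/-- Sequential composition of a list of programs. -/
def Prog.seqs : List (Prog A C) → Prog A C
  | [] => .skip
  | p :: l => .seq p (Prog.seqs l)

/-- `Run act tst p s t s'`: the program `p` takes state `s` to state `s'` in at most `t` steps of
its flat code `Prog.flat p`. -/
inductive Run (act : A → S → S) (tst : C → S → Bool) : Prog A C → S → ℕ → S → Prop
  | skip (s : S) : Run act tst .skip s 0 s
  | act (a : A) (s : S) : Run act tst (.act a) s 1 (act a s)
  | seq {p q : Prog A C} {s s' s'' : S} {t t' : ℕ} : Run act tst p s t s' →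
      Run act tst q s' t' s'' → Run act tst (.seq p q) s (t + t') s''
  | ite_true {c : C} {p q : Prog A C} {s s' : S} {t : ℕ} : tst c s = true →
      Run act tst p s t s' → Run act tst (.ite c p q) s (t + 2) s'
  | ite_false {c : C} {p q : Prog A C} {s s' : S} {t : ℕ} : tst c s = false →
      Run act tst q s t s' → Run act tst (.ite c p q) s (t + 2) s'
  | loop_true {c : C} {p : Prog A C} {s s' s'' : S} {t t' : ℕ} : tst c s = true →
      Run act tst p s t s' → Run act tst (.loop c p) s' t' s'' →
      Run act tst (.loop c p) s (t + t' + 2) s''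
  | loop_false {c : C} {p : Prog A C} {s : S} : tst c s = false →
      Run act tst (.loop c p) s 2 s
  | mono {p : Prog A C} {s s' : S} {t t' : ℕ} : t ≤ t' → Run act tst p s t s' →
      Run act tst p s t' s'

/-- Instructions of unstructured programs: a basic action, skipping the next instruction if a test
succeeds, and relative jumps forward and backward. -/
inductive FlatInstr (A C : Type)
  | act (a : A)
  | skipIf (c : C)
  | jump (k : ℕ)
  | bjump (k : ℕ)

/-- Number of instructions of the flat code of a program. -/
def Prog.size : Prog A C → ℕ
  | .skip => 0
  | .act _ => 1
  | .seq p q => p.size + q.size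
  | .ite _ p q => p.size + q.size + 3
  | .loop _ p => p.size + 3

/-- The unstructured program for a structured one. -/
def Prog.flat : Prog A C → List (FlatInstr A C)
  | .skip => []
  | .act a => [.act a]
  | .seq p q => p.flat ++ q.flat
  | .ite c p q =>
      .skipIf c :: .jump (p.size + 2) :: (p.flat ++ .jump (q.size + 1) :: q.flat)
  | .loop c p => .skipIf c :: .jump (p.size + 2) :: (p.flat ++ [.bjump (p.size + 2)])

theorem Prog.length_flat (p : Prog A C) : p.flat.length = p.size := by
  induction p with
  | skip | act => rfl
  | seq p q hp hq => simp [flat, size, hp, hq]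
  | ite c p q hp hq => simp [flat, size, hp, hq]; omega
  | loop c p hp => simp [flat, size, hp]

/-- `u.Step act tst n s n' s'`: executed at position `n` in state `s`, the instruction `u` leads to
position `n'` and state `s'`. -/
inductive FlatInstr.Step (act : A → S → S) (tst : C → S → Bool) :
    FlatInstr A C → ℕ → S → ℕ → S → Prop
  | act (a : A) (n : ℕ) (s : S) : Step act tst (.act a) n s (n + 1) (act a s)
  | skipIf_true {c : C} (n : ℕ) {s : S} : tst c s = true →
      Step act tst (.skipIf c) n s (n + 2) s
  | skipIf_false {c : C} (n : ℕ) {s : S} : tst c s = false →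
      Step act tst (.skipIf c) n s (n + 1) s
  | jump (k n : ℕ) (s : S) : Step act tst (.jump k) n s (n + k) s
  | bjump (k n : ℕ) (s : S) : Step act tst (.bjump k) (n + k) s n s

/-- `FlatSteps act tst X n s t n' s'`: the unstructured program `X` gets from position `n` and state
`s` to position `n'` and state `s'` in at most `t` steps. -/
inductive FlatSteps (act : A → S → S) (tst : C → S → Bool) (X : List (FlatInstr A C)) :
    ℕ → S → ℕ → ℕ → S → Prop
  | refl (n : ℕ) (s : S) (t : ℕ) : FlatSteps act tst X n s t n s
  | head {u : FlatInstr A C} {n n' n'' t : ℕ} {s s' s'' : S} : X[n]? = some u →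
      u.Step act tst n s n' s' → FlatSteps act tst X n' s' t n'' s'' →
      FlatSteps act tst X n s (t + 1) n'' s''

namespace FlatSteps

variable {act : A → S → S} {tst : C → S → Bool} {X : List (FlatInstr A C)}
  {n n' n'' t t' : ℕ} {s s' s'' : S}

theorem mono (htt' : t ≤ t') (h : FlatSteps act tst X n s t n' s') :
    FlatSteps act tst X n s t' n' s' := by
  induction h generalizing t' with
  | refl => exact refl _ _ _
  | head hu hstep _ ih =>
    obtain ⟨t', rfl⟩ := Nat.exists_eq_add_of_lt (Nat.lt_of_succ_le htt')
    exact head hu hstep (ih (by omega))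

theorem trans (h : FlatSteps act tst X n s t n' s') (h' : FlatSteps act tst X n' s' t' n'' s'') :
    FlatSteps act tst X n s (t + t') n'' s'' := by
  induction h with
  | refl => exact h'.mono (by omega)
  | head hu hstep _ ih => exact (head hu hstep (ih h')).mono (by omega)

theorem single {u : FlatInstr A C} (hu : X[n]? = some u) (hstep : u.Step act tst n s n' s') :
    FlatSteps act tst X n s 1 n' s' :=
  head hu hstep (refl _ _ 0)

end FlatSteps

/-- The list `l` occurs in `X` from position `n` on. -/
def OccursAt {α : Type} (X : List α) (n : ℕ) (l : List α) : Prop := l <+: X.drop n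

theorem occursAt_cons {α : Type} {X : List α} {n : ℕ} {a : α} {l : List α} :
    OccursAt X n (a :: l) ↔ X[n]? = some a ∧ OccursAt X (n + 1) l := by
  by_cases hn : n < X.length
  · rw [OccursAt, List.drop_eq_getElem_cons hn, List.cons_prefix_cons, OccursAt,
      List.getElem?_eq_getElem hn, Option.some_inj, eq_comm]
  · simp [OccursAt, List.drop_eq_nil_of_le (not_lt.mp hn), List.getElem?_eq_none (not_lt.mp hn)]

theorem occursAt_append {α : Type} {X : List α} {n : ℕ} {l₁ l₂ : List α} :
    OccursAt X n (l₁ ++ l₂) ↔ OccursAt X n l₁ ∧ OccursAt X (n + l₁.length) l₂ := by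
  induction l₁ generalizing n with
  | nil => simp [OccursAt]
  | cons a l ih =>
    rw [List.cons_append, occursAt_cons, occursAt_cons, ih, and_assoc, List.length_cons,
      Nat.add_right_comm, Nat.add_assoc]

theorem flatSteps_of_run {act : A → S → S} {tst : C → S → Bool} {p : Prog A C} {s s' : S} {t : ℕ}
    (h : Run act tst p s t s') {X : List (FlatInstr A C)} {n : ℕ} (hX : OccursAt X n p.flat) :
    FlatSteps act tst X n s t (n + p.size) s' := by
  induction h generalizing n with
  | skip s => exact .refl _ _ _
  | act a s => exact .single (occursAt_cons.mp hX).1 (.act a n s)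
  | @seq p q _ _ _ _ _ _ _ ihp ihq =>
    rw [Prog.flat, occursAt_append, p.length_flat] at hX
    rw [Prog.size, ← Nat.add_assoc]
    exact (ihp hX.1).trans (ihq hX.2)
  | @ite_true c p q s s' t hc _ ih =>
    simp only [Prog.flat, occursAt_cons, occursAt_append, p.length_flat] at hX
    obtain ⟨hskip, -, hp, hjump, -⟩ := hX
    have hend := FlatSteps.single hjump (.jump (act := act) (tst := tst) _ _ s')
    refine .head hskip (.skipIf_true n hc) ((ih hp).trans ?_)
    rw [Prog.size]
    convert hend using 1
    omega
  | @ite_false c p q s s' t hc _ ih =>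
    simp only [Prog.flat, occursAt_cons, occursAt_append, p.length_flat] at hX
    obtain ⟨hskip, hjump, -, -, hq⟩ := hX
    refine .head hskip (.skipIf_false n hc) (.head hjump (.jump _ _ _) ?_)
    rw [Prog.size]
    convert ih hq using 1 <;> omega
  | @loop_true c p s s' s'' t t' hc _ _ ihp ihloop =>
    have hloop := hX
    simp only [Prog.flat, occursAt_cons, occursAt_append, p.length_flat] at hX
    obtain ⟨hskip, -, hp, hbjump, -⟩ := hX
    have hback : FlatSteps act tst X (n + 1 + 1 + p.size) s' 1 n s' :=
      .single hbjump (by convert FlatInstr.Step.bjump _ n s' using 1; omega)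
    exact (FlatSteps.head hskip (.skipIf_true n hc)
      ((ihp hp).trans (hback.trans (ihloop hloop)))).mono (by omega)
  | @loop_false c p s hc =>
    simp only [Prog.flat, occursAt_cons] at hX
    refine .head hX.1 (.skipIf_false n hc) (.single hX.2.1 ?_)
    rw [Prog.size]
    convert FlatInstr.Step.jump _ _ s using 1
    omega
  | mono htt' _ ih => exact (ih hX).mono htt'

end Structured

/-! ### Register programs as PGLB instruction sequences -/

section RegisterCode

variable {V : Type}

/-- Structured programs over bit variables: assignments of constants and tests of variables. -/
abbrev RegProg (V : Type) := Prog (V × Bool) V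

open Classical in
/-- Assignment of a constant to a variable. -/
noncomputable def assign (a : V × Bool) (ρ : V → Bool) : V → Bool :=
  Function.update ρ a.1 a.2

/-- Test of a variable. -/
def testVar (v : V) (ρ : V → Bool) : Bool := ρ v

/-- Big-step semantics without time: the register program `p` takes valuation `ρ` to `τ`. -/
def Exec (p : RegProg V) (ρ τ : V → Bool) : Prop := ∃ t, Run assign testVar p ρ t τ

/-- The constant function on bits with the given value. -/
def BitFn.const (b : Bool) : BitFn := if b then .one else .zero

theorem BitFn.const_apply (b b' : Bool) : (BitFn.const b).apply b' = b := by
  cases b <;> rfl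

theorem Action.perform_ident (f : Focus) (y : BitFn) (M : Memory) :
    (Action.mk f ⟨y, .ident⟩).perform M = M := by
  simp [Action.perform, BitFn.apply]

/-- The PGLB instruction for an unstructured instruction on variables named by the foci `e v`. -/
def FlatInstr.toInstr (e : V → Focus) : FlatInstr (V × Bool) V → Instr
  | .act a => .basic ⟨e a.1, ⟨.zero, .const a.2⟩⟩
  | .skipIf v => .neg ⟨e v, ⟨.ident, .ident⟩⟩
  | .jump k => .jump k
  | .bjump k => .bjump k

/-- The PGLB code, still without termination instruction, of a register program. -/
def Prog.code (e : V → Focus) (p : RegProg V) : List Instr := p.flat.map (FlatInstr.toInstr e)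

theorem Prog.length_code (e : V → Focus) (p : RegProg V) : (p.code e).length = p.size := by
  rw [code, List.length_map, length_flat]

theorem Prog.focus_mem_range_of_mem_code {e : V → Focus} {p : RegProg V} {u : Instr} {f : Focus}
    (hu : u ∈ p.code e) (hf : u.focus? = some f) : f ∈ Set.range e := by
  obtain ⟨u, -, rfl⟩ := List.mem_map.mp hu
  cases u <;> simp only [FlatInstr.toInstr, Instr.focus?, Option.some.injEq, reduceCtorEq] at hf <;>
    exact ⟨_, hf⟩

/-- The memory `M` holds the valuation `ρ` at the foci `e v`. -/
def Holds (e : V → Focus) (M : Memory) (ρ : V → Bool) : Prop := ∀ v, M (e v) = ρ v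

theorem Holds.perform_const {e : V → Focus} (he : Function.Injective e) {M : Memory}
    {ρ : V → Bool} (hM : Holds e M ρ) (y : BitFn) (a : V × Bool) :
    Holds e ((Action.mk (e a.1) ⟨y, .const a.2⟩).perform M) (assign a ρ) := by
  classical
  intro v
  simp only [Action.perform, BitFn.const_apply, assign]
  by_cases hv : v = a.1
  · subst hv; simp
  · rw [Function.update_of_ne hv, Function.update_of_ne (he.ne hv), hM]

theorem exists_exec_of_step {e : V → Focus} (he : Function.Injective e) {X : List Instr}
    {u : FlatInstr (V × Bool) V} {n n' : ℕ} {ρ ρ' : V → Bool} {M : Memory}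
    (hu : X[n]? = some (u.toInstr e)) (h : u.Step assign testVar n ρ n' ρ') (hM : Holds e M ρ) :
    ∃ M', Holds e M' ρ' ∧ ∀ t, exec X (t + 1) n M = exec X t n' M' := by
  cases h with
  | act a => exact ⟨_, hM.perform_const he .zero a, fun t => by rw [exec, hu]; rfl⟩
  | skipIf_true _ hv | skipIf_false _ hv =>
    refine ⟨M, hM, fun t => ?_⟩
    rw [testVar, ← hM] at hv
    simp [exec, hu, FlatInstr.toInstr, Action.perform_ident, Action.reply, BitFn.apply, hv]
  | jump k => exact ⟨M, hM, fun t => by rw [exec, hu]; rfl⟩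
  | bjump k => exact ⟨M, hM, fun t => by simp [exec, hu, FlatInstr.toInstr]⟩

theorem exists_exec_of_flatSteps {e : V → Focus} (he : Function.Injective e) {X : List Instr}
    {Y : List (FlatInstr (V × Bool) V)}
    (hXY : ∀ (n : ℕ) (u : FlatInstr (V × Bool) V), Y[n]? = some u → X[n]? = some (u.toInstr e))
    {n n' t : ℕ} {ρ ρ' : V → Bool} (h : FlatSteps assign testVar Y n ρ t n' ρ') {M : Memory}
    (hM : Holds e M ρ) :
    ∃ M', Holds e M' ρ' ∧ ∃ k, ∀ t', exec X (t' + k) n M = exec X t' n' M' := by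
  induction h generalizing M with
  | refl => exact ⟨M, hM, 0, fun _ => rfl⟩
  | head hu hstep _ ih =>
    obtain ⟨M₁, hM₁, hexec₁⟩ := exists_exec_of_step he (hXY _ _ hu) hstep hM
    obtain ⟨M₂, hM₂, k, hexec₂⟩ := ih hM₁
    exact ⟨M₂, hM₂, k + 1, fun t' => by rw [← Nat.add_assoc, hexec₁, hexec₂]⟩

theorem Exec.exists_exec_code_term {e : V → Focus} (he : Function.Injective e) {p : RegProg V}
    {ρ τ : V → Bool} (h : Exec p ρ τ) {M : Memory} (hM : Holds e M ρ) (Z : List Instr) :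
    ∃ t M', exec (p.code e ++ .term :: Z) t 0 M = some M' ∧ Holds e M' τ := by
  obtain ⟨t, hrun⟩ := h
  have hcode : ∀ (n : ℕ) (u : FlatInstr (V × Bool) V), p.flat[n]? = some u →
      (p.code e ++ .term :: Z)[n]? = some (u.toInstr e) := by
    intro n u hu
    rw [List.getElem?_append_left (by simpa [Prog.code] using (List.getElem?_eq_some_iff.mp hu).1),
      Prog.code, List.getElem?_map, hu, Option.map_some]
  obtain ⟨M', hM', k, hexec⟩ :=
    exists_exec_of_flatSteps he hcode (flatSteps_of_run hrun (n := 0) (List.prefix_refl _)) hM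
  have hterm : (p.code e ++ .term :: Z)[0 + p.size]? = some .term := by
    simp [← p.length_code e]
  exact ⟨1 + k, M', by rw [hexec, exec, hterm], hM'⟩

theorem exec_mono {X : List Instr} {t t' : ℕ} (htt' : t ≤ t') {n : ℕ} {M M' : Memory}
    (h : exec X t n M = some M') : exec X t' n M = some M' := by
  induction t generalizing t' n M with
  | zero => simp [exec] at h
  | succ t ih =>
    obtain ⟨t', rfl⟩ := Nat.exists_eq_add_of_lt (Nat.lt_of_succ_le htt')
    have ht : t ≤ t + t' := by omega
    rw [exec] at h ⊢
    split at h <;> first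
      | exact h
      | exact ih ht h
      | (split at h; exacts [by rw [if_pos ‹_›]; exact ih ht h, nomatch h])

theorem mem_computed_iff {X : List Instr} {ρ : InReg → Bool} {β : OutReg → Bool} :
    β ∈ computed X ρ ↔
      ∃ t M, exec X t 0 (initMemory ρ) = some M ∧ (fun g : OutReg => M g.1) = β := by
  simp only [computed, Part.mem_map_iff]
  constructor
  · rintro ⟨M, hM, h⟩
    obtain ⟨t, ht⟩ := Nat.rfindOpt_spec hM
    exact ⟨t, M, ht, h⟩
  · rintro ⟨t, M, ht, h⟩
    exact ⟨M, (Nat.rfindOpt_mono fun hle hm => exec_mono hle hm).mpr ⟨t, ht⟩, h⟩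

end RegisterCode

/-! ### Derived register programs -/

section DerivedPrograms

variable {V ι : Type} {ρ ρ' ρ'' τ : V → Bool}

theorem Exec.skip (ρ : V → Bool) : Exec .skip ρ ρ := ⟨_, Run.skip ρ⟩

theorem Exec.act (a : V × Bool) (ρ : V → Bool) : Exec (.act a) ρ (assign a ρ) := ⟨_, Run.act a ρ⟩

theorem Exec.seq {p q : RegProg V} : Exec p ρ ρ' → Exec q ρ' ρ'' → Exec (.seq p q) ρ ρ''
  | ⟨_, h⟩, ⟨_, h'⟩ => ⟨_, h.seq h'⟩

theorem Exec.ite {c : V} {p q : RegProg V} (h : Exec (if ρ c then p else q) ρ ρ') :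
    Exec (.ite c p q) ρ ρ' := by
  obtain ⟨t, h⟩ := h
  cases hc : ρ c with
  | true => exact ⟨_, Run.ite_true hc (by simpa [hc] using h)⟩
  | false => exact ⟨_, Run.ite_false hc (by simpa [hc] using h)⟩

theorem Exec.loop_true {c : V} {p : RegProg V} (hc : ρ c = true) :
    Exec p ρ ρ' → Exec (.loop c p) ρ' ρ'' → Exec (.loop c p) ρ ρ''
  | ⟨_, h⟩, ⟨_, h'⟩ => ⟨_, Run.loop_true hc h h'⟩

theorem Exec.loop_false {c : V} {p : RegProg V} (hc : ρ c = false) :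
    Exec (.loop c p) ρ ρ := ⟨_, Run.loop_false hc⟩

theorem assign_self (v : V) (b : Bool) (ρ : V → Bool) : assign (v, b) ρ v = b := by
  simp [assign]

theorem assign_of_ne {v w : V} (h : w ≠ v) (b : Bool) (ρ : V → Bool) :
    assign (v, b) ρ w = ρ w := by
  simp [assign, h]

theorem eqOn_assign_of_notMem {E : Set V} {v : V} (hv : v ∉ E) (b : Bool) (ρ : V → Bool) :
    Set.EqOn (assign (v, b) ρ) ρ E :=
  fun _ hw => assign_of_ne (ne_of_mem_of_not_mem hw hv) b ρ

theorem eqOn_assign_congr {E : Set V} {v : V} (h : Set.EqOn ρ ρ' (E \ {v})) (b : Bool) :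
    Set.EqOn (assign (v, b) ρ) (assign (v, b) ρ') E := by
  intro w hw
  by_cases hwv : w = v
  · rw [hwv, assign_self, assign_self]
  · rw [assign_of_ne hwv, assign_of_ne hwv, h ⟨hw, hwv⟩]

/-- Assignment of a variable to a variable. -/
def copyVar (v w : V) : RegProg V := .ite w (.act (v, true)) (.act (v, false))

theorem exec_copyVar (v w : V) (ρ : V → Bool) : Exec (copyVar v w) ρ (assign (v, ρ w) ρ) := by
  refine Exec.ite ?_
  cases ρ w <;> exact Exec.act _ _

/-! #### Sequences and case distinctions -/

theorem exec_seqs_assign {p : ι → RegProg V} {d : ι → V} {f : ι → (V → Bool) → Bool}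
    (hp : ∀ i ρ, Exec (p i) ρ (assign (d i, f i ρ) ρ)) {l : List ι}
    (hl : l.Pairwise fun i j => d j ≠ d i ∧ ∀ ρ b, f j (assign (d i, b) ρ) = f j ρ)
    (ρ : V → Bool) :
    ∃ ρ', Exec (.seqs (l.map p)) ρ ρ' ∧ (∀ i ∈ l, ρ' (d i) = f i ρ) ∧
      ∀ v, (∀ i ∈ l, v ≠ d i) → ρ' v = ρ v := by
  induction l generalizing ρ with
  | nil => exact ⟨ρ, Exec.skip ρ, by simp, fun _ _ => rfl⟩
  | cons i l ih =>
    rw [List.pairwise_cons] at hl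
    obtain ⟨ρ', hexec, hassigned, hrest⟩ := ih hl.2 (assign (d i, f i ρ) ρ)
    refine ⟨ρ', (hp i ρ).seq hexec, List.forall_mem_cons.mpr ⟨?_, fun j hj => ?_⟩, fun v hv => ?_⟩
    · rw [hrest _ fun k hk => (hl.1 k hk).1.symm, assign_self]
    · rw [hassigned j hj, (hl.1 j hj).2]
    · obtain ⟨hvi, hvl⟩ := List.forall_mem_cons.mp hv
      rw [hrest v hvl, assign_of_ne hvi]

theorem exec_seqs_const {d : ι → V} (hd : Function.Injective d) (b : ι → Bool)
    {l : List ι} (hl : l.Nodup) (ρ : V → Bool) :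
    ∃ ρ', Exec (.seqs (l.map fun i => .act (d i, b i))) ρ ρ' ∧ (∀ i ∈ l, ρ' (d i) = b i) ∧
      ∀ v, (∀ i ∈ l, v ≠ d i) → ρ' v = ρ v :=
  exec_seqs_assign (f := fun i _ => b i) (fun _ ρ => Exec.act _ ρ)
    (hl.imp fun h => ⟨fun h' => h (hd h').symm, fun _ _ => rfl⟩) ρ

theorem size_seqs_map_le {A C : Type} {p : ι → Prog A C} {l : List ι} {n : ℕ}
    (h : ∀ i ∈ l, (p i).size ≤ n) : (Prog.seqs (l.map p)).size ≤ l.length * n := by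
  induction l with
  | nil => simp [Prog.seqs, Prog.size]
  | cons i l ih =>
    obtain ⟨hi, hl⟩ := List.forall_mem_cons.mp h
    rw [List.map_cons, Prog.seqs, Prog.size, List.length_cons, Nat.succ_mul, Nat.add_comm]
    exact Nat.add_le_add (ih hl) hi

/-- Case distinction: the first variable `c i` which holds selects the program `p i`; if there is
none, `q` is selected. -/
def switch (c : ι → V) (p : ι → RegProg V) (q : RegProg V) : List ι → RegProg V
  | [] => q
  | i :: l => .ite (c i) (p i) (switch c p q l)

theorem exec_switch {c : ι → V} {p : ι → RegProg V} {i : ι} (hc : ∀ j, ρ (c j) = true ↔ j = i)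
    (hi : Exec (p i) ρ ρ') (q : RegProg V) {l : List ι} (hl : i ∈ l) :
    Exec (switch c p q l) ρ ρ' := by
  induction l with
  | nil => simp at hl
  | cons j l ih =>
    refine Exec.ite ?_
    by_cases hj : ρ (c j) = true
    · rwa [if_pos hj, (hc j).mp hj]
    · rw [if_neg hj]
      exact ih ((List.mem_cons.mp hl).resolve_left fun hij => hj ((hc j).mpr hij.symm))

theorem exec_switch_default {c : ι → V} (hc : ∀ j, ρ (c j) = false) {q : RegProg V}
    (hq : Exec q ρ ρ') (p : ι → RegProg V) (l : List ι) : Exec (switch c p q l) ρ ρ' := by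
  induction l with
  | nil => exact hq
  | cons j l ih =>
    refine Exec.ite ?_
    rw [hc j]
    exact ih

theorem size_switch_le (c : ι → V) {p : ι → RegProg V} (q : RegProg V) {l : List ι} {n : ℕ}
    (h : ∀ i ∈ l, (p i).size ≤ n) :
    (switch c p q l).size ≤ l.length * (n + 3) + q.size := by
  induction l with
  | nil => simp [switch]
  | cons i l ih =>
    obtain ⟨hi, hl⟩ := List.forall_mem_cons.mp h
    simp only [switch, Prog.size, List.length_cons, Nat.succ_mul]
    have := ih hl
    omega

/-! #### Loops over all values of some variables -/

/-- Run `p` for both values of the variable `v`; the variable `d` controls the loop. -/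
def forBit (v d : V) (p : RegProg V) : RegProg V :=
  .seq (.act (v, false)) <| .seq (.act (d, true)) <| .loop d <| .seq p <|
    .ite v (.act (d, false)) (.seq (.act (v, true)) (.act (d, true)))

/-- Nested loops over all values of the given variables. -/
def forBits (d : V) (p : RegProg V) : List V → RegProg V
  | [] => p
  | v :: l => forBit v d (forBits d p l)

theorem size_forBits (d : V) (p : RegProg V) (l : List V) :
    (forBits d p l).size = p.size + 11 * l.length := by
  induction l with
  | nil => rfl
  | cons v l ih =>
    simp only [forBits, forBit, Prog.size, ih, List.length_cons]
    omega

theorem exec_forBit {v d : V} {p : RegProg V}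
    (h₀ : Exec p (assign (d, true) (assign (v, false) ρ)) ρ') (hv₀ : ρ' v = false)
    (h₁ : Exec p (assign (d, true) (assign (v, true) ρ')) ρ'') (hv₁ : ρ'' v = true) :
    Exec (forBit v d p) ρ (assign (d, false) ρ'') := by
  refine (Exec.act _ _).seq ((Exec.act _ _).seq
    (Exec.loop_true (assign_self _ _ _) (h₀.seq (Exec.ite ?_))
      (Exec.loop_true (assign_self d _ _) (h₁.seq (Exec.ite ?_))
        (Exec.loop_false (assign_self _ _ _)))))
  · rw [hv₀]
    exact (Exec.act _ _).seq (Exec.act _ _)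
  · rw [hv₁]
    exact Exec.act _ _

/-- The program `p` leaves the variables in `E` alone and adds to the variable `o`, as a
disjunction, the property `P` of the valuation. -/
def Accumulates (E : Set V) (o : V) (p : RegProg V) (P : (V → Bool) → Prop) : Prop :=
  ∀ ρ, ∃ ρ', Exec p ρ ρ' ∧ Set.EqOn ρ' ρ E ∧ (ρ' o = true ↔ ρ o = true ∨ P ρ)

theorem Accumulates.forBit {E : Set V} {o v d : V} {p : RegProg V} {P : (V → Bool) → Prop}
    (hp : Accumulates E o p P) (hP : DependsOn P E) (hv : v ∈ E) (hd : d ∉ E) (ho : o ∉ E)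
    (hdo : d ≠ o) :
    Accumulates (E \ {v}) o (forBit v d p) fun ρ => ∃ b, P (assign (v, b) ρ) := by
  intro ρ
  have hov : o ≠ v := (ne_of_mem_of_not_mem hv ho).symm
  obtain ⟨ρ₁, hexec₁, hE₁, ho₁⟩ := hp (assign (d, true) (assign (v, false) ρ))
  replace hE₁ := hE₁.trans (eqOn_assign_of_notMem hd _ _)
  obtain ⟨ρ₂, hexec₂, hE₂, ho₂⟩ := hp (assign (d, true) (assign (v, true) ρ₁))
  have hρ₁ : Set.EqOn ρ₁ ρ (E \ {v}) := (hE₁.mono Set.sdiff_subset).trans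
    (eqOn_assign_of_notMem (by simp) _ _)
  have hrestart : Set.EqOn (assign (d, true) (assign (v, true) ρ₁)) (assign (v, true) ρ) E :=
    (eqOn_assign_of_notMem hd _ _).trans (eqOn_assign_congr hρ₁ _)
  replace hE₂ := hE₂.trans hrestart
  refine ⟨_, exec_forBit hexec₁ ((hE₁ hv).trans (assign_self _ _ _)) hexec₂
    ((hE₂ hv).trans (assign_self _ _ _)), ?_, ?_⟩
  · exact (eqOn_assign_of_notMem (fun h => hd h.1) _ _).trans
      ((hE₂.mono Set.sdiff_subset).trans (eqOn_assign_of_notMem (by simp) _ _))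
  · rw [assign_of_ne hdo.symm, ho₂, hP hrestart, assign_of_ne hdo.symm, assign_of_ne hov, ho₁,
      hP (eqOn_assign_of_notMem hd _ _), assign_of_ne hdo.symm, assign_of_ne hov,
      or_assoc]
    exact or_congr_right (Bool.exists_bool (p := fun b => P (assign (v, b) ρ))).symm

theorem Accumulates.congr {E F : Set V} {o : V} {p : RegProg V} {P Q : (V → Bool) → Prop}
    (hp : Accumulates E o p P) (hFE : F ⊆ E) (hPQ : ∀ ρ, P ρ ↔ Q ρ) : Accumulates F o p Q := by
  intro ρ
  obtain ⟨ρ', hexec, hE, ho⟩ := hp ρ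
  exact ⟨ρ', hexec, hE.mono hFE, ho.trans (or_congr_right (hPQ ρ))⟩

theorem Accumulates.forBits {E : Set V} {o d : V} {p : RegProg V} {P : (V → Bool) → Prop}
    (hp : Accumulates E o p P) (hP : DependsOn P E) (hd : d ∉ E) (ho : o ∉ E) (hdo : d ≠ o)
    {l : List V} (hl : l.Nodup) (hlE : ∀ v ∈ l, v ∈ E) :
    Accumulates (E \ {v | v ∈ l}) o (forBits d p l)
      fun ρ => ∃ ρ', Set.EqOn ρ' ρ (E \ {v | v ∈ l}) ∧ P ρ' := by
  induction l with
  | nil =>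
    refine hp.congr Set.sdiff_subset fun ρ => ⟨fun h => ⟨ρ, fun _ _ => rfl, h⟩, ?_⟩
    rintro ⟨ρ', hρ', h⟩
    rwa [← hP (show ∀ w ∈ E, ρ' w = ρ w from fun w hw => hρ' (by simpa using hw))]
  | cons v l ih =>
    obtain ⟨hvl, hl⟩ := List.nodup_cons.mp hl
    obtain ⟨hvE, hlE⟩ := List.forall_mem_cons.mp hlE
    have hinsert : E \ {w | w ∈ v :: l} = (E \ {w | w ∈ l}) \ {v} := by
      ext w
      simp only [Set.mem_sdiff, Set.mem_ofPred_eq, List.mem_cons, Set.mem_singleton_iff]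
      tauto
    have hdep : DependsOn (fun ρ => ∃ ρ', Set.EqOn ρ' ρ (E \ {w | w ∈ l}) ∧ P ρ')
        (E \ {w | w ∈ l}) := fun ρ τ (h : Set.EqOn ρ τ _) => propext
      ⟨fun ⟨ρ', hρ', h'⟩ => ⟨ρ', hρ'.trans h, h'⟩,
        fun ⟨ρ', hρ', h'⟩ => ⟨ρ', hρ'.trans h.symm, h'⟩⟩
    refine ((ih hl hlE).forBit hdep ⟨hvE, hvl⟩ (fun h => hd h.1) (fun h => ho h.1) hdo).congr
      hinsert.subset fun ρ => ⟨?_, ?_⟩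
    · rintro ⟨b, ρ', hρ', h⟩
      rw [hinsert]
      exact ⟨ρ', (hρ'.mono Set.sdiff_subset).trans (eqOn_assign_of_notMem (by simp) _ _), h⟩
    · rintro ⟨ρ', hρ', h⟩
      rw [hinsert] at hρ'
      classical
      refine ⟨ρ' v, ρ', fun w hw => ?_, h⟩
      rw [← eqOn_assign_congr hρ' (ρ' v) hw, assign, Function.update_eq_self]

end DerivedPrograms

/-! ### Stack machines on registers -/

section Statements

variable {K Λ σ : Type} {Γ : K → Type}

/-- The number of symbols that a statement pushes at most. -/
def pushes : TM2.Stmt Γ Λ σ → ℕ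
  | .push _ _ q => pushes q + 1
  | .peek _ _ q | .pop _ _ q | .load _ q => pushes q
  | .branch _ q₁ q₂ => pushes q₁ + pushes q₂
  | .goto _ | .halt => 0

/-- The statement pushes only symbols from `syms`. -/
def PushesIn (syms : ∀ k, Finset (Γ k)) : TM2.Stmt Γ Λ σ → Prop
  | .push k f q => (∀ v, f v ∈ syms k) ∧ PushesIn syms q
  | .peek _ _ q | .pop _ _ q | .load _ q => PushesIn syms q
  | .branch _ q₁ q₂ => PushesIn syms q₁ ∧ PushesIn syms q₂
  | .goto _ | .halt => True

variable [DecidableEq K]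

theorem length_update_cons_le (S : ∀ k, List (Γ k)) (k : K) (g : Γ k) (k' : K) :
    (Function.update S k (g :: S k) k').length ≤ (S k').length + 1 := by
  by_cases h : k' = k
  · subst h; simp
  · simp [h]

theorem length_update_tail_le (S : ∀ k, List (Γ k)) (k k' : K) :
    (Function.update S k (S k).tail k').length ≤ (S k').length := by
  by_cases h : k' = k
  · subst h; simp
  · simp [h]

theorem length_stepAux_le (q : TM2.Stmt Γ Λ σ) (v : σ) (S : ∀ k, List (Γ k)) (k : K) :
    ((TM2.stepAux q v S).stk k).length ≤ (S k).length + pushes q := by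
  induction q generalizing v S with
  | push k' f q ih =>
    have := length_update_cons_le S k' (f v) k
    exact (ih _ _).trans (by rw [pushes]; omega)
  | pop k' f q ih => exact (ih _ _).trans (Nat.add_le_add_right (length_update_tail_le S k' k) _)
  | peek _ _ _ ih | load _ _ ih => exact ih _ _
  | branch f q₁ q₂ ih₁ ih₂ =>
    rw [TM2.stepAux, pushes]
    cases f v
    · exact (ih₂ _ _).trans (by omega)
    · exact (ih₁ _ _).trans (by omega)
  | goto f | halt => exact le_rfl

end Statements

/-- The variables of a register program that searches for a witness of length at most `W` for an
input of length `m`, simulating the stack machine `tm` with stacks of height at most `B + 1` and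
symbols from `syms`: input and output, stack cells, one-hot control state, run flag, candidate
witness, and the control variable of the search loops. -/
inductive Var (tm : FinTM2) (syms : ∀ k, Finset (tm.Γ k)) (m W B : ℕ) : Type
  | inp (i : Fin m)
  | out
  | cell (i : Fin (B + 1)) (k : tm.K) (g : {g // g ∈ syms k})
  | st (c : tm.Λ × tm.σ)
  | running
  | choice (c : Fin W × Bool)
  | again

section SearchPrograms

variable {tm : FinTM2} {syms : ∀ k, Finset (tm.Γ k)} {m W B : ℕ}

attribute [local instance] FinTM2.kFin FinTM2.ΛFin FinTM2.σFin

local notation "𝕍" => Var tm syms m W B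

/-- The variables that are not used by the simulation of `tm`. -/
def Var.externals : Set 𝕍 := Set.range .inp ∪ {.out} ∪ Set.range .choice

/-- The stack cells. -/
def Var.cells : Set 𝕍 := {v | ∃ i k g, v = .cell i k g}

theorem Var.cell_mem_cells (i : Fin (B + 1)) (k : tm.K) (g : {g // g ∈ syms k}) :
    (.cell i k g : 𝕍) ∈ Var.cells :=
  ⟨i, k, g, rfl⟩

theorem Var.externals_subset_compl_cells : (Var.externals : Set 𝕍) ⊆ Var.cellsᶜ := by
  rintro _ ((⟨i, rfl⟩ | rfl) | ⟨c, rfl⟩) ⟨i, k, g, h⟩ <;> cases h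

/-- The valuation represents the stacks: `cell i k g` tells whether the symbol `g` is at depth `i`
in stack `k`. -/
structure Represents (ρ : 𝕍 → Bool) (S : ∀ k, List (tm.Γ k)) : Prop where
  cell : ∀ i k g, ρ (.cell i k g) = true ↔ (S k)[(i : ℕ)]? = some g.1
  mem : ∀ k, ∀ g ∈ S k, g ∈ syms k

theorem Represents.congr {ρ ρ' : 𝕍 → Bool} {S : ∀ k, List (tm.Γ k)} (hR : Represents ρ S)
    (h : Set.EqOn ρ' ρ Var.cells) : Represents ρ' S :=
  ⟨fun i k g => by rw [h (Var.cell_mem_cells i k g), hR.cell], hR.mem⟩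

theorem Represents.update {ρ ρ' : 𝕍 → Bool} {S : ∀ k, List (tm.Γ k)} (hR : Represents ρ S)
    {k : tm.K} {l : List (tm.Γ k)} (hl : ∀ g ∈ l, g ∈ syms k)
    (hk : ∀ i g, ρ' (.cell i k g) = true ↔ l[(i : ℕ)]? = some g.1)
    (hrest : ∀ v, (∀ i g, v ≠ .cell i k g) → ρ' v = ρ v) :
    Represents ρ' (Function.update S k l) := by
  constructor
  · intro i k' g
    by_cases h : k' = k
    · subst h
      rw [hk, Function.update_self]
    · rw [hrest _ (by simp [h]), hR.cell, Function.update_of_ne h]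
  · intro k' g hg
    by_cases h : k' = k
    · subst h
      rw [Function.update_self] at hg
      exact hl g hg
    · rw [Function.update_of_ne h] at hg
      exact hR.mem k' g hg

/-! #### Pushing and popping -/

/-- All pairs of a depth and a symbol, by increasing depth. -/
noncomputable def cellList (syms : ∀ k, Finset (tm.Γ k)) (B : ℕ) (k : tm.K) :
    List (Fin (B + 1) × {g // g ∈ syms k}) :=
  List.finRange (B + 1) ×ˢ (Finset.univ : Finset {g // g ∈ syms k}).toList

theorem mem_cellList (k : tm.K) (c : Fin (B + 1) × {g // g ∈ syms k}) : c ∈ cellList syms B k :=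
  List.mem_product.mpr ⟨List.mem_finRange _, Finset.mem_toList.mpr (Finset.mem_univ _)⟩

theorem length_cellList (k : tm.K) : (cellList syms B k).length = (B + 1) * (syms k).card := by
  simp [cellList, List.length_product]

theorem pairwise_cellList (k : tm.K) :
    (cellList syms B k).Pairwise fun c c' => c ≠ c' ∧ c.1 ≤ c'.1 := by
  change (List.flatMap _ _).Pairwise _
  rw [List.pairwise_flatMap]
  refine ⟨fun i _ => ?_, (List.pairwise_lt_finRange _).imp fun {i j} hij => ?_⟩
  · rw [List.pairwise_map]
    exact (Finset.nodup_toList _).imp fun h => ⟨fun h' => h (congrArg Prod.snd h'), le_rfl⟩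
  · simp only [List.mem_map]
    rintro _ ⟨g, -, rfl⟩ _ ⟨g', -, rfl⟩
    exact ⟨fun h => hij.ne (congrArg Prod.fst h), hij.le⟩

/-- Move the symbols of stack `k`: depth `i` takes its symbol from depth `src i` or, if this is
`none`, is set according to `b`. The cells are treated in the order of the list `l`. -/
def shiftCode (k : tm.K) (src : Fin (B + 1) → Option (Fin (B + 1))) (b : {g // g ∈ syms k} → Bool)
    (l : List (Fin (B + 1) × {g // g ∈ syms k})) : RegProg 𝕍 :=
  .seqs <| l.map fun c => (src c.1).elim (.act (.cell c.1 k c.2, b c.2)) fun j =>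
    copyVar (.cell c.1 k c.2) (.cell j k c.2)

theorem size_shiftCode_le (k : tm.K) (src : Fin (B + 1) → Option (Fin (B + 1)))
    (b : {g // g ∈ syms k} → Bool) (l : List (Fin (B + 1) × {g // g ∈ syms k})) :
    (shiftCode k src b l : RegProg 𝕍).size ≤ l.length * 5 := by
  refine size_seqs_map_le fun c _ => ?_
  cases src c.1 <;> simp [copyVar, Prog.size]

theorem exec_shiftCode {k : tm.K} {src : Fin (B + 1) → Option (Fin (B + 1))}
    {l : List (Fin (B + 1) × {g // g ∈ syms k})}
    (hsrc : l.Pairwise fun c c' => c ≠ c' ∧ src c'.1 ≠ some c.1) (hl : ∀ c, c ∈ l)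
    (b : {g // g ∈ syms k} → Bool) (ρ : 𝕍 → Bool) :
    ∃ ρ', Exec (shiftCode k src b l) ρ ρ' ∧
      (∀ i g, ρ' (.cell i k g) = (src i).elim (b g) fun j => ρ (.cell j k g)) ∧
      ∀ v, (∀ i g, v ≠ .cell i k g) → ρ' v = ρ v := by
  have hindep : l.Pairwise fun c c' => (.cell c'.1 k c'.2 : 𝕍) ≠ .cell c.1 k c.2 ∧
      ∀ (ρ : 𝕍 → Bool) b', ((src c'.1).elim (b c'.2) fun j => assign (.cell c.1 k c.2, b') ρ
        (.cell j k c'.2)) = (src c'.1).elim (b c'.2) fun j => ρ (.cell j k c'.2) := by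
    refine hsrc.imp fun {c c'} h => ⟨fun heq => h.1 ?_, fun ρ b => ?_⟩
    · simp only [Var.cell.injEq, heq_eq_eq, true_and] at heq
      exact (Prod.ext heq.1 heq.2).symm
    · cases hj : src c'.1 with
      | none => rfl
      | some j =>
        refine assign_of_ne (fun heq => h.2 ?_) _ _
        simp only [Var.cell.injEq] at heq
        rw [hj, heq.1]
  obtain ⟨ρ', hexec, hcell, hrest⟩ := exec_seqs_assign
    (ι := Fin (B + 1) × {g // g ∈ syms k})
    (p := fun c => (src c.1).elim (.act (.cell c.1 k c.2, b c.2)) fun j =>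
      copyVar (.cell c.1 k c.2) (.cell j k c.2))
    (f := fun c ρ => (src c.1).elim (b c.2) fun j => ρ (.cell j k c.2))
    (fun c ρ => by
      cases src c.1
      exacts [Exec.act _ _, exec_copyVar _ _ _]) hindep ρ
  exact ⟨ρ', hexec, fun i g => hcell (i, g) (hl _), fun v hv => hrest v fun c _ => hv c.1 c.2⟩

open Classical in
/-- Push the symbol `g` on stack `k`. -/
noncomputable def pushCode (k : tm.K) (g : tm.Γ k) : RegProg 𝕍 :=
  shiftCode k (Fin.cons none fun j => some j.castSucc) (fun g' => decide (g'.1 = g))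
    (cellList syms B k).reverse

/-- Remove the top symbol of stack `k`. -/
noncomputable def popCode (k : tm.K) : RegProg 𝕍 :=
  shiftCode k (Fin.snoc (α := fun _ => Option (Fin (B + 1))) (fun j => some j.succ) none)
    (fun _ => false) (cellList syms B k)

theorem size_pushCode_le (k : tm.K) (g : tm.Γ k) :
    (pushCode k g : RegProg 𝕍).size ≤ (B + 1) * (syms k).card * 5 := by
  rw [← length_cellList, ← List.length_reverse]
  exact size_shiftCode_le _ _ _ _

theorem size_popCode_le (k : tm.K) :
    (popCode k : RegProg 𝕍).size ≤ (B + 1) * (syms k).card * 5 := by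
  rw [← length_cellList]
  exact size_shiftCode_le _ _ _ _

theorem exec_pushCode {ρ : 𝕍 → Bool} {S : ∀ k, List (tm.Γ k)} (hR : Represents ρ S) (k : tm.K)
    {g : tm.Γ k} (hg : g ∈ syms k) :
    ∃ ρ', Exec (pushCode k g) ρ ρ' ∧ Represents ρ' (Function.update S k (g :: S k)) ∧
      Set.EqOn ρ' ρ Var.cellsᶜ := by
  classical
  have hsrc : (cellList syms B k).reverse.Pairwise fun c c' => c ≠ c' ∧
      (Fin.cons none fun j => some j.castSucc : Fin (B + 1) → Option (Fin (B + 1))) c'.1 ≠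
        some c.1 := by
    refine List.pairwise_reverse.mpr ((pairwise_cellList k).imp ?_)
    rintro ⟨i, g₁⟩ ⟨j, g₂⟩ ⟨hne, hij⟩
    refine ⟨hne.symm, ?_⟩
    cases i using Fin.cases with
    | zero => simp
    | succ i =>
      simp only [Fin.cons_succ, ne_eq, Option.some_inj]
      rintro rfl
      exact absurd hij (by simp [Fin.le_def])
  obtain ⟨ρ', hexec, hcell, hrest⟩ := exec_shiftCode hsrc
    (fun c => List.mem_reverse.mpr (mem_cellList k c)) (fun g' => decide (g'.1 = g)) ρ
  refine ⟨ρ', hexec, hR.update (List.forall_mem_cons.mpr ⟨hg, hR.mem k⟩) (fun i g' => ?_) hrest,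
    fun v hv => hrest v fun i g' h => hv ⟨i, k, g', h⟩⟩
  rw [hcell]
  cases i using Fin.cases with
  | zero => simp [eq_comm]
  | succ i => simp [hR.cell]

theorem exec_popCode {ρ : 𝕍 → Bool} {S : ∀ k, List (tm.Γ k)} (hR : Represents ρ S) (k : tm.K)
    (hB : (S k).length ≤ B + 1) :
    ∃ ρ', Exec (popCode k) ρ ρ' ∧ Represents ρ' (Function.update S k (S k).tail) ∧
      Set.EqOn ρ' ρ Var.cellsᶜ := by
  have hsrc : (cellList syms B k).Pairwise fun c c' => c ≠ c' ∧
      Fin.snoc (α := fun _ => Option (Fin (B + 1))) (fun j => some j.succ) none c'.1 ≠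
        some c.1 := by
    refine (pairwise_cellList k).imp ?_
    rintro ⟨i, g₁⟩ ⟨j, g₂⟩ ⟨hne, hij⟩
    refine ⟨hne, ?_⟩
    cases j using Fin.lastCases with
    | last => simp
    | cast j =>
      simp only [Fin.snoc_castSucc, ne_eq, Option.some_inj]
      rintro rfl
      exact absurd hij (by simp [Fin.le_def])
  obtain ⟨ρ', hexec, hcell, hrest⟩ := exec_shiftCode hsrc (mem_cellList k) (fun _ => false) ρ
  refine ⟨ρ', hexec, hR.update (fun g hg => hR.mem k g (List.mem_of_mem_tail hg)) (fun i g' => ?_)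
    hrest, fun v hv => hrest v fun i g' h => hv ⟨i, k, g', h⟩⟩
  rw [hcell]
  cases i using Fin.lastCases with
  | last => simp [List.getElem?_eq_none hB]
  | cast i => simp [hR.cell]

/-- Case distinction on the top of stack `k`. -/
noncomputable def topSwitch (k : tm.K) (p : Option (tm.Γ k) → RegProg 𝕍) : RegProg 𝕍 :=
  switch (fun g => .cell 0 k g) (fun g => p (some g.1)) (p none)
    (Finset.univ : Finset {g // g ∈ syms k}).toList

theorem exec_topSwitch {ρ ρ' : 𝕍 → Bool} {S : ∀ k, List (tm.Γ k)} (hR : Represents ρ S)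
    {k : tm.K} {p : Option (tm.Γ k) → RegProg 𝕍} (h : Exec (p (S k).head?) ρ ρ') :
    Exec (topSwitch k p) ρ ρ' := by
  cases hS : S k with
  | nil =>
    rw [hS] at h
    refine exec_switch_default (fun g => ?_) h _ _
    rw [Bool.eq_false_iff, Ne, hR.cell, hS]
    simp
  | cons g l =>
    rw [hS] at h
    have hg : g ∈ syms k := hR.mem k g (hS ▸ List.mem_cons_self)
    refine exec_switch (i := (⟨g, hg⟩ : {g // g ∈ syms k})) (fun g' => ?_) h _
      (Finset.mem_toList.mpr (Finset.mem_univ _))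
    rw [hR.cell, hS]
    simp [Subtype.ext_iff, eq_comm]

/-! #### Statements and steps -/

open Classical in
/-- Set the control state. -/
noncomputable def setState (c : tm.Λ × tm.σ) : RegProg 𝕍 :=
  .seq (.act (.running, true)) <| .seqs <|
    (Finset.univ : Finset (tm.Λ × tm.σ)).toList.map fun d => .act (.st d, decide (d = c))

/-- The valuation represents the control state, where the label `none` stands for a halted machine,
whose internal state is not kept. -/
def HasState (ρ : 𝕍 → Bool) (l : Option tm.Λ) (v : tm.σ) : Prop :=
  match l with
  | none => ρ .running = false
  | some l => ρ .running = true ∧ ∀ c, ρ (.st c) = true ↔ c = (l, v)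

theorem exec_setState (ρ : 𝕍 → Bool) (l : tm.Λ) (v : tm.σ) :
    ∃ ρ', Exec (setState (l, v)) ρ ρ' ∧ HasState ρ' (some l) v ∧
      Set.EqOn ρ' ρ (Var.externals ∪ Var.cells) := by
  classical
  obtain ⟨ρ', hexec, hstate, hrest⟩ := exec_seqs_const (V := 𝕍) (d := Var.st)
    (fun _ _ h => by simpa using h) (fun c => decide (c = (l, v)))
    (Finset.nodup_toList (Finset.univ : Finset (tm.Λ × tm.σ))) (assign (.running, true) ρ)
  refine ⟨ρ', (Exec.act _ _).seq hexec, ⟨?_, fun c => ?_⟩, fun w hw => ?_⟩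
  · rw [hrest _ (by simp), assign_self]
  · simp [hstate c (by simp)]
  · rw [hrest w, assign_of_ne]
    · rintro rfl
      simp [Var.externals, Var.cells] at hw
    · rintro c - rfl
      simp [Var.externals, Var.cells] at hw

/-- The code of a statement of the stack machine, for a given internal state. -/
noncomputable def stmtCode : TM2.Stmt tm.Γ tm.Λ tm.σ → tm.σ → RegProg 𝕍
  | .push k f q, v => .seq (pushCode k (f v)) (stmtCode q v)
  | .peek k f q, v => topSwitch k fun o => stmtCode q (f v o)
  | .pop k f q, v => topSwitch k fun o => .seq (popCode k) (stmtCode q (f v o))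
  | .load f q, v => stmtCode q (f v)
  | .branch f q₁ q₂, v => if f v then stmtCode q₁ v else stmtCode q₂ v
  | .goto f, v => setState (f v, v)
  | .halt, _ => .act (.running, false)

theorem exec_stmtCode {q : TM2.Stmt tm.Γ tm.Λ tm.σ} (hq : PushesIn syms q) (v : tm.σ)
    {ρ : 𝕍 → Bool} {S : ∀ k, List (tm.Γ k)} (hR : Represents ρ S)
    (hB : ∀ k, (S k).length + pushes q ≤ B) :
    ∃ ρ', Exec (stmtCode q v) ρ ρ' ∧ Represents ρ' (TM2.stepAux q v S).stk ∧
      HasState ρ' (TM2.stepAux q v S).l (TM2.stepAux q v S).var ∧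
      Set.EqOn ρ' ρ Var.externals := by
  induction q generalizing v ρ S with
  | push k f q ih =>
    obtain ⟨ρ₁, hexec₁, hR₁, hρ₁⟩ := exec_pushCode hR k (hq.1 v)
    obtain ⟨ρ₂, hexec₂, hR₂, hstate, hρ₂⟩ := ih hq.2 v hR₁ fun k' => by
      have := hB k'
      have := length_update_cons_le S k (f v) k'
      rw [pushes] at *
      omega
    exact ⟨ρ₂, hexec₁.seq hexec₂, hR₂, hstate,
      hρ₂.trans (hρ₁.mono Var.externals_subset_compl_cells)⟩
  | peek k f q ih =>
    obtain ⟨ρ', hexec, h⟩ := ih hq (f v (S k).head?) hR hB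
    exact ⟨ρ', exec_topSwitch hR hexec, h⟩
  | pop k f q ih =>
    obtain ⟨ρ₁, hexec₁, hR₁, hρ₁⟩ := exec_popCode hR k (by have := hB k; omega)
    obtain ⟨ρ₂, hexec₂, hR₂, hstate, hρ₂⟩ := ih hq (f v (S k).head?) hR₁ fun k' =>
      (Nat.add_le_add_right (length_update_tail_le S k k') _).trans (hB k')
    exact ⟨ρ₂, exec_topSwitch hR (hexec₁.seq hexec₂), hR₂, hstate,
      hρ₂.trans (hρ₁.mono Var.externals_subset_compl_cells)⟩
  | load f q ih => exact ih hq (f v) hR hB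
  | branch f q₁ q₂ ih₁ ih₂ =>
    simp only [pushes] at hB
    rw [stmtCode, TM2.stepAux]
    cases f v
    · exact ih₂ hq.2 v hR fun k => by have := hB k; omega
    · exact ih₁ hq.1 v hR fun k => by have := hB k; omega
  | goto f =>
    obtain ⟨ρ', hexec, hstate, hρ'⟩ := exec_setState ρ (f v) v
    exact ⟨ρ', hexec, hR.congr (hρ'.mono Set.subset_union_right), hstate,
      hρ'.mono Set.subset_union_left⟩
  | halt =>
    exact ⟨_, Exec.act _ _, hR.congr (eqOn_assign_of_notMem (by simp [Var.cells]) _ _),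
      assign_self _ _ _, eqOn_assign_of_notMem (by simp [Var.externals]) _ _⟩

/-- One step of the stack machine. -/
noncomputable def stepCode : RegProg 𝕍 :=
  switch (fun c => .st c) (fun c => stmtCode (tm.m c.1) c.2) .skip
    (Finset.univ : Finset (tm.Λ × tm.σ)).toList

theorem exec_loop_stepCode (hm : ∀ l, PushesIn syms (tm.m l)) {P : ℕ}
    (hP : ∀ l, pushes (tm.m l) ≤ P) {n : ℕ} {c c' : TM2.Cfg tm.Γ tm.Λ tm.σ} (hc' : c'.l = none)
    (hsteps : (flip bind (TM2.step tm.m))^[n] (some c) = some c') {ρ : 𝕍 → Bool}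
    (hR : Represents ρ c.stk) (hstate : HasState ρ c.l c.var)
    (hB : ∀ k, (c.stk k).length + n * P ≤ B) :
    ∃ ρ', Exec (.loop .running stepCode) ρ ρ' ∧ Represents ρ' c'.stk ∧
      Set.EqOn ρ' ρ Var.externals := by
  induction n generalizing c ρ with
  | zero =>
    obtain rfl : c = c' := Option.some_inj.mp hsteps
    rw [hc'] at hstate
    exact ⟨ρ, Exec.loop_false hstate, hR, fun _ _ => rfl⟩
  | succ n ih =>
    obtain ⟨l, v, S⟩ := c
    rw [Function.iterate_succ_apply] at hsteps
    cases l with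
    | none =>
      have hnone : (flip bind (TM2.step tm.m))^[n] none = none := Function.iterate_fixed rfl n
      exact absurd (hnone.symm.trans hsteps) (by simp)
    | some l =>
      have hPl := hP l
      simp only [Nat.succ_mul] at hB
      obtain ⟨ρ₁, hexec₁, hR₁, hstate₁, hρ₁⟩ := exec_stmtCode (hm l) v hR
        fun k => by have := hB k; dsimp only; omega
      obtain ⟨ρ₂, hexec₂, hR₂, hρ₂⟩ := ih hsteps hR₁ hstate₁ fun k => by
        have := hB k
        have := length_stepAux_le (tm.m l) v S k
        omega
      exact ⟨ρ₂, Exec.loop_true hstate.1 (exec_switch hstate.2 hexec₁ _ (by simp)) hexec₂, hR₂,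
        hρ₂.trans hρ₁⟩

/-! #### Loading the stacks -/

/-- Empty all stacks. -/
noncomputable def clearCode : RegProg 𝕍 :=
  .seqs <| (Finset.univ : Finset (Fin (B + 1) × Σ k, {g // g ∈ syms k})).toList.map fun c =>
    .act (.cell c.1 c.2.1 c.2.2, false)

theorem exec_clearCode (ρ : 𝕍 → Bool) :
    ∃ ρ', Exec clearCode ρ ρ' ∧ Represents ρ' (fun _ => []) ∧ Set.EqOn ρ' ρ Var.cellsᶜ := by
  have hinj : Function.Injective fun c : Fin (B + 1) × Σ k, {g // g ∈ syms k} =>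
      (.cell c.1 c.2.1 c.2.2 : 𝕍) := by
    rintro ⟨i, k, g⟩ ⟨i', k', g'⟩ h
    simp only [Var.cell.injEq] at h
    obtain ⟨rfl, rfl, h⟩ := h
    rw [eq_of_heq h]
  obtain ⟨ρ', hexec, hcell, hrest⟩ := exec_seqs_const hinj (fun _ => false)
    (Finset.nodup_toList Finset.univ) ρ
  refine ⟨ρ', hexec, ⟨fun i k g => ?_, by simp⟩, fun v hv => hrest v fun c _ hc =>
    hv ⟨_, _, _, hc⟩⟩
  simp [hcell (i, ⟨k, g⟩) (by simp)]

/-- The program `p` pushes on stack `k` the symbols `l ρ` that depend on the valuation `ρ`. -/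
def Loads (k : tm.K) (p : RegProg 𝕍) (l : (𝕍 → Bool) → List (tm.Γ k)) : Prop :=
  ∀ ρ S, Represents ρ S → ∃ ρ', Exec p ρ ρ' ∧
    Represents ρ' (Function.update S k (l ρ ++ S k)) ∧ Set.EqOn ρ' ρ Var.externals

theorem Loads.skip (k : tm.K) : Loads k (.skip : RegProg 𝕍) fun _ => [] :=
  fun ρ S hR => ⟨ρ, Exec.skip ρ, by simpa using hR, fun _ _ => rfl⟩

theorem loads_pushCode {k : tm.K} {g : tm.Γ k} (hg : g ∈ syms k) :
    Loads k (pushCode k g : RegProg 𝕍) fun _ => [g] := by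
  intro ρ S hR
  obtain ⟨ρ', hexec, hR', hρ'⟩ := exec_pushCode hR k hg
  exact ⟨ρ', hexec, hR', hρ'.mono Var.externals_subset_compl_cells⟩

theorem Loads.ite {k : tm.K} {p q : RegProg 𝕍} {l l' : (𝕍 → Bool) → List (tm.Γ k)}
    (hp : Loads k p l) (hq : Loads k q l') (c : 𝕍) :
    Loads k (.ite c p q) fun ρ => if ρ c then l ρ else l' ρ := by
  intro ρ S hR
  dsimp only
  cases hc : ρ c with
  | true =>
    obtain ⟨ρ', hexec, h⟩ := hp ρ S hR
    exact ⟨ρ', Exec.ite (by rwa [hc, if_pos rfl]), h⟩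
  | false =>
    obtain ⟨ρ', hexec, h⟩ := hq ρ S hR
    exact ⟨ρ', Exec.ite (by rwa [hc, if_neg Bool.false_ne_true]), by simpa using h⟩

theorem Loads.seq {k : tm.K} {p q : RegProg 𝕍} {l l' : (𝕍 → Bool) → List (tm.Γ k)}
    (hp : Loads k p l) (hq : Loads k q l') (hl' : DependsOn l' Var.externals) :
    Loads k (.seq p q) fun ρ => l' ρ ++ l ρ := by
  intro ρ S hR
  obtain ⟨ρ₁, hexec₁, hR₁, hρ₁⟩ := hp ρ S hR
  obtain ⟨ρ₂, hexec₂, hR₂, hρ₂⟩ := hq ρ₁ _ hR₁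
  refine ⟨ρ₂, hexec₁.seq hexec₂, ?_, hρ₂.trans hρ₁⟩
  rwa [hl' hρ₁, Function.update_self, Function.update_idem, ← List.append_assoc] at hR₂

/-- Execute the programs `p i` from the last one to the first one, so that what the first one pushes
comes out on top. -/
def pushAll {ι : Type} (p : ι → RegProg 𝕍) : List ι → RegProg 𝕍
  | [] => .skip
  | i :: l => .seq (pushAll p l) (p i)

theorem size_pushAll_le {ι : Type} {p : ι → RegProg 𝕍} {n : ℕ} (h : ∀ i, (p i).size ≤ n)
    (l : List ι) : (pushAll p l).size ≤ l.length * n := by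
  induction l with
  | nil => simp [pushAll, Prog.size]
  | cons i l ih =>
    rw [pushAll, Prog.size, List.length_cons, Nat.succ_mul]
    exact Nat.add_le_add ih (h i)

theorem loads_pushAll {ι : Type} {k : tm.K} {p : ι → RegProg 𝕍}
    {l : ι → (𝕍 → Bool) → List (tm.Γ k)} (hp : ∀ i, Loads k (p i) (l i))
    (hl : ∀ i, DependsOn (l i) Var.externals) (L : List ι) :
    Loads k (pushAll p L) fun ρ => L.flatMap fun i => l i ρ := by
  induction L with
  | nil => exact Loads.skip k
  | cons i L ih => exact ih.seq (hp i) (hl i)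

/-! ### Search for witnesses by a register program -/

theorem filterMap_range_getElem? {α : Type*} {w : List α} {n : ℕ} (h : w.length ≤ n) :
    (List.range n).filterMap (w[·]?) = w := by
  induction w generalizing n with
  | nil => simp
  | cons a w ih =>
    obtain ⟨n, rfl⟩ := Nat.exists_eq_add_of_le' (Nat.one_le_of_lt h)
    rw [List.range_succ_eq_map, List.filterMap_cons, List.filterMap_map]
    simpa [Function.comp_def] using ih (Nat.le_of_succ_le_succ h)

theorem filterMap_finRange_getElem? {α : Type*} {w : List α} {n : ℕ} (h : w.length ≤ n) :
    (List.finRange n).filterMap (fun j : Fin n => w[(j : ℕ)]?) = w := by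
  have hrange := filterMap_range_getElem? h
  rwa [← List.map_coe_finRange_eq_range, List.filterMap_map] at hrange

theorem map_finRange_getD {α : Type*} (x : List α) (a : α) :
    (List.finRange x.length).map (fun i : Fin x.length => x.getD i a) = x :=
  List.ext_getElem (by simp) fun i h₁ h₂ => by simp

theorem initList_stk (tm : FinTM2) (s : List (tm.Γ tm.k₀)) :
    (initList tm s).stk = Function.update (fun _ => []) tm.k₀ s := by
  funext k
  by_cases h : k = tm.k₀
  · subst h
    simp [initList]
  · simp [initList, h]

theorem haltList_stk (tm : FinTM2) (s : List (tm.Γ tm.k₁)) :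
    (haltList tm s).stk = Function.update (fun _ => []) tm.k₁ s := by
  funext k
  by_cases h : k = tm.k₁
  · subst h
    simp [haltList]
  · simp [haltList, h]

/-- The input held by a valuation. -/
def heldInput (ρ : 𝕍 → Bool) : List Bool := (List.finRange m).map fun i => ρ (.inp i)

/-- The candidate witness held by a valuation: position `j` is used if `choice (j, false)` is set,
and then holds the bit `choice (j, true)`. -/
def heldWitness (ρ : 𝕍 → Bool) : List Bool :=
  (List.finRange W).filterMap fun j =>
    if ρ (.choice (j, false)) then some (ρ (.choice (j, true))) else none

theorem length_heldInput (ρ : 𝕍 → Bool) : (heldInput ρ).length = m := by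
  simp [heldInput]

theorem length_heldWitness_le (ρ : 𝕍 → Bool) : (heldWitness ρ).length ≤ W :=
  (List.length_filterMap_le _ _).trans (List.length_finRange).le

theorem Var.inp_mem_externals (i : Fin m) : (.inp i : 𝕍) ∈ Var.externals := by
  simp [Var.externals]

theorem Var.choice_mem_externals (c : Fin W × Bool) : (.choice c : 𝕍) ∈ Var.externals := by
  simp [Var.externals]

theorem Var.out_mem_externals : (.out : 𝕍) ∈ Var.externals := by
  simp [Var.externals]

theorem dependsOn_heldInput :
    DependsOn (heldInput : (𝕍 → Bool) → List Bool) (Set.range .inp) := fun _ _ h =>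
  List.map_congr_left fun i _ => h _ ⟨i, rfl⟩

theorem dependsOn_heldWitness :
    DependsOn (heldWitness : (𝕍 → Bool) → List Bool) (Set.range .choice) := fun _ _ h =>
  List.filterMap_congr fun j _ => by rw [h _ ⟨(j, false), rfl⟩, h _ ⟨(j, true), rfl⟩]

theorem heldInput_eq {ρ : 𝕍 → Bool} {x : List Bool} (hx : x.length = m)
    (hρ : ∀ i, ρ (.inp i) = x.getD i false) : heldInput ρ = x := by
  subst hx
  exact (List.map_congr_left fun i _ => hρ i).trans (map_finRange_getD x false)

theorem exists_heldWitness_eq (ρ : 𝕍 → Bool) {w : List Bool} (hw : w.length ≤ W) :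
    ∃ ρ' : 𝕍 → Bool, Set.EqOn ρ' ρ (Set.range .choice)ᶜ ∧ heldWitness ρ' = w := by
  refine ⟨fun v => match v with
    | .choice (j, false) => decide ((j : ℕ) < w.length)
    | .choice (j, true) => w.getD j false
    | v => ρ v, fun v hv => ?_, ?_⟩
  · cases v with
    | choice c => exact absurd ⟨c, rfl⟩ hv
    | _ => rfl
  · conv_rhs => rw [← filterMap_finRange_getElem? hw]
    refine List.filterMap_congr fun j _ => ?_
    by_cases hj : (j : ℕ) < w.length <;> simp [hj]

/-- The initial stack of the machine for the input and the candidate witness held by `ρ`. -/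
def heldSymbols (sym : Bool ⊕ Bool → tm.Γ tm.k₀) (ρ : 𝕍 → Bool) : List (tm.Γ tm.k₀) :=
  ((heldInput ρ).map Sum.inl ++ (heldWitness ρ).map Sum.inr).map sym

theorem length_heldSymbols_le (sym : Bool ⊕ Bool → tm.Γ tm.k₀) (ρ : 𝕍 → Bool) :
    (heldSymbols sym ρ).length ≤ m + W := by
  have := length_heldInput ρ
  have := length_heldWitness_le ρ
  simp only [heldSymbols, List.length_map, List.length_append]
  omega

/-- Push the symbol for the bit held by the variable `v` on the input stack. -/
noncomputable def pushBit (sym : Bool → tm.Γ tm.k₀) (v : 𝕍) : RegProg 𝕍 :=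
  .ite v (pushCode tm.k₀ (sym true)) (pushCode tm.k₀ (sym false))

theorem loads_pushBit {sym : Bool → tm.Γ tm.k₀} (hsym : ∀ b, sym b ∈ syms tm.k₀) (v : 𝕍) :
    Loads tm.k₀ (pushBit sym v) fun ρ => [sym (ρ v)] := by
  rw [pushBit]
  convert (loads_pushCode (hsym true)).ite (loads_pushCode (hsym false)) v using 1
  funext ρ
  cases ρ v <;> rfl

/-- Push the input and the candidate witness on the input stack. -/
noncomputable def loadCode (sym : Bool ⊕ Bool → tm.Γ tm.k₀) : RegProg 𝕍 :=
  .seq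
    (pushAll (fun j => .ite (.choice (j, false)) (pushBit (sym ∘ .inr) (.choice (j, true))) .skip)
      (List.finRange W))
    (pushAll (fun i => pushBit (sym ∘ .inl) (.inp i)) (List.finRange m))

theorem loads_loadCode {sym : Bool ⊕ Bool → tm.Γ tm.k₀} (hsym : ∀ b, sym b ∈ syms tm.k₀) :
    Loads tm.k₀ (loadCode sym : RegProg 𝕍) (heldSymbols sym) := by
  have hwitness := loads_pushAll
    (p := fun j : Fin W =>
      (.ite (.choice (j, false)) (pushBit (sym ∘ .inr) (.choice (j, true))) .skip : RegProg 𝕍))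
    (fun j => (loads_pushBit (fun b => hsym (.inr b)) _).ite (.skip _) _)
    (fun j ρ ρ' h => by simp only [h _ (Var.choice_mem_externals _)]) (List.finRange W)
  have hinput := loads_pushAll (p := fun i : Fin m => (pushBit (sym ∘ .inl) (.inp i) : RegProg 𝕍))
    (fun i => loads_pushBit (fun b => hsym (.inl b)) _)
    (fun i ρ ρ' h => by simp only [h _ (Var.inp_mem_externals _)]) (List.finRange m)
  rw [loadCode]
  convert hwitness.seq hinput fun ρ ρ' h => by
    simp only [h _ (Var.inp_mem_externals _)] using 1
  funext ρ
  rw [heldSymbols, heldInput, heldWitness, List.map_append, List.map_map, List.map_map,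
    List.map_filterMap, List.map_eq_flatMap, List.filterMap_eq_flatMap_toList, List.map_flatMap]
  congr 2
  funext j
  cases ρ (.choice (j, false)) <;> rfl

/-- Prepare a run of the stack machine on the input and the candidate witness. -/
noncomputable def initCode (sym : Bool ⊕ Bool → tm.Γ tm.k₀) : RegProg 𝕍 :=
  .seq clearCode (.seq (loadCode sym) (setState (tm.main, tm.initialState)))

theorem exec_initCode {sym : Bool ⊕ Bool → tm.Γ tm.k₀} (hsym : ∀ b, sym b ∈ syms tm.k₀)
    (ρ : 𝕍 → Bool) :
    ∃ ρ', Exec (initCode sym) ρ ρ' ∧ Represents ρ' (initList tm (heldSymbols sym ρ)).stk ∧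
      HasState ρ' (some tm.main) tm.initialState ∧ Set.EqOn ρ' ρ Var.externals := by
  obtain ⟨ρ₁, hclear, hR₁, hρ₁⟩ := exec_clearCode ρ
  obtain ⟨ρ₂, hload, hR₂, hρ₂⟩ := loads_loadCode hsym ρ₁ _ hR₁
  obtain ⟨ρ₃, hset, hstate, hρ₃⟩ := exec_setState ρ₂ tm.main tm.initialState
  replace hρ₁ := hρ₁.mono Var.externals_subset_compl_cells
  have hsymbols : heldSymbols sym ρ₁ = heldSymbols sym ρ := by
    rw [heldSymbols, heldSymbols,
      dependsOn_heldInput (fun v ⟨i, hi⟩ => hρ₁ (hi ▸ Var.inp_mem_externals i)),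
      dependsOn_heldWitness (fun v ⟨c, hc⟩ => hρ₁ (hc ▸ Var.choice_mem_externals c))]
  rw [hsymbols, List.append_nil, ← initList_stk] at hR₂
  exact ⟨ρ₃, hclear.seq (hload.seq hset), hR₂.congr (hρ₃.mono Set.subset_union_right), hstate,
    (hρ₃.mono Set.subset_union_left).trans (hρ₂.trans hρ₁)⟩

/-- Run the stack machine on the input and the candidate witness, and add its answer to `out`. -/
noncomputable def searchBody (sym : Bool ⊕ Bool → tm.Γ tm.k₀) (a : {g // g ∈ syms tm.k₁}) :
    RegProg 𝕍 :=
  .seq (initCode sym) <| .seq (.loop .running stepCode) <|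
    .ite (.cell 0 tm.k₁ a) (.act (.out, true)) .skip

theorem exec_searchBody (hm : ∀ l, PushesIn syms (tm.m l)) {P : ℕ}
    (hP : ∀ l, pushes (tm.m l) ≤ P) {sym : Bool ⊕ Bool → tm.Γ tm.k₀}
    (hsym : ∀ b, sym b ∈ syms tm.k₀) (a : {g // g ∈ syms tm.k₁}) {ρ : 𝕍 → Bool}
    {n : ℕ} {s : List (tm.Γ tm.k₁)}
    (hsteps : (flip bind (TM2.step tm.m))^[n] (some (initList tm (heldSymbols sym ρ))) =
      some (haltList tm s))
    (hB : m + W + n * P ≤ B) :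
    ∃ ρ', Exec (searchBody sym a) ρ ρ' ∧ Set.EqOn ρ' ρ (Var.externals \ {.out}) ∧
      (ρ' .out = true ↔ ρ .out = true ∨ s.head? = some a.1) := by
  obtain ⟨ρ₁, hinit, hR₁, hstate, hρ₁⟩ := exec_initCode hsym ρ
  have hheight : ∀ k, ((initList tm (heldSymbols sym ρ)).stk k).length ≤ m + W := fun k => by
    rw [initList_stk]
    by_cases hk : k = tm.k₀
    · subst hk
      rw [Function.update_self]
      exact length_heldSymbols_le sym ρ
    · simp [hk]
  obtain ⟨ρ₂, hloop, hR₂, hρ₂⟩ := exec_loop_stepCode hm hP rfl hsteps hR₁ hstate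
    fun k => (Nat.add_le_add_right (hheight k) _).trans hB
  replace hρ₂ := hρ₂.trans hρ₁
  have htop : ρ₂ (.cell 0 tm.k₁ a) = true ↔ s.head? = some a.1 := by
    rw [hR₂.cell, haltList_stk, Function.update_self, List.head?_eq_getElem?]
    rfl
  rw [← htop, ← hρ₂ Var.out_mem_externals]
  cases hb : ρ₂ (.cell 0 tm.k₁ a) with
  | true =>
    refine ⟨assign (.out, true) ρ₂, hinit.seq (hloop.seq (Exec.ite ?_)),
      (eqOn_assign_of_notMem (by simp) _ _).trans (hρ₂.mono Set.sdiff_subset),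
      by simp [assign_self]⟩
    rw [hb]
    exact Exec.act _ _
  | false =>
    refine ⟨ρ₂, hinit.seq (hloop.seq (Exec.ite ?_)), hρ₂.mono Set.sdiff_subset, by simp⟩
    rw [hb]
    exact Exec.skip _

/-- The loop variables that hold a candidate witness. -/
noncomputable def choiceList : List 𝕍 :=
  (Finset.univ : Finset (Fin W × Bool)).toList.map .choice

theorem nodup_choiceList : (choiceList : List 𝕍).Nodup :=
  (Finset.nodup_toList _).map fun _ _ h => by simpa using h

theorem setOf_mem_choiceList : {v | v ∈ (choiceList : List 𝕍)} = Set.range .choice := by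
  ext v
  simp [choiceList]

theorem length_choiceList : (choiceList : List 𝕍).length = W * 2 := by
  simp [choiceList]

/-- Search for a witness that the stack machine accepts. -/
noncomputable def searchProg (sym : Bool ⊕ Bool → tm.Γ tm.k₀) (a : {g // g ∈ syms tm.k₁}) :
    RegProg 𝕍 :=
  forBits .again (searchBody sym a) choiceList

theorem exists_eqOn_heldWitness_iff {ρ : 𝕍 → Bool} {x : List Bool} (hx : x.length = m)
    (hρ : ∀ i, ρ (.inp i) = x.getD i false) (p : List Bool → List Bool → Prop) :
    (∃ ρ' : 𝕍 → Bool, Set.EqOn ρ' ρ ((Var.externals \ {.out}) \ Set.range .choice) ∧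
      p (heldInput ρ') (heldWitness ρ')) ↔ ∃ w : List Bool, w.length ≤ W ∧ p x w := by
  constructor
  · rintro ⟨ρ', hρ', h⟩
    rw [heldInput_eq hx fun i => (hρ' (by simp [Var.externals])).trans (hρ i)] at h
    exact ⟨_, length_heldWitness_le ρ', h⟩
  · rintro ⟨w, hw, h⟩
    obtain ⟨ρ', hρ', rfl⟩ := exists_heldWitness_eq ρ hw
    refine ⟨ρ', hρ'.mono fun v hv => hv.2, ?_⟩
    rwa [heldInput_eq hx fun i => (hρ' (by simp)).trans (hρ i)]

theorem exec_searchProg (hm : ∀ l, PushesIn syms (tm.m l)) {P : ℕ}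
    (hP : ∀ l, pushes (tm.m l) ≤ P) {sym : Bool ⊕ Bool → tm.Γ tm.k₀}
    (hsym : ∀ b, sym b ∈ syms tm.k₀) {a : {g // g ∈ syms tm.k₁}}
    {χ : List Bool × List Bool → Bool} {T : ℕ} (hB : m + W + T * P ≤ B)
    (hχ : ∀ x w : List Bool, x.length = m → w.length ≤ W → ∃ n ≤ T, ∃ s : List (tm.Γ tm.k₁),
      (flip bind (TM2.step tm.m))^[n]
        (some (initList tm ((x.map Sum.inl ++ w.map Sum.inr).map sym))) = some (haltList tm s) ∧
      (s.head? = some a.1 ↔ χ (x, w) = true))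
    {ρ : 𝕍 → Bool} {x : List Bool} (hx : x.length = m)
    (hρ : ∀ i, ρ (.inp i) = x.getD i false) (hout : ρ .out = false) :
    ∃ ρ', Exec (searchProg sym a) ρ ρ' ∧
      (ρ' .out = true ↔ ∃ w : List Bool, w.length ≤ W ∧ χ (x, w) = true) := by
  have hbody : Accumulates (Var.externals \ {.out}) .out (searchBody sym a : RegProg 𝕍)
      fun ρ => χ (heldInput ρ, heldWitness ρ) = true := fun ρ => by
    obtain ⟨n, hn, s, hsteps, hs⟩ := hχ (heldInput ρ) (heldWitness ρ) (length_heldInput ρ)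
      (length_heldWitness_le ρ)
    obtain ⟨ρ', hexec, hE, hout⟩ := exec_searchBody hm hP hsym a hsteps
      ((Nat.add_le_add_left (Nat.mul_le_mul_right P hn) _).trans hB)
    exact ⟨ρ', hexec, hE, hout.trans (or_congr_right hs)⟩
  have hdep : DependsOn (fun ρ : 𝕍 → Bool => χ (heldInput ρ, heldWitness ρ) = true)
      (Var.externals \ {.out}) := fun ρ ρ' h => by
    dsimp only
    rw [dependsOn_heldInput fun v ⟨i, hi⟩ => h v (by simp [← hi, Var.externals]),
      dependsOn_heldWitness fun v ⟨c, hc⟩ => h v (by simp [← hc, Var.externals])]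
  have hchoice : ∀ v ∈ (choiceList : List 𝕍), v ∈ (Var.externals \ {.out} : Set 𝕍) := by
    simp only [choiceList, List.forall_mem_map]
    intro c _
    exact ⟨Var.choice_mem_externals c, by simp⟩
  obtain ⟨ρ', hexec, -, hfound⟩ := hbody.forBits hdep (d := .again) (by simp [Var.externals])
    (by simp) (by simp) nodup_choiceList hchoice ρ
  refine ⟨ρ', hexec, ?_⟩
  rw [hfound, hout, setOf_mem_choiceList]
  simpa using exists_eqOn_heldWitness_iff hx hρ fun x w => χ (x, w) = true

/-! ### Size of the search program -/

theorem size_topSwitch_le {k : tm.K} {p : Option (tm.Γ k) → RegProg 𝕍} {n : ℕ}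
    (h : ∀ o, (p o).size ≤ n) : (topSwitch k p).size ≤ (syms k).card * (n + 3) + n := by
  refine (size_switch_le _ _ fun g _ => h _).trans ?_
  simpa using h none

theorem size_setState_le (c : tm.Λ × tm.σ) :
    (setState c : RegProg 𝕍).size ≤ 1 + Fintype.card (tm.Λ × tm.σ) := by
  refine Nat.add_le_add_left ((size_seqs_map_le (n := 1) fun c _ => le_rfl).trans ?_) _
  simp

theorem exists_size_stmtCode_le (syms : ∀ k, Finset (tm.Γ k)) (q : TM2.Stmt tm.Γ tm.Λ tm.σ) :
    ∃ C, ∀ m W B v, (stmtCode q v : RegProg (Var tm syms m W B)).size ≤ C * (B + 1) := by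
  induction q with
  | push k f q ih =>
    obtain ⟨C, hC⟩ := ih
    refine ⟨(syms k).card * 5 + C, fun m W B v => ?_⟩
    have hpush := size_pushCode_le (m := m) (W := W) (B := B) (syms := syms) k (f v)
    have hq := hC m W B v
    simp only [stmtCode, Prog.size]
    linarith
  | peek k f q ih =>
    obtain ⟨C, hC⟩ := ih
    refine ⟨(syms k).card * (C + 3) + C, fun m W B v => ?_⟩
    refine (size_topSwitch_le fun o => hC m W B _).trans ?_
    nlinarith [Nat.zero_le ((syms k).card * B)]
  | pop k f q ih =>
    obtain ⟨C, hC⟩ := ih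
    set D := (syms k).card * 5 + C with hD
    have hpop : ∀ m W B v, (.seq (popCode k) (stmtCode q v) : RegProg (Var tm syms m W B)).size ≤
        D * (B + 1) := fun m W B v => by
      have hpop := size_popCode_le (m := m) (W := W) (B := B) (syms := syms) k
      have hq := hC m W B v
      simp only [Prog.size, hD]
      linarith
    refine ⟨(syms k).card * (D + 3) + D, fun m W B v => ?_⟩
    refine (size_topSwitch_le fun o => hpop m W B _).trans ?_
    nlinarith [Nat.zero_le ((syms k).card * B)]
  | load f q ih =>
    obtain ⟨C, hC⟩ := ih
    exact ⟨C, fun m W B v => hC m W B (f v)⟩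
  | branch f q₁ q₂ ih₁ ih₂ =>
    obtain ⟨C₁, hC₁⟩ := ih₁
    obtain ⟨C₂, hC₂⟩ := ih₂
    refine ⟨C₁ + C₂, fun m W B v => ?_⟩
    rw [stmtCode, Nat.add_mul]
    split
    · exact (hC₁ m W B v).trans (Nat.le_add_right _ _)
    · exact (hC₂ m W B v).trans (Nat.le_add_left _ _)
  | goto f =>
    exact ⟨1 + Fintype.card (tm.Λ × tm.σ), fun m W B v =>
      (size_setState_le _).trans (Nat.le_mul_of_pos_right _ (Nat.succ_pos _))⟩
  | halt => exact ⟨1, fun m W B v => by simp [stmtCode, Prog.size]⟩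

theorem exists_size_stepCode_le (syms : ∀ k, Finset (tm.Γ k)) :
    ∃ C, ∀ m W B, (stepCode : RegProg (Var tm syms m W B)).size ≤ C * (B + 1) := by
  choose C hC using fun l => exists_size_stmtCode_le syms (tm.m l)
  have hsum : ∀ m W B (c : tm.Λ × tm.σ),
      (stmtCode (tm.m c.1) c.2 : RegProg (Var tm syms m W B)).size ≤ (∑ l, C l) * (B + 1) :=
    fun m W B c => (hC c.1 m W B c.2).trans (Nat.mul_le_mul_right _
      (Finset.single_le_sum (fun _ _ => Nat.zero_le _) (Finset.mem_univ c.1)))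
  refine ⟨Fintype.card (tm.Λ × tm.σ) * (∑ l, C l + 3), fun m W B => ?_⟩
  refine (size_switch_le _ _ fun c _ => hsum m W B c).trans ?_
  rw [Finset.length_toList, Finset.card_univ, Prog.size, Nat.add_zero, Nat.mul_assoc]
  exact Nat.mul_le_mul_left _ (by linarith)

theorem size_clearCode_le :
    (clearCode : RegProg 𝕍).size ≤ Fintype.card (Σ k, {g // g ∈ syms k}) * (B + 1) := by
  refine (size_seqs_map_le (n := 1) fun c _ => le_rfl).trans ?_
  rw [Finset.length_toList, Finset.card_univ, Fintype.card_prod, Fintype.card_fin, Nat.mul_one,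
    Nat.mul_comm]

theorem size_pushBit_le (sym : Bool → tm.Γ tm.k₀) (v : 𝕍) :
    (pushBit sym v).size ≤ ((syms tm.k₀).card * 10 + 3) * (B + 1) := by
  have htrue := size_pushCode_le (m := m) (W := W) (B := B) (syms := syms) tm.k₀ (sym true)
  have hfalse := size_pushCode_le (m := m) (W := W) (B := B) (syms := syms) tm.k₀ (sym false)
  simp only [pushBit, Prog.size]
  linarith

theorem size_loadCode_le (sym : Bool ⊕ Bool → tm.Γ tm.k₀) :
    (loadCode sym : RegProg 𝕍).size ≤ (m + W) * (((syms tm.k₀).card * 10 + 6) * (B + 1)) := by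
  set D := ((syms tm.k₀).card * 10 + 6) * (B + 1) with hD
  have hbit : ∀ (sym : Bool → tm.Γ tm.k₀) (v : 𝕍), (pushBit sym v).size + 3 ≤ D := fun sym v => by
    have := size_pushBit_le sym v
    linarith
  have hwitness := size_pushAll_le (n := D) (p := fun j : Fin W =>
    (.ite (.choice (j, false)) (pushBit (sym ∘ .inr) (.choice (j, true))) .skip : RegProg 𝕍))
    (fun j => by simpa [Prog.size] using hbit _ _) (List.finRange W)
  have hinput := size_pushAll_le (n := D)
    (p := fun i : Fin m => (pushBit (sym ∘ .inl) (.inp i) : RegProg 𝕍))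
    (fun i => (Nat.le_add_right _ 3).trans (hbit _ _)) (List.finRange m)
  rw [List.length_finRange] at hwitness hinput
  rw [loadCode, Prog.size, Nat.add_mul, Nat.add_comm (m * D)]
  exact Nat.add_le_add hwitness hinput

theorem exists_size_searchBody_le (syms : ∀ k, Finset (tm.Γ k)) :
    ∃ C, ∀ m W B sym a, (searchBody sym a : RegProg (Var tm syms m W B)).size ≤
      C * ((B + 1) * (m + W + 1)) := by
  obtain ⟨C, hC⟩ := exists_size_stepCode_le syms
  set G := Fintype.card (Σ k, {g // g ∈ syms k}) with hG
  set Q := Fintype.card (tm.Λ × tm.σ) with hQ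
  set D := (syms tm.k₀).card * 10 + 6 with hD
  refine ⟨G + D + (1 + Q) + C + 7, fun m W B sym a => ?_⟩
  have hB : B + 1 ≤ (B + 1) * (m + W + 1) := Nat.le_mul_of_pos_right _ (Nat.succ_pos _)
  have hload : (m + W) * (D * (B + 1)) ≤ D * ((B + 1) * (m + W + 1)) := by
    rw [mul_left_comm, mul_comm (m + W)]
    exact Nat.mul_le_mul_left _ (Nat.mul_le_mul_left _ (Nat.le_succ _))
  calc (searchBody sym a : RegProg (Var tm syms m W B)).size
      ≤ G * (B + 1) + ((m + W) * (D * (B + 1)) + (1 + Q)) + (C * (B + 1) + 3 + (1 + 3)) := by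
        have hclear := size_clearCode_le (m := m) (W := W) (B := B) (syms := syms)
        have hload := size_loadCode_le (m := m) (W := W) (B := B) (syms := syms) sym
        have hset := size_setState_le (m := m) (W := W) (B := B) (syms := syms)
          (tm.main, tm.initialState)
        have hstep := hC m W B
        rw [← hG] at hclear
        rw [← hD] at hload
        rw [← hQ] at hset
        simp only [searchBody, initCode, Prog.size]
        omega
    _ ≤ (G + D + (1 + Q) + C + 7) * ((B + 1) * (m + W + 1)) := by
        generalize (B + 1) * (m + W + 1) = U at *
        nlinarith [Nat.mul_le_mul_left G hB, Nat.mul_le_mul_left C hB]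

theorem exists_size_searchProg_le (syms : ∀ k, Finset (tm.Γ k)) :
    ∃ C, ∀ m W B sym a, (searchProg sym a : RegProg (Var tm syms m W B)).size ≤
      C * ((B + 1) * (m + W + 1)) := by
  obtain ⟨C, hC⟩ := exists_size_searchBody_le syms
  refine ⟨C + 22, fun m W B sym a => ?_⟩
  have hbody := hC m W B sym a
  have hW : m + W + 1 ≤ (B + 1) * (m + W + 1) := Nat.le_mul_of_pos_left _ (Nat.succ_pos _)
  rw [searchProg, size_forBits, length_choiceList, Nat.add_mul]
  omega

/-! ### Finitely many symbols suffice -/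

section Symbols

variable {K Λ σ : Type} {Γ : K → Type}

/-- The symbols that a statement may push. -/
def pushedSyms : TM2.Stmt Γ Λ σ → Set (Σ k, Γ k)
  | .push k f q => Set.range (fun v => ⟨k, f v⟩) ∪ pushedSyms q
  | .peek _ _ q | .pop _ _ q | .load _ q => pushedSyms q
  | .branch _ q₁ q₂ => pushedSyms q₁ ∪ pushedSyms q₂
  | .goto _ | .halt => ∅

theorem finite_pushedSyms [Finite σ] (q : TM2.Stmt Γ Λ σ) : (pushedSyms q).Finite := by
  induction q with
  | push k f q ih => exact (Set.finite_range _).union ih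
  | peek _ _ _ ih | pop _ _ _ ih | load _ _ ih => exact ih
  | branch _ _ _ ih₁ ih₂ => exact ih₁.union ih₂
  | goto _ | halt => exact Set.finite_empty

theorem pushesIn_of_subset {syms : ∀ k, Finset (Γ k)} {q : TM2.Stmt Γ Λ σ}
    (h : ∀ c ∈ pushedSyms q, c.2 ∈ syms c.1) : PushesIn syms q := by
  induction q with
  | push k f q ih =>
    exact ⟨fun v => h ⟨k, f v⟩ (Or.inl ⟨v, rfl⟩), ih fun c hc => h c (Or.inr hc)⟩
  | peek _ _ _ ih | pop _ _ _ ih | load _ _ ih => exact ih h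
  | branch _ _ _ ih₁ ih₂ =>
    exact ⟨ih₁ fun c hc => h c (Or.inl hc), ih₂ fun c hc => h c (Or.inr hc)⟩
  | goto _ | halt => trivial

theorem exists_syms (tm : FinTM2) {A : Set (Σ k, tm.Γ k)} (hA : A.Finite) :
    ∃ syms : ∀ k, Finset (tm.Γ k), (∀ l, PushesIn syms (tm.m l)) ∧ ∀ c ∈ A, c.2 ∈ syms c.1 := by
  have hfin : ((⋃ l, pushedSyms (tm.m l)) ∪ A).Finite :=
    (Set.finite_iUnion fun l => finite_pushedSyms _).union hA
  have hfiber : ∀ k, (Sigma.mk k ⁻¹' ((⋃ l, pushedSyms (tm.m l)) ∪ A)).Finite := fun k =>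
    hfin.preimage sigma_mk_injective.injOn
  exact ⟨fun k => (hfiber k).toFinset,
    fun l => pushesIn_of_subset fun c hc =>
      (hfiber _).mem_toFinset.mpr (Or.inl (Set.mem_iUnion.mpr ⟨l, hc⟩)),
    fun c hc => (hfiber _).mem_toFinset.mpr (Or.inr hc)⟩

end Symbols

theorem monotone_eval {R : Type*} [CommSemiring R] [PartialOrder R] [IsOrderedRing R]
    [CanonicallyOrderedAdd R] (p : Polynomial R) : Monotone fun a => p.eval a := fun a b h => by
  simp only [Polynomial.eval_eq_sum_range]
  exact Finset.sum_le_sum fun i _ =>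
    mul_le_mul_of_nonneg_left (pow_le_pow_left₀ zero_le h i) zero_le

/-! ### Search programs as instruction sequences -/

/-- The registers of a search program: `m` for the input, one for the answer and `N` auxiliary
ones. -/
def searchFoci (m N : ℕ) : List Focus :=
  (List.range m).map (fun i => ⟨.inp, i + 1⟩) ++ ⟨.out0, 1⟩ ::
    (List.range N).map (fun i => ⟨.aux0, i + 1⟩)

theorem mem_searchFoci {m N : ℕ} {f : Focus} :
    f ∈ searchFoci m N ↔ f.role = .inp ∧ f.index ∈ Set.Icc 1 m ∨ f = ⟨.out0, 1⟩ ∨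
      f.role = .aux0 ∧ f.index ∈ Set.Icc 1 N := by
  have hrange : ∀ (r : Role) (n : ℕ), f ∈ (List.range n).map (fun i => (⟨r, i + 1⟩ : Focus)) ↔
      f.role = r ∧ f.index ∈ Set.Icc 1 n := fun r n => by
    obtain ⟨r', i⟩ := f
    simp only [List.mem_map, List.mem_range, Focus.mk.injEq, Set.mem_Icc]
    exact ⟨by rintro ⟨i, hi, rfl, rfl⟩; exact ⟨rfl, by omega⟩,
      by rintro ⟨rfl, hi⟩; exact ⟨i - 1, by omega, rfl, by omega⟩⟩
  rw [searchFoci, List.mem_append, List.mem_cons, hrange, hrange]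

theorem lowRegisterIndices_of_uses_iff {X : List Instr} {m N : ℕ}
    (h : ∀ f, Uses X f ↔ f ∈ searchFoci m N) : LowRegisterIndices X := by
  intro r
  refine ⟨match r with | .inp => m | .out0 => 1 | .aux0 => N | _ => 0, ?_⟩
  ext i
  rw [Set.mem_ofPred_eq, h, mem_searchFoci]
  cases r <;> simp

/-- Instructions that involve the given registers. Placed behind `!`, they are not executed, but
make the numbers of the registers in use an initial segment. -/
def padding (l : List Focus) : List Instr := l.map fun f => .basic ⟨f, ⟨.zero, .ident⟩⟩

theorem uses_code_append_padding {V : Type} {e : V → Focus} {l : List Focus} (he : ∀ v, e v ∈ l)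
    (p : RegProg V) (f : Focus) : Uses (p.code e ++ .term :: padding l) f ↔ f ∈ l := by
  constructor
  · rintro ⟨u, hu, hf⟩
    rcases List.mem_append.1 hu with hu | hu
    · obtain ⟨v, rfl⟩ := Prog.focus_mem_range_of_mem_code hu hf
      exact he v
    · rcases List.mem_cons.1 hu with rfl | hu
      · simp [Instr.focus?] at hf
      · obtain ⟨g, hg, rfl⟩ := List.mem_map.1 hu
        exact Option.some_injective _ hf ▸ hg
  · intro hf
    exact ⟨.basic ⟨f, ⟨.zero, .ident⟩⟩, by simp [padding, hf], rfl⟩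

/-- The variables of a search program that are kept in auxiliary registers: stack cells, control
states, candidate witnesses, and the two flags of its loops. -/
abbrev AuxVar (tm : FinTM2) (syms : ∀ k, Finset (tm.Γ k)) (W B : ℕ) : Type :=
  (Fin (B + 1) × Σ k, {g // g ∈ syms k}) ⊕ (tm.Λ × tm.σ) ⊕ (Fin W × Bool) ⊕ Bool

theorem card_auxVar : Fintype.card (AuxVar tm syms W B) =
    (B + 1) * Fintype.card (Σ k, {g // g ∈ syms k}) +
      (Fintype.card (tm.Λ × tm.σ) + (W * 2 + 2)) := by
  simp [AuxVar]

/-- The register of an auxiliary variable. -/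
noncomputable def auxFocus (v : AuxVar tm syms W B) : Focus :=
  ⟨.aux0, (Fintype.equivFin _ v : ℕ) + 1⟩

theorem auxFocus_injective : Function.Injective (auxFocus : AuxVar tm syms W B → Focus) :=
  fun _ _ h => (Fintype.equivFin _).injective
    (Fin.ext (Nat.succ_injective (congrArg Focus.index h)))

/-- Input, output and auxiliary variables. -/
def Var.toSum : 𝕍 → Fin m ⊕ Unit ⊕ AuxVar tm syms W B
  | .inp i => .inl i
  | .out => .inr (.inl ())
  | .cell i k g => .inr (.inr (.inl (i, ⟨k, g⟩)))
  | .st c => .inr (.inr (.inr (.inl c)))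
  | .choice c => .inr (.inr (.inr (.inr (.inl c))))
  | .running => .inr (.inr (.inr (.inr (.inr false))))
  | .again => .inr (.inr (.inr (.inr (.inr true))))

theorem Var.toSum_injective : Function.Injective (Var.toSum : 𝕍 → _) := by
  intro v w h
  cases v <;> cases w <;> simp_all [Var.toSum]

/-- The register of a variable. -/
noncomputable def varFocus (v : 𝕍) : Focus :=
  Sum.elim (fun i : Fin m => ⟨.inp, i + 1⟩) (Sum.elim (fun _ => ⟨.out0, 1⟩) auxFocus) v.toSum

theorem varFocus_injective : Function.Injective (varFocus : 𝕍 → Focus) := by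
  refine Function.Injective.comp (Function.Injective.sumElim
    (fun _ _ h => Fin.ext (Nat.succ_injective (congrArg Focus.index h)))
    (Function.Injective.sumElim (fun _ _ _ => rfl) auxFocus_injective fun _ w h => ?_)
    fun i w h => ?_) Var.toSum_injective
  · exact absurd (congrArg Focus.role h) nofun
  · rcases w with _ | w <;> exact absurd (congrArg Focus.role h) nofun

theorem varFocus_mem (v : 𝕍) :
    varFocus v ∈ searchFoci m (Fintype.card (AuxVar tm syms W B)) := by
  rw [mem_searchFoci, varFocus]
  rcases v.toSum with i | _ | w
  · exact Or.inl ⟨rfl, Nat.succ_pos _, i.isLt⟩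
  · exact Or.inr (Or.inl rfl)
  · exact Or.inr (Or.inr ⟨rfl, Nat.succ_pos _, (Fintype.equivFin _ w).isLt⟩)

/-- The search program as a PGLB instruction sequence. -/
noncomputable def searchSeq (sym : Bool ⊕ Bool → tm.Γ tm.k₀) (a : {g // g ∈ syms tm.k₁})
    (m W B : ℕ) : List Instr :=
  (searchProg sym a : RegProg (Var tm syms m W B)).code varFocus ++
    .term :: padding (searchFoci m (Fintype.card (AuxVar tm syms W B)))

theorem uses_searchSeq {sym : Bool ⊕ Bool → tm.Γ tm.k₀} {a : {g // g ∈ syms tm.k₁}} {f : Focus} :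
    Uses (searchSeq sym a m W B) f ↔
      f ∈ searchFoci m (Fintype.card (AuxVar tm syms W B)) :=
  uses_code_append_padding varFocus_mem _ f

theorem exists_length_searchSeq_le (syms : ∀ k, Finset (tm.Γ k)) :
    ∃ C, ∀ sym (a : {g // g ∈ syms tm.k₁}) m W B,
      (searchSeq sym a m W B).length ≤ C * ((B + 1) * (m + W + 1)) := by
  obtain ⟨C, hC⟩ := exists_size_searchProg_le syms
  set G := Fintype.card (Σ k, {g // g ∈ syms k}) with hG
  set Q := Fintype.card (tm.Λ × tm.σ) with hQ
  refine ⟨C + G + Q + 6, fun sym a m W B => ?_⟩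
  have hprog := hC m W B sym a
  have hlength : (searchSeq sym a m W B).length =
      (searchProg sym a : RegProg (Var tm syms m W B)).size +
        (1 + m + 1 + ((B + 1) * G + (Q + (W * 2 + 2)))) := by
    simp only [searchSeq, padding, searchFoci, List.length_append, List.length_cons,
      List.length_map, List.length_range, Prog.length_code, card_auxVar, ← hG, ← hQ]
    omega
  have hB : B + 1 ≤ (B + 1) * (m + W + 1) := Nat.le_mul_of_pos_right _ (Nat.succ_pos _)
  have hW : m + W + 1 ≤ (B + 1) * (m + W + 1) := Nat.le_mul_of_pos_left _ (Nat.succ_pos _)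
  rw [hlength]
  generalize (B + 1) * (m + W + 1) = U at *
  nlinarith [Nat.mul_le_mul_right G hB, Nat.le_mul_of_pos_right Q (show 0 < U by omega)]

/-! ### PGLB instruction sequences for NP -/

/-- The counterpart of `DecidesAt` for PGLB instruction sequences: backward jumps are allowed. -/
def PGLBDecidesAt (X : List Instr) (L : Language Bool) (m : ℕ) : Prop :=
  IsPGLB X ∧ LowRegisterIndices X ∧
    (∀ f, Uses X f →
      (f.role = Role.inp ∧ f.index ≤ m) ∨ f = ⟨Role.out0, 1⟩ ∨ f.role.isAux = true) ∧
    ∀ x : List Bool, x.length = m →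
      ∃ β ∈ computed X (inputBits x), (β ⟨⟨Role.out0, 1⟩, rfl⟩ = true ↔ x ∈ L)

theorem PGLBDecidesAt.translate {Ψ : List Instr → List Instr} (hΨ : IsTranslation Ψ)
    {X : List Instr} {L : Language Bool} {m : ℕ} (hX : PGLBDecidesAt X L m) :
    DecidesAt (Ψ X) L m := by
  obtain ⟨hX, hlow, huses, hcomp⟩ := hX
  obtain ⟨hΨX, hΨlow, hΨuses, hΨcomp⟩ := hΨ X hX hlow
  refine ⟨hΨX, hΨlow, fun f hf => ?_, hΨcomp ▸ hcomp⟩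
  exact (hΨuses f hf).elim (fun haux => Or.inr (Or.inr haux)) (huses f)

theorem pglbDecidesAt_searchSeq (hm : ∀ l, PushesIn syms (tm.m l)) {P : ℕ}
    (hP : ∀ l, pushes (tm.m l) ≤ P) {sym : Bool ⊕ Bool → tm.Γ tm.k₀}
    (hsym : ∀ b, sym b ∈ syms tm.k₀) {a : {g // g ∈ syms tm.k₁}}
    {χ : List Bool × List Bool → Bool} {T : ℕ} (hB : m + W + T * P ≤ B)
    (hχ : ∀ x w : List Bool, x.length = m → w.length ≤ W → ∃ n ≤ T, ∃ s : List (tm.Γ tm.k₁),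
      (flip bind (TM2.step tm.m))^[n]
        (some (initList tm ((x.map Sum.inl ++ w.map Sum.inr).map sym))) = some (haltList tm s) ∧
      (s.head? = some a.1 ↔ χ (x, w) = true))
    {L : Language Bool}
    (hL : ∀ x : List Bool, x.length = m →
      (x ∈ L ↔ ∃ w : List Bool, w.length ≤ W ∧ χ (x, w) = true)) :
    PGLBDecidesAt (searchSeq sym a m W B) L m := by
  refine ⟨by simp [IsPGLB, searchSeq], lowRegisterIndices_of_uses_iff fun f => uses_searchSeq,
    fun f hf => ?_, fun x hx => ?_⟩
  · rcases mem_searchFoci.1 (uses_searchSeq.1 hf) with ⟨hr, -, hi⟩ | hf | ⟨hr, -⟩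
    · exact Or.inl ⟨hr, hi⟩
    · exact Or.inr (Or.inl hf)
    · exact Or.inr (Or.inr (by rw [hr]; rfl))
  · have hinput : ∀ i, initMemory (inputBits x) (varFocus (.inp i : Var tm syms m W B)) =
        x.getD i false := fun i => by
      simp [initMemory, varFocus, Var.toSum, Role.isInput, inputBits]
    obtain ⟨ρ', hexec, hout⟩ := exec_searchProg hm hP hsym hB hχ hx hinput (a := a)
      (ρ := fun v => initMemory (inputBits x) (varFocus v))
      (by simp [initMemory, varFocus, Var.toSum, Role.isInput, Role.initial])
    obtain ⟨t, M, hM, hρ'⟩ := hexec.exists_exec_code_term varFocus_injective (fun _ => rfl)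
      (padding (searchFoci m (Fintype.card (AuxVar tm syms W B))))
    refine ⟨fun g => M g.1, mem_computed_iff.2 ⟨t, M, hM, rfl⟩, ?_⟩
    rw [hL x hx, ← hout, ← hρ' .out]
    rfl

theorem exists_pglbDecidesAt_of_mem_NP {L : Language Bool} (hL : L ∈ NP) :
    ∃ q : Polynomial ℕ, ∀ m, ∃ X, PGLBDecidesAt X L m ∧ LLOC X ≤ q.eval m := by
  obtain ⟨U, q, ⟨χ, hχU, ⟨⟨tm, inA, outA⟩, T, hM⟩⟩, hLU⟩ := hL
  obtain ⟨syms, hm, hA⟩ := exists_syms tm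
    (A := Set.range (fun b => ⟨tm.k₀, inA.symm b⟩) ∪ {⟨tm.k₁, outA.symm true⟩})
    ((Set.finite_range _).union (Set.finite_singleton _))
  have hsym : ∀ b, inA.symm b ∈ syms tm.k₀ := fun b => hA ⟨tm.k₀, inA.symm b⟩ (Or.inl ⟨b, rfl⟩)
  have haccept : outA.symm true ∈ syms tm.k₁ := hA ⟨tm.k₁, outA.symm true⟩ (Or.inr rfl)
  obtain ⟨C, hC⟩ := exists_length_searchSeq_le syms
  obtain ⟨P, hP⟩ : ∃ P, ∀ l, pushes (tm.m l) ≤ P :=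
    ⟨_, fun l => Finset.single_le_sum (f := fun l => pushes (tm.m l)) (fun _ _ => Nat.zero_le _)
      (Finset.mem_univ l)⟩
  set Bp : Polynomial ℕ := .X + q + T.comp (.X + q) * .C P with hBp
  have hsteps : ∀ m, ∀ x w : List Bool, x.length = m → w.length ≤ q.eval m →
      ∃ n ≤ T.eval (m + q.eval m), ∃ s : List (tm.Γ tm.k₁),
        (flip bind (TM2.step tm.m))^[n]
          (some (initList tm ((x.map Sum.inl ++ w.map Sum.inr).map inA.symm))) =
            some (haltList tm s) ∧
        (s.head? = some (outA.symm true) ↔ χ (x, w) = true) := fun m x w hx hw => by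
    have hMxw := hM (x, w)
    refine ⟨hMxw.steps, hMxw.steps_le_m.trans (monotone_eval T ?_), [outA.symm (χ (x, w))],
      hMxw.evals_in_steps, by simp⟩
    simp [pairEncoding, Computability.encodingProd, Computability.encodingList, hx, hw]
  refine ⟨.C C * ((Bp + 1) * (.X + q + 1)), fun m =>
    ⟨searchSeq inA.symm ⟨_, haccept⟩ m (q.eval m) (Bp.eval m),
      pglbDecidesAt_searchSeq hm hP hsym (by simp [hBp]) (hsteps m) fun x hx => ?_, ?_⟩⟩
  · rw [hLU x, hx]
    exact exists_congr fun w => and_congr_right fun _ => (hχU (x, w)).symm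
  · simpa using! hC inA.symm ⟨_, haccept⟩ m (q.eval m) (Bp.eval m)

end SearchPrograms

/-! ### Stack machines from structured programs -/

/-- Basic actions on stacks and an internal state. -/
inductive StackAct (K : Type) (Γ : K → Type) (σ : Type) : Type
  | push (k : K) (f : σ → Γ k)
  | peek (k : K) (f : σ → Option (Γ k) → σ)
  | pop (k : K) (f : σ → Option (Γ k) → σ)
  | load (f : σ → σ)

section StackProg

variable {K : Type} {Γ : K → Type} {σ : Type}

/-- Structured programs for stack machines, with tests of the internal state. -/
abbrev StackProg (K : Type) (Γ : K → Type) (σ : Type) := Prog (StackAct K Γ σ) (σ → Bool)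

/-- Test of the internal state. -/
def testState (c : σ → Bool) (s : σ × (∀ k, List (Γ k))) : Bool := c s.1

/-- The label of a position; the positions behind the program share the label `N`. -/
def flatLabel (N n : ℕ) : Fin (N + 1) := ⟨min n N, by omega⟩

/-- The statement for the instruction at position `n` of a program of length `N`. -/
def FlatInstr.stmt (N n : ℕ) :
    FlatInstr (StackAct K Γ σ) (σ → Bool) → TM2.Stmt Γ (Fin (N + 1)) σ
  | .act (.push k f) => .push k f (.goto fun _ => flatLabel N (n + 1))
  | .act (.peek k f) => .peek k f (.goto fun _ => flatLabel N (n + 1))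
  | .act (.pop k f) => .pop k f (.goto fun _ => flatLabel N (n + 1))
  | .act (.load f) => .load f (.goto fun _ => flatLabel N (n + 1))
  | .skipIf c =>
      .branch c (.goto fun _ => flatLabel N (n + 2)) (.goto fun _ => flatLabel N (n + 1))
  | .jump k => .goto fun _ => flatLabel N (n + k)
  | .bjump k => .goto fun _ => flatLabel N (n - k)

/-- The stack machine that executes an unstructured program and halts at its end. -/
def flatMachine (X : List (FlatInstr (StackAct K Γ σ) (σ → Bool))) (i : Fin (X.length + 1)) :
    TM2.Stmt Γ (Fin (X.length + 1)) σ :=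
  match X[(i : ℕ)]? with
  | none => .halt
  | some u => u.stmt X.length i

theorem flatMachine_flatLabel {X : List (FlatInstr (StackAct K Γ σ) (σ → Bool))} {n : ℕ}
    {u : FlatInstr (StackAct K Γ σ) (σ → Bool)} (hu : X[n]? = some u) :
    flatMachine X (flatLabel X.length n) = u.stmt X.length n := by
  have hlabel : ((flatLabel X.length n : Fin (X.length + 1)) : ℕ) = n :=
    min_eq_left (List.getElem?_eq_some_iff.1 hu).1.le
  rw [flatMachine, hlabel, hu]

theorem flatMachine_flatLabel_length (X : List (FlatInstr (StackAct K Γ σ) (σ → Bool))) :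
    flatMachine X (flatLabel X.length X.length) = .halt := by
  simp [flatMachine, flatLabel]

variable [DecidableEq K]

/-- The effect of a basic action. -/
def StackAct.apply : StackAct K Γ σ → σ × (∀ k, List (Γ k)) → σ × (∀ k, List (Γ k))
  | .push k f, (v, S) => (v, Function.update S k (f v :: S k))
  | .peek k f, (v, S) => (f v (S k).head?, S)
  | .pop k f, (v, S) => (f v (S k).head?, Function.update S k (S k).tail)
  | .load f, (v, S) => (f v, S)

/-- The configuration at position `n` of a program of length `N`. -/
def flatCfg (N n : ℕ) (s : σ × (∀ k, List (Γ k))) : TM2.Cfg Γ (Fin (N + 1)) σ :=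
  ⟨some (flatLabel N n), s.1, s.2⟩

theorem step_flatCfg {X : List (FlatInstr (StackAct K Γ σ) (σ → Bool))} {n n' : ℕ}
    {s s' : σ × (∀ k, List (Γ k))} {u : FlatInstr (StackAct K Γ σ) (σ → Bool)}
    (hu : X[n]? = some u) (h : u.Step StackAct.apply testState n s n' s') :
    TM2.step (flatMachine X) (flatCfg X.length n s) = some (flatCfg X.length n' s') := by
  rw [flatCfg, TM2.step, flatMachine_flatLabel hu]
  cases h with
  | act a => cases a <;> rfl
  | skipIf_true _ hc | skipIf_false _ hc =>
    rw [testState] at hc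
    simp [FlatInstr.stmt, TM2.stepAux, hc, flatCfg]
  | jump => rfl
  | bjump k => simp [FlatInstr.stmt, TM2.stepAux, flatCfg]

theorem iterate_step_of_flatSteps {X : List (FlatInstr (StackAct K Γ σ) (σ → Bool))}
    {n n' t : ℕ} {s s' : σ × (∀ k, List (Γ k))}
    (h : FlatSteps StackAct.apply testState X n s t n' s') : ∃ t' ≤ t,
      (flip bind (TM2.step (flatMachine X)))^[t'] (some (flatCfg X.length n s)) =
        some (flatCfg X.length n' s') := by
  induction h with
  | refl => exact ⟨0, Nat.zero_le _, rfl⟩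
  | head hu hstep _ ih =>
    obtain ⟨t', ht', hiter⟩ := ih
    exact ⟨t' + 1, Nat.succ_le_succ ht', by
      rw [Function.iterate_succ_apply, ← hiter, ← step_flatCfg hu hstep]; rfl⟩

theorem iterate_step_of_run {p : StackProg K Γ σ} {s s' : σ × (∀ k, List (Γ k))} {t : ℕ}
    (h : Run StackAct.apply testState p s t s') : ∃ t' ≤ t + 1,
      (flip bind (TM2.step (flatMachine p.flat)))^[t'] (some (flatCfg p.flat.length 0 s)) =
        some ⟨none, s'.1, s'.2⟩ := by
  obtain ⟨t', ht', hiter⟩ := iterate_step_of_flatSteps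
    (flatSteps_of_run h (X := p.flat) (n := 0) (List.prefix_refl _))
  have hhalt : TM2.step (flatMachine p.flat) (flatCfg p.flat.length p.flat.length s') =
      some ⟨none, s'.1, s'.2⟩ := by
    rw [flatCfg, TM2.step, flatMachine_flatLabel_length, TM2.stepAux]
  refine ⟨t' + 1, Nat.succ_le_succ ht', ?_⟩
  rw [Function.iterate_succ_apply', hiter, Nat.zero_add, ← p.length_flat]
  exact hhalt

/-- The bundled stack machine for a structured program. -/
def stackMachine [Fintype K] [Fintype σ] (k₀ k₁ : K) [Fintype (Γ k₀)] (v₀ : σ)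
    (p : StackProg K Γ σ) : FinTM2 where
  K := K
  k₀ := k₀
  k₁ := k₁
  Γ := Γ
  Λ := Fin (p.flat.length + 1)
  main := flatLabel _ 0
  σ := σ
  initialState := v₀
  m := flatMachine p.flat

theorem nonempty_tm2ComputableInPolyTime_of_run [Finite K] [Finite σ] {k₀ k₁ : K}
    [Finite (Γ k₀)] {v₀ : σ} {p : StackProg K Γ σ} {α β αΓ βΓ : Type} {ea : α → List αΓ}
    {eb : β → List βΓ} {f : α → β} (inA : Γ k₀ ≃ αΓ) (outA : Γ k₁ ≃ βΓ) (T : Polynomial ℕ)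
    (h : ∀ a, Run StackAct.apply testState p
      (v₀, Function.update (fun _ => []) k₀ ((ea a).map inA.symm)) (T.eval (ea a).length)
      (v₀, Function.update (fun _ => []) k₁ ((eb (f a)).map outA.symm))) :
    Nonempty (TM2ComputableInPolyTime ea eb f) := by
  have := Fintype.ofFinite K
  have := Fintype.ofFinite σ
  have := Fintype.ofFinite (Γ k₀)
  have hinit : ∀ s, initList (stackMachine k₀ k₁ v₀ p) s =
      flatCfg p.flat.length 0 (v₀, Function.update (fun _ => []) k₀ s) := fun s =>
    congrArg (TM2.Cfg.mk _ _) (initList_stk (tm := stackMachine k₀ k₁ v₀ p) s)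
  have hhalt : ∀ s, haltList (stackMachine k₀ k₁ v₀ p) s =
      ⟨none, v₀, Function.update (fun _ => []) k₁ s⟩ := fun s =>
    congrArg (TM2.Cfg.mk _ _) (haltList_stk (tm := stackMachine k₀ k₁ v₀ p) s)
  choose t ht hiter using fun a => iterate_step_of_run (h a)
  exact ⟨{ tm := stackMachine k₀ k₁ v₀ p
           inputAlphabet := inA
           outputAlphabet := outA
           time := T + 1
           outputsFun := fun a =>
            { steps := t a
              evals_in_steps := by
                refine Eq.trans ?_ ((hiter a).trans (congrArg some (hhalt _)).symm)
                exact congrArg _ (congrArg some (hinit _))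
              steps_le_m := by simpa using ht a } }⟩

end StackProg

section Drain

variable {K : Type} [DecidableEq K] {Γ : K → Type} {σ : Type}

/-- `Takes p s t s'`: the stack program `p` takes state `s` to state `s'` within `t` steps. -/
abbrev Takes (p : StackProg K Γ σ) (s : σ × (∀ k, List (Γ k))) (t : ℕ)
    (s' : σ × (∀ k, List (Γ k))) : Prop :=
  Run StackAct.apply testState p s t s'

theorem takes_act {a : StackAct K Γ σ} {s s' : σ × (∀ k, List (Γ k))} (h : a.apply s = s') :
    Takes (.act a) s 1 s' :=
  h ▸ Run.act a s

/-- The program that moves the symbols of stack `k` to stack `d`, where `write` and `read` access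
the part of the internal state that holds the symbol popped last. -/
def drain (k d : K) (write : σ → Option (Γ k) → σ) (read : σ → Option (Γ k)) (g : σ → Γ d) :
    StackProg K Γ σ :=
  .seq (.act (.pop k write)) (.loop (fun v => (read v).isSome)
    (.seq (.act (.push d g)) (.act (.pop k write))))

/-- The program that empties stack `k`; `write` and `read` are as in `drain`. -/
def clearStack (k : K) (write : σ → Option (Γ k) → σ) (read : σ → Option (Γ k)) :
    StackProg K Γ σ :=
  .seq (.act (.pop k write)) (.loop (fun v => (read v).isSome) (.act (.pop k write)))

variable {k d : K} {write : σ → Option (Γ k) → σ} {read : σ → Option (Γ k)}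

theorem takes_drain_loop (hkd : k ≠ d) {g : σ → Γ d} {h : Γ k → Γ d}
    (read_write : ∀ v o, read (write v o) = o)
    (write_write : ∀ v o o', write (write v o) o' = write v o')
    (g_write : ∀ v a, g (write v (some a)) = h a) (v : σ) (l : List (Γ k))
    (S : ∀ k, List (Γ k)) :
    Takes (.loop (fun v => (read v).isSome) (.seq (.act (.push d g)) (.act (.pop k write))))
      (write v l.head?, Function.update S k l.tail) (4 * l.length + 2)
      (write v none,
        Function.update (Function.update S k []) d ((l.map h).reverse ++ S d)) := by
  induction l generalizing S with
  | nil =>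
    have hS : Function.update (Function.update S k []) d (S d) = Function.update S k [] :=
      Function.update_eq_self_iff.2 (Function.update_of_ne hkd.symm _ _).symm
    simp only [List.map_nil, List.reverse_nil, List.nil_append, hS]
    exact Run.loop_false (by simp [testState, read_write])
  | cons a l ih =>
    have hloop := ih (Function.update S d (h a :: S d))
    rw [Function.update_comm (β := fun k => List (Γ k)) hkd.symm (h a :: S d) [],
      Function.update_idem, Function.update_self] at hloop
    refine Run.mono (t := 1 + 1 + (4 * l.length + 2) + 2) (by rw [List.length_cons]; omega)
      (Run.loop_true (by simp [testState, read_write])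
        (Run.seq (takes_act rfl) (takes_act ?_)) (by simpa using hloop))
    simp [StackAct.apply, g_write, write_write, Function.update_comm hkd, hkd.symm]

theorem takes_drain (hkd : k ≠ d) {g : σ → Γ d} {h : Γ k → Γ d}
    (read_write : ∀ v o, read (write v o) = o)
    (write_write : ∀ v o o', write (write v o) o' = write v o')
    (g_write : ∀ v a, g (write v (some a)) = h a) (v : σ) (S : ∀ k, List (Γ k)) :
    Takes (drain k d write read g) (v, S) (4 * (S k).length + 3)
      (write v none,
        Function.update (Function.update S k []) d (((S k).map h).reverse ++ S d)) :=
  Run.mono (by omega) (Run.seq (takes_act rfl)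
    (takes_drain_loop hkd read_write write_write g_write v (S k) S))

theorem takes_clearStack_loop (read_write : ∀ v o, read (write v o) = o)
    (write_write : ∀ v o o', write (write v o) o' = write v o') (v : σ) (l : List (Γ k))
    (S : ∀ k, List (Γ k)) :
    Takes (.loop (fun v => (read v).isSome) (.act (.pop k write)))
      (write v l.head?, Function.update S k l.tail) (4 * l.length + 2)
      (write v none, Function.update S k []) := by
  induction l with
  | nil => exact Run.loop_false (by simp [testState, read_write])
  | cons a l ih =>
    exact Run.mono (t := 1 + (4 * l.length + 2) + 2) (by rw [List.length_cons]; omega)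
      (Run.loop_true (by simp [testState, read_write])
        (takes_act (by simp [StackAct.apply, write_write])) ih)

theorem takes_clearStack (read_write : ∀ v o, read (write v o) = o)
    (write_write : ∀ v o o', write (write v o) o' = write v o') (v : σ)
    (S : ∀ k, List (Γ k)) :
    Takes (clearStack k write read) (v, S) (4 * (S k).length + 3)
      (write v none, Function.update S k []) :=
  Run.mono (by omega) (Run.seq (takes_act rfl)
    (takes_clearStack_loop read_write write_write v (S k) S))

end Drain

/-! ### Random access memory on a stack machine -/

/-- The stacks of the evaluator: the input, the remaining bits of the evaluated word, scratch space,
the current address, the memory log, the part of the log already scanned, and the output. -/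
inductive Stk
  | inp
  | xs
  | tmp
  | pat
  | log
  | dump
  | out
  deriving DecidableEq

instance : Finite Stk :=
  Finite.of_surjective ![Stk.inp, .xs, .tmp, .pat, .log, .dump, .out] fun
    | .inp => ⟨0, rfl⟩
    | .xs => ⟨1, rfl⟩
    | .tmp => ⟨2, rfl⟩
    | .pat => ⟨3, rfl⟩
    | .log => ⟨4, rfl⟩
    | .dump => ⟨5, rfl⟩
    | .out => ⟨6, rfl⟩

/-- The alphabets of the evaluator. On the stack `log`, address bits are in the left summand and
contents in the right one; on `inp` the left summand is the evaluated word, the right one its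
advice. -/
abbrev Stk.Sym : Stk → Type
  | .inp | .log | .dump => Bool ⊕ Bool
  | .xs | .tmp | .pat | .out => Bool

/-- Operations on a bit of memory, coded by six bits; `m₀` and `m₁` select the kind of operation
(see `Op.exec`), the other bits give the reply and the effect on the contents `0` and `1`. -/
structure Op where
  m₀ : Bool
  m₁ : Bool
  y₀ : Bool
  y₁ : Bool
  e₀ : Bool
  e₁ : Bool

instance : Finite Op :=
  Finite.of_injective (fun o => (o.m₀, o.m₁, o.y₀, o.y₁, o.e₀, o.e₁))
    (by rintro ⟨⟩ ⟨⟩ h; simpa using h)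

/-- The internal state of the evaluator: the symbols read last, the status of a comparison of
addresses, the content found, two flags, and the current operation. -/
structure Ctl where
  sym : Option (Bool ⊕ Bool)
  bit : Option Bool
  eq : Bool
  res : Option Bool
  act : Bool
  cond : Bool
  op : Op

instance : Finite Ctl :=
  Finite.of_injective (fun c => (c.sym, c.bit, c.eq, c.res, c.act, c.cond, c.op))
    (by rintro ⟨⟩ ⟨⟩ h; simpa using h)

/-- The contents of all stacks of the evaluator. -/
structure Stacks where
  inp : List (Bool ⊕ Bool) := []
  xs : List Bool := []
  tmp : List Bool := []
  pat : List Bool := []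
  log : List (Bool ⊕ Bool) := []
  dump : List (Bool ⊕ Bool) := []
  out : List Bool := []

/-- The content of a stack. -/
def Stacks.get (S : Stacks) : ∀ k : Stk, List k.Sym
  | .inp => S.inp
  | .xs => S.xs
  | .tmp => S.tmp
  | .pat => S.pat
  | .log => S.log
  | .dump => S.dump
  | .out => S.out

/-- Replacement of the content of a stack. -/
def Stacks.set (S : Stacks) : ∀ k : Stk, List k.Sym → Stacks
  | .inp, l => { S with inp := l }
  | .xs, l => { S with xs := l }
  | .tmp, l => { S with tmp := l }
  | .pat, l => { S with pat := l }
  | .log, l => { S with log := l }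
  | .dump, l => { S with dump := l }
  | .out, l => { S with out := l }

theorem Stacks.update_get (S : Stacks) (k : Stk) (l : List k.Sym) :
    Function.update S.get k l = (S.set k l).get := by
  funext j
  cases k <;> cases j <;> rfl

/-- Programs of the evaluator. -/
abbrev EvalProg := StackProg Stk Stk.Sym Ctl

/-- Transition within `t` steps between states of the evaluator. -/
abbrev EvalTakes (p : EvalProg) (c : Ctl) (S : Stacks) (t : ℕ) (c' : Ctl) (S' : Stacks) : Prop :=
  Takes p (c, S.get) t (c', S'.get)

section EvalTakes

variable {c : Ctl} {S : Stacks}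

theorem evalTakes_load (f : Ctl → Ctl) : EvalTakes (.act (.load f)) c S 1 (f c) S :=
  takes_act rfl

theorem evalTakes_peek (k : Stk) (f : Ctl → Option k.Sym → Ctl) :
    EvalTakes (.act (.peek k f)) c S 1 (f c (S.get k).head?) S :=
  takes_act rfl

theorem evalTakes_push (k : Stk) (f : Ctl → k.Sym) :
    EvalTakes (.act (.push k f)) c S 1 c (S.set k (f c :: S.get k)) :=
  takes_act (by rw [StackAct.apply, S.update_get])

theorem evalTakes_pop (k : Stk) (f : Ctl → Option k.Sym → Ctl) :
    EvalTakes (.act (.pop k f)) c S 1 (f c (S.get k).head?) (S.set k (S.get k).tail) :=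
  takes_act (by rw [StackAct.apply, S.update_get])

end EvalTakes

/-- The bit in a symbol, `false` if there is none. -/
def bitOf : Option (Bool ⊕ Bool) → Bool
  | none => false
  | some (.inl b) => b
  | some (.inr b) => b

/-- Record the symbol read from a stack of marked bits. -/
def setSym (c : Ctl) (o : Option (Bool ⊕ Bool)) : Ctl := { c with sym := o }

/-- Record the bit read from a stack of bits. -/
def setBit (c : Ctl) (o : Option Bool) : Ctl := { c with bit := o }

/-- The program that moves `tmp` to `pat`. -/
def tmpToPat : EvalProg := drain .tmp .pat setBit Ctl.bit fun c => c.bit.getD false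

/-- The program that moves `tmp` to `xs`. -/
def tmpToXs : EvalProg := drain .tmp .xs setBit Ctl.bit fun c => c.bit.getD false

/-- The program that moves `pat` to `tmp`. -/
def patToTmp : EvalProg := drain .pat .tmp setBit Ctl.bit fun c => c.bit.getD false

/-- The program that moves `tmp` to `log` as an address. -/
def tmpToLog : EvalProg := drain .tmp .log setBit Ctl.bit fun c => .inl (c.bit.getD false)

/-- The program that moves `dump` to `log`. -/
def dumpToLog : EvalProg := drain .dump .log setSym Ctl.sym fun c => c.sym.getD (.inl false)

section Moves

variable {c : Ctl} {S : Stacks}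

theorem evalTakes_drain {k d : Stk} (hkd : k ≠ d) {write : Ctl → Option k.Sym → Ctl}
    {read : Ctl → Option k.Sym} {g : Ctl → d.Sym} (h : k.Sym → d.Sym)
    {S' : Stacks} (hS' : (S.set k []).set d (((S.get k).map h).reverse ++ S.get d) = S')
    (read_write : ∀ v o, read (write v o) = o := by intros; rfl)
    (write_write : ∀ v o o', write (write v o) o' = write v o' := by intros; rfl)
    (g_write : ∀ v a, g (write v (some a)) = h a := by intros; rfl) :
    EvalTakes (drain k d write read g) c S (4 * (S.get k).length + 3) (write c none) S' := by
  rw [EvalTakes, ← hS', ← Stacks.update_get, ← Stacks.update_get]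
  exact takes_drain hkd read_write write_write g_write c S.get

theorem takes_tmpToPat : EvalTakes tmpToPat c S (4 * S.tmp.length + 3)
    { c with bit := none } { S with tmp := [], pat := S.tmp.reverse ++ S.pat } :=
  evalTakes_drain (k := .tmp) (d := .pat) (by decide) (fun b => b)
    (by simp [Stacks.get, Stacks.set])

theorem takes_tmpToXs : EvalTakes tmpToXs c S (4 * S.tmp.length + 3)
    { c with bit := none } { S with tmp := [], xs := S.tmp.reverse ++ S.xs } :=
  evalTakes_drain (k := .tmp) (d := .xs) (by decide) (fun b => b)
    (by simp [Stacks.get, Stacks.set])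

theorem takes_patToTmp : EvalTakes patToTmp c S (4 * S.pat.length + 3)
    { c with bit := none } { S with pat := [], tmp := S.pat.reverse ++ S.tmp } :=
  evalTakes_drain (k := .pat) (d := .tmp) (by decide) (fun b => b)
    (by simp [Stacks.get, Stacks.set])

theorem takes_tmpToLog : EvalTakes tmpToLog c S (4 * S.tmp.length + 3)
    { c with bit := none } { S with tmp := [], log := (S.tmp.map Sum.inl).reverse ++ S.log } :=
  evalTakes_drain (k := .tmp) (d := .log) (by decide) Sum.inl rfl

theorem takes_dumpToLog : EvalTakes dumpToLog c S (4 * S.dump.length + 3)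
    { c with sym := none } { S with dump := [], log := S.dump.reverse ++ S.log } :=
  evalTakes_drain (k := .dump) (d := .log) (by decide) (fun b => b)
    (by simp [Stacks.get, Stacks.set])

end Moves

/-! ### Lookup in the log -/

/-- The history of a memory: pairs of the address and the content of a write, the most recent one
first. -/
abbrev Log := List (List Bool × Bool)

/-- The representation of a log on a stack. -/
def encodeLog (rs : Log) : List (Bool ⊕ Bool) :=
  rs.flatMap fun r => r.1.map Sum.inl ++ [.inr r.2]

/-- The most recent content at an address `a`. An entry for a prefix of `a` counts as an entry for
`a`, so that the addresses in use have to form a prefix code. -/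
def lookup (a : List Bool) : Log → Option Bool
  | [] => none
  | r :: rs => if r.1.isPrefixOf a then some r.2 else lookup a rs

/-- Compare the symbol read with the pattern. -/
def compareSym (c : Ctl) : Ctl := { c with eq := c.eq && c.bit == some (bitOf c.sym) }

/-- Note the content read if the address has matched and no more recent content has been found. -/
def noteContent (c : Ctl) : Ctl :=
  { c with
    res := c.res.or (if c.eq then some (bitOf c.sym) else none)
    eq := true }

/-- Test whether the symbol read last is in the left summand. -/
def isLeftSym (c : Ctl) : Bool :=
  match c.sym with
  | some (.inl _) => true
  | _ => false

/-- The program that processes one symbol of the log. -/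
def scanStep : EvalProg :=
  .seq (.act (.push .dump fun c => c.sym.getD (.inl false))) <|
  .seq (.ite isLeftSym
    (.seq (.act (.pop .pat setBit)) <| .seq (.act (.load compareSym)) <|
      .ite (fun c => c.bit.isSome) (.act (.push .tmp fun c => c.bit.getD false)) .skip)
    (.seq (.act (.load noteContent)) tmpToPat)) <|
  .act (.pop .log setSym)

/-- The program that processes the log. -/
def scanLoop : EvalProg := .loop (fun c => c.sym.isSome) scanStep

section Scan

variable (c : Ctl) (S : Stacks)

theorem takes_scanStep_inl (b : Bool) : EvalTakes scanStep { c with sym := some (.inl b) } S 9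
    { c with sym := S.log.head?, bit := S.pat.head?, eq := c.eq && S.pat.head? == some b }
    { S with
      tmp := S.pat.head?.toList ++ S.tmp, pat := S.pat.tail, log := S.log.tail
      dump := .inl b :: S.dump } := by
  obtain ⟨inp, xs, tmp, pat, log, dump, out⟩ := S
  have hpush : EvalTakes
      (.ite (fun c => c.bit.isSome) (.act (.push .tmp fun c => c.bit.getD false)) .skip)
      (compareSym (setBit { c with sym := some (.inl b) } pat.head?))
      ⟨inp, xs, tmp, pat.tail, log, .inl b :: dump, out⟩ 3
      (compareSym (setBit { c with sym := some (.inl b) } pat.head?))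
      ⟨inp, xs, pat.head?.toList ++ tmp, pat.tail, log, .inl b :: dump, out⟩ := by
    cases pat with
    | nil => exact Run.mono (by omega) (Run.ite_false rfl (Run.skip _))
    | cons b' pat => exact Run.ite_true rfl (evalTakes_push .tmp _)
  exact Run.mono (t := 1 + (1 + (1 + 3) + 2 + 1)) le_rfl
    (Run.seq (evalTakes_push .dump _) (Run.seq
      (Run.ite_true rfl (Run.seq (evalTakes_pop .pat _) (Run.seq (evalTakes_load _) hpush)))
      (evalTakes_pop .log _)))

theorem takes_scanStep_inr (v : Bool) : EvalTakes scanStep { c with sym := some (.inr v) } S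
    (4 * S.tmp.length + 8)
    { c with
      sym := S.log.head?, bit := none, eq := true
      res := c.res.or (if c.eq then some v else none) }
    { S with
      tmp := [], pat := S.tmp.reverse ++ S.pat, log := S.log.tail, dump := .inr v :: S.dump } :=
  Run.mono (t := 1 + (1 + (4 * S.tmp.length + 3) + 2 + 1)) (by omega)
    (Run.seq (evalTakes_push .dump _) (Run.seq
      (Run.ite_false rfl (Run.seq (evalTakes_load _) takes_tmpToPat)) (evalTakes_pop .log _)))

variable {c S}

theorem takes_scanLoop_map_inl {a : List Bool} {l : List (Bool ⊕ Bool)} {t : ℕ} {c' : Ctl}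
    {S' : Stacks} (h : ∀ bt, EvalTakes scanLoop
      { c with sym := l.head?, bit := bt, eq := c.eq && a.isPrefixOf S.pat }
      { S with
        tmp := (S.pat.take a.length).reverse ++ S.tmp, pat := S.pat.drop a.length
        log := l.tail, dump := (a.map Sum.inl).reverse ++ S.dump } t c' S') :
    EvalTakes scanLoop { c with sym := (a.map Sum.inl ++ l).head? }
      { S with log := (a.map Sum.inl ++ l).tail } (11 * a.length + t) c' S' := by
  induction a generalizing c S with
  | nil => simpa using h c.bit
  | cons b a ih =>
    refine Run.mono (t := 9 + (11 * a.length + t) + 2) (by rw [List.length_cons]; omega)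
      (Run.loop_true rfl (takes_scanStep_inl c { S with log := a.map Sum.inl ++ l } b)
        (ih (c := { c with bit := S.pat.head?, eq := c.eq && S.pat.head? == some b })
          (S := { S with
            tmp := S.pat.head?.toList ++ S.tmp, pat := S.pat.tail
            dump := .inl b :: S.dump }) fun bt => ?_))
    cases hpat : S.pat with
    | nil => simpa [hpat] using h bt
    | cons b' pat =>
      simpa [hpat, Bool.and_assoc, List.isPrefixOf, Bool.beq_comm (a := b)] using h bt

theorem takes_scanLoop (pat : List Bool) (rs : Log) : ∃ bt, EvalTakes scanLoop
    { c with sym := (encodeLog rs).head?, eq := true }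
    { S with tmp := [], pat := pat, log := (encodeLog rs).tail } (24 * (encodeLog rs).length + 2)
    { c with sym := none, bit := bt, eq := true, res := c.res.or (lookup pat rs) }
    { S with tmp := [], pat := pat, log := [], dump := (encodeLog rs).reverse ++ S.dump } := by
  induction rs generalizing c S with
  | nil =>
    refine ⟨c.bit, ?_⟩
    simp only [lookup, Option.or_none]
    exact Run.loop_false rfl
  | cons r rs ih =>
    obtain ⟨a, v⟩ := r
    obtain ⟨bt, hrs⟩ := ih
      (c := { c with res := c.res.or (if a.isPrefixOf pat then some v else none), bit := none })
      (S := { S with dump := .inr v :: ((a.map Sum.inl).reverse ++ S.dump) })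
    have hlog : encodeLog ((a, v) :: rs) = a.map Sum.inl ++ (.inr v :: encodeLog rs) := by
      simp [encodeLog]
    have hres : c.res.or (lookup pat ((a, v) :: rs)) =
        (c.res.or (if a.isPrefixOf pat then some v else none)).or (lookup pat rs) := by
      rw [Option.or_assoc, lookup]
      cases a.isPrefixOf pat <;> rfl
    have hdump : (a.map Sum.inl ++ (Sum.inr v :: encodeLog rs)).reverse ++ S.dump =
        (encodeLog rs).reverse ++ (Sum.inr v :: ((a.map Sum.inl).reverse ++ S.dump)) := by
      simp
    have : (pat.take a.length).length ≤ a.length := by simp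
    rw [hlog, hres, hdump]
    refine ⟨bt, Run.mono (t := 11 * a.length +
      (4 * (pat.take a.length).length + 8 + (24 * (encodeLog rs).length + 2) + 2))
      (by simp; omega) (takes_scanLoop_map_inl (c := { c with eq := true })
        (S := { S with tmp := [], pat := pat }) fun bt₁ => ?_)⟩
    have hstep := takes_scanStep_inr { c with eq := a.isPrefixOf pat, bit := bt₁ }
      { S with
        tmp := (pat.take a.length).reverse, pat := pat.drop a.length, log := encodeLog rs
        dump := (a.map Sum.inl).reverse ++ S.dump } v
    simp only [List.length_reverse, List.reverse_reverse, List.take_append_drop] at hstep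
    exact Run.loop_true rfl (by simpa using hstep) hrs

end Scan

/-! ### The evaluator -/

/-- The effect of an operation on the content `b` of a bit of memory and the two flags, given the
next input bit `i`. The four kinds of operations are: a method applied to `b` if `act` holds, with
its reply going to `cond`; copying `b` to `act`; setting `b` if `act` holds and `cond` has a given
value; loading the input bit into `b`. -/
def Op.exec (o : Op) (b i act cond : Bool) : Bool × Bool × Bool :=
  match o.m₀, o.m₁ with
  | false, false =>
    if act then (if b then o.e₁ else o.e₀, act, if b then o.y₁ else o.y₀) else (b, act, cond)
  | false, true => (b, b, cond)
  | true, false => (b || (act && cond == o.y₀), act, cond)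
  | true, true => (i, act, cond)

/-- The abstract state of the evaluator: flags, remaining input, current address, and memory. -/
structure EvalState where
  act : Bool
  cond : Bool
  xs : List Bool
  pat : List Bool
  rs : Log

/-- The effect of an operation on the abstract state. -/
def EvalState.exec (s : EvalState) (o : Op) : EvalState :=
  let r := o.exec ((lookup s.pat s.rs).getD false) (s.xs.headD false) s.act s.cond
  { act := r.2.1
    cond := r.2.2
    xs := if o.m₀ && o.m₁ then s.xs.tail else s.xs
    pat := []
    rs := (s.pat, r.1) :: s.rs }

/-- The operation coded by the first six bits. -/
def opOfBits (l : List Bool) : Op :=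
  ⟨l.getD 0 false, l.getD 1 false, l.getD 2 false, l.getD 3 false, l.getD 4 false, l.getD 5 false⟩

/-- Interpretation of a bit string as a program: `true` announces a bit of an address, `false` an
operation. -/
def interp : List Bool → EvalState → EvalState
  | [], s => s
  | true :: l, s => interp l.tail { s with pat := l.headD false :: s.pat }
  | false :: l, s => interp (l.drop 6) (s.exec (opOfBits l))
termination_by l => l.length
decreasing_by
  · simp
  · simp

/-- The answer of the program `a` on input `x`. -/
def evalAnswer (x a : List Bool) : Bool := (interp a ⟨true, false, x, [], []⟩).act

theorem length_encodeLog_exec (s : EvalState) (o : Op) :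
    (s.exec o).pat.length + (encodeLog (s.exec o).rs).length =
      s.pat.length + (encodeLog s.rs).length + 1 := by
  simp only [EvalState.exec, encodeLog, List.flatMap_cons, List.length_append, List.length_map,
    List.length_cons, List.length_nil]
  omega

theorem length_interp_le (l : List Bool) (s : EvalState) :
    (interp l s).pat.length + (encodeLog (interp l s).rs).length ≤
      l.length + (s.pat.length + (encodeLog s.rs).length) := by
  induction l, s using interp.induct with
  | case1 s => simp [interp]
  | case2 l s ih =>
    rw [interp]
    simp only [List.length_tail, List.length_cons] at ih ⊢
    omega
  | case3 l s ih =>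
    rw [interp]
    have := length_encodeLog_exec s (opOfBits l)
    simp only [List.length_drop, List.length_cons] at ih ⊢
    omega

theorem length_xs_interp_le (l : List Bool) (s : EvalState) :
    (interp l s).xs.length ≤ s.xs.length := by
  induction l, s using interp.induct with
  | case1 s => rw [interp]
  | case2 l s ih => rwa [interp]
  | case3 l s ih =>
    rw [interp]
    refine ih.trans ?_
    simp only [EvalState.exec]
    split <;> simp

/-- The internal states of the evaluator that represent an abstract state. -/
def EvalState.ctl (s : EvalState) (c : Ctl) : Ctl := { c with act := s.act, cond := s.cond }

/-- The stacks that represent an abstract state while `inp` is the remaining program. -/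
def EvalState.stacks (s : EvalState) (inp : List (Bool ⊕ Bool)) : Stacks :=
  { inp := inp, xs := s.xs, pat := s.pat, log := encodeLog s.rs }

/-- Prepare for a lookup. -/
def Ctl.startLookup (c : Ctl) : Ctl := { c with eq := true, res := none }

/-- Execute the current operation on the bit found by the lookup. -/
def Ctl.execOp (c : Ctl) : Ctl :=
  let r := c.op.exec (c.res.getD false) (c.bit.getD false) c.act c.cond
  { c with res := some r.1, act := r.2.1, cond := r.2.2 }

/-- The program that reads an input bit if the current operation needs one. -/
def readBit : EvalProg := .ite (fun c => c.op.m₀ && c.op.m₁) (.act (.pop .xs setBit)) .skip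

/-- The program that executes the current operation at the current address. -/
def opProg : EvalProg :=
  .seq (.act (.load Ctl.startLookup)) <|
  .seq (.act (.pop .log setSym)) <|
  .seq scanLoop <|
  .seq dumpToLog <|
  .seq readBit <|
  .seq (.act (.load Ctl.execOp)) <|
  .seq (.act (.push .log fun c => .inr (c.res.getD false))) <|
  .seq patToTmp tmpToLog

/-- The program that reads the code of an operation. -/
def readOp : EvalProg :=
  .seq (.act (.pop .inp fun c o => { c with op := { c.op with m₀ := bitOf o } })) <|
  .seq (.act (.pop .inp fun c o => { c with op := { c.op with m₁ := bitOf o } })) <|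
  .seq (.act (.pop .inp fun c o => { c with op := { c.op with y₀ := bitOf o } })) <|
  .seq (.act (.pop .inp fun c o => { c with op := { c.op with y₁ := bitOf o } })) <|
  .seq (.act (.pop .inp fun c o => { c with op := { c.op with e₀ := bitOf o } })) <|
  .act (.pop .inp fun c o => { c with op := { c.op with e₁ := bitOf o } })

/-- The program for one round of the evaluator. -/
def mainStep : EvalProg :=
  .seq (.ite (fun c => bitOf c.sym)
    (.seq (.act (.pop .inp setSym)) (.act (.push .pat fun c => bitOf c.sym)))
    (.seq readOp opProg)) <|
  .act (.pop .inp setSym)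

/-- The program that processes the advice. -/
def mainLoop : EvalProg := .loop (fun c => c.sym.isSome) mainStep

section Rounds

variable (c : Ctl) (s : EvalState)

theorem takes_readBit (S : Stacks) :
    EvalTakes readBit c S 3 { c with bit := if c.op.m₀ && c.op.m₁ then S.xs.head? else c.bit }
      { S with xs := if c.op.m₀ && c.op.m₁ then S.xs.tail else S.xs } := by
  cases hm : (c.op.m₀ && c.op.m₁) with
  | true => exact Run.ite_true hm (evalTakes_pop .xs _)
  | false => exact Run.mono (by omega) (Run.ite_false hm (Run.skip _))

theorem takes_execOp (bt : Option Bool) (S : Stacks) :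
    EvalTakes (.act (.load Ctl.execOp))
      { s.ctl c with
        bit := if c.op.m₀ && c.op.m₁ then s.xs.head? else bt
        res := lookup s.pat s.rs } S 1
      ((s.exec c.op).ctl { c with
        bit := if c.op.m₀ && c.op.m₁ then s.xs.head? else bt
        res := (s.exec c.op).rs.head?.map Prod.snd }) S := by
  have hbit : ∀ b, c.op.exec b ((if c.op.m₀ && c.op.m₁ then s.xs.head? else bt).getD false)
      s.act s.cond = c.op.exec b (s.xs.headD false) s.act s.cond := fun b => by
    cases hm₀ : c.op.m₀ <;> cases hm₁ : c.op.m₁ <;> simp [Op.exec, hm₀, hm₁]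
  refine takes_act ?_
  simp only [StackAct.apply, Ctl.execOp, EvalState.ctl, EvalState.exec, hbit, List.head?_cons,
    Option.map_some]

theorem takes_patToTmp_tmpToLog (o : Op) (inp : List (Bool ⊕ Bool)) :
    EvalTakes (.seq patToTmp tmpToLog) c
      { s.stacks inp with
        xs := (s.exec o).xs
        log := .inr (((s.exec o).rs.head?.map Prod.snd).getD false) :: encodeLog s.rs }
      (8 * s.pat.length + 6) { c with bit := none } ((s.exec o).stacks inp) := by
  have hlog : (s.exec o).stacks inp =
      { inp := inp, xs := (s.exec o).xs
        log := ((s.pat.reverse ++ []).map Sum.inl).reverse ++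
          .inr (((s.exec o).rs.head?.map Prod.snd).getD false) :: encodeLog s.rs } := by
    simp [EvalState.stacks, EvalState.exec, encodeLog]
  rw [hlog]
  exact Run.mono (t := 4 * s.pat.length + 3 + (4 * (s.pat.reverse ++ []).length + 3))
    (by rw [List.append_nil, List.length_reverse]; omega) (Run.seq takes_patToTmp takes_tmpToLog)

theorem takes_opProg (inp : List (Bool ⊕ Bool)) : ∃ c',
    EvalTakes opProg (s.ctl c) (s.stacks inp)
      (28 * (encodeLog s.rs).length + 8 * s.pat.length + 18)
      ((s.exec c.op).ctl c') ((s.exec c.op).stacks inp) := by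
  obtain ⟨bt, hscan⟩ := takes_scanLoop (c := (s.ctl c).startLookup)
    (S := { inp := inp, xs := s.xs }) s.pat s.rs
  have hdump := takes_dumpToLog (c := { (s.ctl c).startLookup with
      sym := none, bit := bt, eq := true, res := lookup s.pat s.rs })
    (S := { inp := inp, xs := s.xs, pat := s.pat, dump := (encodeLog s.rs).reverse ++ [] })
  simp only [List.append_nil, List.length_reverse, List.reverse_reverse] at hscan hdump
  have hexec := takes_execOp { c with sym := none, eq := true } s bt
    { s.stacks inp with xs := (s.exec c.op).xs }
  exact ⟨{ c with
    sym := none, bit := none, eq := true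
    res := (s.exec c.op).rs.head?.map Prod.snd },
    Run.mono (t := 1 + (1 + ((24 * (encodeLog s.rs).length + 2) +
      ((4 * (encodeLog s.rs).length + 3) + (3 + (1 + (1 + (8 * s.pat.length + 6))))))))
    (by omega) (Run.seq (evalTakes_load _) (Run.seq (evalTakes_pop .log _) (Run.seq hscan
      (Run.seq hdump (Run.seq (takes_readBit _ _) (Run.seq hexec
      (Run.seq (evalTakes_push .log _) (takes_patToTmp_tmpToLog _ s c.op inp))))))))⟩

theorem takes_readOp (S : Stacks) (l : List Bool) :
    EvalTakes readOp c { S with inp := l.map Sum.inr } 6 { c with op := opOfBits l }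
      { S with inp := (l.drop 6).map Sum.inr } := by
  have h := Run.seq (evalTakes_pop (c := c) (S := { S with inp := l.map Sum.inr }) .inp
      fun c o => { c with op := { c.op with m₀ := bitOf o } })
    (Run.seq (evalTakes_pop .inp fun c o => { c with op := { c.op with m₁ := bitOf o } })
    (Run.seq (evalTakes_pop .inp fun c o => { c with op := { c.op with y₀ := bitOf o } })
    (Run.seq (evalTakes_pop .inp fun c o => { c with op := { c.op with y₁ := bitOf o } })
    (Run.seq (evalTakes_pop .inp fun c o => { c with op := { c.op with e₀ := bitOf o } })
    (evalTakes_pop .inp fun c o => { c with op := { c.op with e₁ := bitOf o } })))))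
  rcases l with _ | ⟨_, _ | ⟨_, _ | ⟨_, _ | ⟨_, _ | ⟨_, _ | ⟨_, l⟩⟩⟩⟩⟩⟩ <;> exact h

theorem takes_mainStep_true (l : List Bool) :
    EvalTakes mainStep (s.ctl { c with sym := some (.inr true) }) (s.stacks (l.map Sum.inr)) 5
      (s.ctl { c with sym := (l.tail.map Sum.inr).head? })
      (EvalState.stacks { s with pat := l.headD false :: s.pat } (l.tail.map Sum.inr).tail) := by
  have h := Run.seq (Run.ite_true (q := .seq readOp opProg) (c := fun c => bitOf c.sym) rfl
    (Run.seq (evalTakes_pop (c := s.ctl { c with sym := some (.inr true) })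
      (S := s.stacks (l.map Sum.inr)) .inp setSym) (evalTakes_push .pat fun c => bitOf c.sym)))
    (evalTakes_pop .inp setSym)
  cases l <;> exact h

theorem takes_mainStep_false (l : List Bool) : ∃ c' : Ctl,
    EvalTakes mainStep (s.ctl { c with sym := some (.inr false) }) (s.stacks (l.map Sum.inr))
      (28 * (encodeLog s.rs).length + 8 * s.pat.length + 27)
      ((s.exec (opOfBits l)).ctl { c' with sym := ((l.drop 6).map Sum.inr).head? })
      ((s.exec (opOfBits l)).stacks ((l.drop 6).map Sum.inr).tail) := by
  obtain ⟨c', hop⟩ := takes_opProg { c with sym := some (.inr false), op := opOfBits l } s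
    ((l.drop 6).map Sum.inr)
  exact ⟨c', Run.mono (t := 6 + (28 * (encodeLog s.rs).length + 8 * s.pat.length + 18) + 2 + 1)
    (by omega) (Run.seq (Run.ite_false rfl
    (Run.seq (takes_readOp _ (s.stacks []) l) hop)) (evalTakes_pop .inp setSym))⟩

theorem takes_mainLoop {N : ℕ} {l : List Bool}
    (hN : l.length + (s.pat.length + (encodeLog s.rs).length) ≤ N) : ∃ c',
    EvalTakes mainLoop (s.ctl { c with sym := (l.map Sum.inr).head? })
      (s.stacks (l.map Sum.inr).tail) (l.length * (40 * (N + 1)) + 2)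
      ((interp l s).ctl c') ((interp l s).stacks []) := by
  induction l, s using interp.induct generalizing c with
  | case1 s =>
    rw [interp]
    exact ⟨{ c with sym := none }, Run.mono (by omega) (Run.loop_false rfl)⟩
  | case2 l s ih =>
    rw [interp]
    obtain ⟨c', hloop⟩ := ih c (by
      simp only [List.length_tail, List.length_cons] at hN ⊢; omega)
    have hle : l.tail.length * (40 * (N + 1)) ≤ l.length * (40 * (N + 1)) :=
      Nat.mul_le_mul_right _ (by simp)
    refine ⟨c', Run.mono ?_ (Run.loop_true rfl (takes_mainStep_true c s l) hloop)⟩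
    rw [List.length_cons, Nat.succ_mul l.length]
    omega
  | case3 l s ih =>
    rw [interp]
    have hlen := length_encodeLog_exec s (opOfBits l)
    obtain ⟨c₁, hstep⟩ := takes_mainStep_false c s l
    obtain ⟨c', hloop⟩ := ih c₁ (by
      simp only [List.length_drop, List.length_cons] at hN ⊢; omega)
    have hle : (l.drop 6).length * (40 * (N + 1)) ≤ l.length * (40 * (N + 1)) :=
      Nat.mul_le_mul_right _ (by simp)
    refine ⟨c', Run.mono ?_ (Run.loop_true rfl hstep hloop)⟩
    rw [List.length_cons] at hN ⊢
    rw [Nat.succ_mul l.length]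
    omega

end Rounds

/-- Record the bit in the symbol read. -/
def copyBit (c : Ctl) (o : Option (Bool ⊕ Bool)) : Ctl := { c with bit := some (bitOf o) }

/-- The program that moves the word from `inp` to `tmp`. -/
def splitLoop : EvalProg :=
  .loop isLeftSym <|
    .seq (.act (.pop .inp copyBit)) <|
    .seq (.act (.push .tmp fun c => c.bit.getD false)) <|
    .act (.peek .inp setSym)

theorem takes_splitLoop (c : Ctl) (x a tmp : List Bool) : ∃ bt,
    EvalTakes splitLoop { c with sym := (x.map Sum.inl ++ a.map Sum.inr).head? }
      { inp := x.map Sum.inl ++ a.map Sum.inr, tmp := tmp } (5 * x.length + 2)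
      { c with sym := (a.map Sum.inr).head?, bit := bt }
      { inp := a.map Sum.inr, tmp := x.reverse ++ tmp } := by
  induction x generalizing c tmp with
  | nil => exact ⟨c.bit, Run.loop_false (by cases a <;> rfl)⟩
  | cons b x ih =>
    obtain ⟨bt, hloop⟩ := ih { c with bit := some b } (b :: tmp)
    have htmp : (b :: x).reverse ++ tmp = x.reverse ++ b :: tmp := by simp
    rw [htmp]
    exact ⟨bt, Run.mono (t := 1 + (1 + 1) + (5 * x.length + 2) + 2)
      (by rw [List.length_cons]; omega)
      (Run.loop_true rfl (Run.seq (evalTakes_pop .inp _)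
        (Run.seq (evalTakes_push .tmp _) (evalTakes_peek .inp _))) hloop)⟩

/-- The initial internal state of the evaluator. -/
def Ctl.init : Ctl :=
  ⟨none, none, true, none, true, false, ⟨false, false, false, false, false, false⟩⟩

/-- The program that replaces a word with advice by the answer. -/
def evalProg : EvalProg :=
  .seq (.act (.peek .inp setSym)) <|
  .seq splitLoop <|
  .seq tmpToXs <|
  .seq (.act (.pop .inp setSym)) <|
  .seq mainLoop <|
  .seq (clearStack .xs setBit Ctl.bit) <|
  .seq (clearStack .pat setBit Ctl.bit) <|
  .seq (clearStack .log setSym Ctl.sym) <|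
  .seq (.act (.push .out Ctl.act)) <|
  .act (.load fun _ => Ctl.init)

theorem evalTakes_clearStack {c : Ctl} {S : Stacks} (k : Stk) {write : Ctl → Option k.Sym → Ctl}
    {read : Ctl → Option k.Sym} (read_write : ∀ v o, read (write v o) = o := by intros; rfl)
    (write_write : ∀ v o o', write (write v o) o' = write v o' := by intros; rfl) :
    EvalTakes (clearStack k write read) c S (4 * (S.get k).length + 3) (write c none)
      (S.set k []) := by
  rw [EvalTakes, ← Stacks.update_get]
  exact takes_clearStack read_write write_write c S.get

theorem takes_evalProg (x a : List Bool) :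
    EvalTakes evalProg Ctl.init { inp := x.map Sum.inl ++ a.map Sum.inr }
      (100 * (x.length + a.length + 1) ^ 2) Ctl.init { out := [evalAnswer x a] } := by
  obtain ⟨bt, hsplit⟩ := takes_splitLoop Ctl.init x a []
  obtain ⟨c, hloop⟩ := takes_mainLoop { Ctl.init with bit := none } ⟨true, false, x, [], []⟩
    (N := a.length) (l := a) le_rfl
  have hlog := length_interp_le a ⟨true, false, x, [], []⟩
  have hxs := length_xs_interp_le a ⟨true, false, x, [], []⟩
  have hload := takes_tmpToXs
    (c := { Ctl.init with sym := (a.map Sum.inr).head?, bit := bt })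
    (S := { inp := a.map Sum.inr, tmp := x.reverse ++ [] })
  simp only [List.append_nil, List.length_reverse, List.reverse_reverse] at hsplit hload
  rw [evalAnswer]
  generalize interp a ⟨true, false, x, [], []⟩ = s at *
  refine Run.mono (t := 1 + ((5 * x.length + 2) + ((4 * x.length + 3) + (1 +
    ((a.length * (40 * (a.length + 1)) + 2) + ((4 * s.xs.length + 3) + ((4 * s.pat.length + 3) +
      ((4 * (encodeLog s.rs).length + 3) + (1 + 1))))))))) ?_
    (Run.seq (evalTakes_peek .inp _) (Run.seq hsplit (Run.seq hload
      (Run.seq (evalTakes_pop .inp setSym) (Run.seq hloop (Run.seq (evalTakes_clearStack .xs)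
      (Run.seq (evalTakes_clearStack .pat) (Run.seq (evalTakes_clearStack .log)
      (Run.seq (evalTakes_push .out _) (evalTakes_load _))))))))))
  simp only [encodeLog, List.flatMap_nil, List.length_nil] at hlog hxs
  rw [← encodeLog] at hlog
  nlinarith [Nat.zero_le (x.length * a.length), Nat.zero_le (x.length ^ 2)]

theorem polyTimeDecidable_evalAnswer :
    PolyTimeDecidable pairEncoding {p | evalAnswer p.1 p.2 = true} := by
  refine ⟨fun p => evalAnswer p.1 p.2, fun _ => Iff.rfl, ?_⟩
  refine nonempty_tm2ComputableInPolyTime_of_run (K := Stk) (Γ := Stk.Sym) (k₀ := .inp)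
    (k₁ := .out) (v₀ := Ctl.init) (p := evalProg) (Equiv.refl _) (Equiv.refl _)
    (.C 100 * (.X + 1) ^ 2) fun p => ?_
  have get_default : (fun _ => [] : ∀ k : Stk, List k.Sym) = Stacks.get {} := by
    funext k
    cases k <;> rfl
  rw [get_default, Stacks.update_get, Stacks.update_get]
  simp only [pairEncoding, Computability.encodingProd, Computability.encodingList,
    Computability.encodingBoolBool, Computability.encodeBool, Polynomial.eval_mul,
    Polynomial.eval_C, Polynomial.eval_pow, Polynomial.eval_add, Polynomial.eval_X,
    Polynomial.eval_one, List.length_append, List.length_map, id_eq, Equiv.refl_symm,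
    Equiv.coe_refl, List.map_id]
  exact takes_evalProg p.1 p.2

/-! ### Programs with numeric addresses -/

/-- The state of a machine like `EvalState` with memory addressed by numbers. -/
structure NumState where
  act : Bool
  cond : Bool
  xs : List Bool
  mem : ℕ → Bool

/-- The effect of an operation at an address. -/
def NumState.exec (s : NumState) (p : ℕ × Op) : NumState :=
  let r := p.2.exec (s.mem p.1) (s.xs.headD false) s.act s.cond
  { act := r.2.1
    cond := r.2.2
    xs := if p.2.m₀ && p.2.m₁ then s.xs.tail else s.xs
    mem := Function.update s.mem p.1 r.1 }

/-- The effect of a list of operations. -/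
def NumState.run (s : NumState) (l : List (ℕ × Op)) : NumState := l.foldl NumState.exec s

theorem NumState.run_append (s : NumState) (l l' : List (ℕ × Op)) :
    s.run (l ++ l') = (s.run l).run l' :=
  List.foldl_append

/-- The address `a` as `w` bits. -/
def addressBits (w a : ℕ) : List Bool := (List.range w).map a.testBit

theorem length_addressBits (w a : ℕ) : (addressBits w a).length = w := by simp [addressBits]

theorem addressBits_injOn (w : ℕ) : Set.InjOn (addressBits w) (Set.Iio (2 ^ w)) := by
  intro a ha b hb h
  refine Nat.eq_of_testBit_eq fun i => ?_
  by_cases hi : i < w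
  · exact List.map_inj_left.mp h i (List.mem_range.mpr hi)
  · have hw : 2 ^ w ≤ 2 ^ i := Nat.pow_le_pow_right two_pos (not_lt.mp hi)
    rw [Nat.testBit_lt_two_pow (lt_of_lt_of_le ha hw),
      Nat.testBit_lt_two_pow (lt_of_lt_of_le hb hw)]

/-- The bits that code an operation at an address. -/
def encodeOp (w : ℕ) (p : ℕ × Op) : List Bool :=
  (addressBits w p.1).flatMap (fun b => [true, b]) ++
    [false, p.2.m₀, p.2.m₁, p.2.y₀, p.2.y₁, p.2.e₀, p.2.e₁]

theorem length_encodeOp (w : ℕ) (p : ℕ × Op) : (encodeOp w p).length = 2 * w + 7 := by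
  simp [encodeOp, List.length_flatMap, length_addressBits, mul_comm]

theorem interp_flatMap (l rest : List Bool) (s : EvalState) :
    interp (l.flatMap (fun b => [true, b]) ++ rest) s =
      interp rest { s with pat := l.reverse ++ s.pat } := by
  induction l generalizing s with
  | nil => rfl
  | cons b l ih =>
    rw [List.flatMap_cons, List.append_assoc, List.cons_append, interp]
    simp [ih]

theorem interp_encodeOp (w : ℕ) (p : ℕ × Op) (rest : List Bool) {s : EvalState}
    (hs : s.pat = []) :
    interp (encodeOp w p ++ rest) s =
      interp rest (EvalState.exec { s with pat := (addressBits w p.1).reverse } p.2) := by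
  rw [encodeOp, List.append_assoc, interp_flatMap, List.cons_append, interp]
  simp [hs, opOfBits]

/-- The evaluator state `s` represents the state `s'` with numeric addresses of `w` bits. -/
structure Agrees (w : ℕ) (s : EvalState) (s' : NumState) : Prop where
  act : s.act = s'.act
  cond : s.cond = s'.cond
  xs : s.xs = s'.xs
  pat : s.pat = []
  mem : ∀ a < 2 ^ w, (lookup (addressBits w a).reverse s.rs).getD false = s'.mem a

theorem Agrees.exec {w : ℕ} {s : EvalState} {s' : NumState} (h : Agrees w s s') {p : ℕ × Op}
    (hp : p.1 < 2 ^ w) :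
    Agrees w (EvalState.exec { s with pat := (addressBits w p.1).reverse } p.2) (s'.exec p) where
  act := by simp only [EvalState.exec, NumState.exec, h.mem _ hp, h.act, h.cond, h.xs]
  cond := by simp only [EvalState.exec, NumState.exec, h.mem _ hp, h.act, h.cond, h.xs]
  xs := by simp only [EvalState.exec, NumState.exec, h.xs]
  pat := rfl
  mem a ha := by
    simp only [EvalState.exec, NumState.exec, lookup, h.mem _ hp, h.act, h.cond, h.xs]
    by_cases hap : a = p.1
    · subst hap
      simp
    · have not_prefix :
          (addressBits w p.1).reverse.isPrefixOf (addressBits w a).reverse = false := by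
        rw [Bool.eq_false_iff, Ne, List.isPrefixOf_iff_prefix]
        intro hpre
        have heq := hpre.eq_of_length (by simp [length_addressBits])
        exact hap (addressBits_injOn w ha hp (List.reverse_injective heq).symm)
      rw [not_prefix, Function.update_of_ne hap]
      exact h.mem a ha

theorem act_interp_flatMap_encodeOp {w : ℕ} {l : List (ℕ × Op)} (hl : ∀ p ∈ l, p.1 < 2 ^ w)
    {s : EvalState} {s' : NumState} (h : Agrees w s s') :
    (interp (l.flatMap (encodeOp w)) s).act = (s'.run l).act := by
  induction l generalizing s s' with
  | nil =>
    rw [List.flatMap_nil, interp]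
    exact h.act
  | cons p l ih =>
    rw [List.flatMap_cons, interp_encodeOp _ _ _ h.pat]
    exact ih (fun q hq => hl q (List.mem_cons_of_mem _ hq)) (h.exec (hl p List.mem_cons_self))

/-! ### Single pass instruction sequences as programs with numeric addresses -/

/-- The number of a role. -/
def Role.code : Role → ℕ
  | .inp => 1
  | .inout => 2
  | .out0 => 3
  | .out1 => 4
  | .aux0 => 5
  | .aux1 => 6

theorem Role.code_injective : Function.Injective Role.code := by
  rintro ⟨⟩ ⟨⟩ h <;> first | rfl | exact absurd h (by decide)

theorem Role.code_mem_Icc (r : Role) : r.code ∈ Set.Icc 1 6 := by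
  cases r <;> simp [Role.code]

/-- The address of a register. -/
def regAddr (f : Focus) : ℕ := 8 * f.index + f.role.code

/-- The address of the bit that tells whether the instruction at position `i` is to be executed. -/
def posAddr (i : ℕ) : ℕ := 8 * i

theorem regAddr_injective : Function.Injective regAddr := by
  intro f g h
  obtain ⟨hf₁, hf₆⟩ := f.role.code_mem_Icc
  obtain ⟨hg₁, hg₆⟩ := g.role.code_mem_Icc
  rw [regAddr, regAddr] at h
  exact Focus.ext (Role.code_injective (by omega)) (by omega)

theorem posAddr_ne_regAddr (i : ℕ) (f : Focus) : posAddr i ≠ regAddr f := by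
  obtain ⟨hf₁, hf₆⟩ := f.role.code_mem_Icc
  rw [posAddr, regAddr]
  omega

theorem posAddr_injective : Function.Injective posAddr :=
  mul_right_injective₀ (by decide)

/-- The operation that reads a bit into the flag `act`. -/
def Op.read : Op := ⟨false, true, false, false, false, false⟩

/-- The operation that applies a method if the flag `act` is set, with the reply in the flag
`cond`. -/
def Op.method (m : Method) : Op :=
  ⟨false, false, m.yield.apply false, m.yield.apply true, m.effect.apply false,
    m.effect.apply true⟩

/-- The operation that sets a bit if the flag `act` is set and the flag `cond` has the value `b`. -/
def Op.mark (b : Bool) : Op := ⟨true, false, b, false, false, false⟩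

/-- The operation that stores the next input bit. -/
def Op.input : Op := ⟨true, true, false, false, false, false⟩

/-- The operation that sets a bit if the flag `act` is set. -/
def Op.set : Op := .method ⟨.zero, .one⟩

/-- The operations for a basic action at position `i` with next positions `j` (reply `1`) and
`k` (reply `0`). -/
def stepOps (i : ℕ) (a : Action) (j k : ℕ) : List (ℕ × Op) :=
  [(posAddr i, .read), (regAddr a.focus, .method a.method), (posAddr j, .mark true),
    (posAddr k, .mark false)]

section Step

variable {s : NumState}

theorem mem_run_stepOps_of_false {i : ℕ} (h : s.mem (posAddr i) = false) (a : Action) (j k : ℕ) :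
    (s.run (stepOps i a j k)).mem = s.mem := by
  simp [NumState.run, stepOps, NumState.exec, Op.exec, Op.read, Op.method, Op.mark, h]

theorem mem_run_mark_mark (h : s.act = true) (j k n : ℕ) :
    (s.run [(j, .mark true), (k, .mark false)]).mem n =
      (s.mem n || decide (n = if s.cond then j else k)) := by
  simp only [NumState.run, List.foldl_cons, List.foldl_nil, NumState.exec, Op.exec, Op.mark, h,
    Function.update_apply]
  cases s.cond <;> split_ifs <;> simp_all

theorem exec_read {n : ℕ} (h : s.mem n = true) : s.exec (n, .read) = { s with act := true } := by
  simp [NumState.exec, Op.exec, Op.read, h]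

theorem exec_method (h : s.act = true) (n : ℕ) (m : Method) :
    s.exec (n, .method m) =
      { s with
        cond := m.yield.apply (s.mem n)
        mem := Function.update s.mem n (m.effect.apply (s.mem n)) } := by
  cases hn : s.mem n <;> simp [NumState.exec, Op.exec, Op.method, h, hn]

theorem exec_input (n : ℕ) :
    s.exec (n, .input) =
      { s with xs := s.xs.tail, mem := Function.update s.mem n (s.xs.headD false) } :=
  rfl

theorem exec_set (h : s.act = true) (n : ℕ) :
    s.exec (n, .set) = { s with cond := false, mem := Function.update s.mem n true } :=
  exec_method h n _

theorem mem_run_stepOps_of_true {i : ℕ} (h : s.mem (posAddr i) = true) (a : Action) (j k n : ℕ) :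
    (s.run (stepOps i a j k)).mem n =
      (Function.update s.mem (regAddr a.focus) (a.method.effect.apply (s.mem (regAddr a.focus))) n
        || decide (n = if a.method.yield.apply (s.mem (regAddr a.focus)) then posAddr j
          else posAddr k)) := by
  change (((s.exec _).exec _).run [(posAddr j, .mark true), (posAddr k, .mark false)]).mem n = _
  rw [exec_read h, exec_method rfl, mem_run_mark_mark rfl]

end Step

/-- The state `s` represents a run at position `pc ≥ i` with memory `M`, as far as the positions
from `i` on and the registers in `U` are concerned. -/
structure Tracks (U : Set Focus) (i pc : ℕ) (M : Memory) (s : NumState) : Prop where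
  pos : ∀ j ≥ i, s.mem (posAddr j) = decide (j = pc)
  reg : ∀ f ∈ U, s.mem (regAddr f) = M f

/-- An action without effect. -/
def idleAction : Action := ⟨⟨.out0, 1⟩, ⟨.zero, .ident⟩⟩

/-- The operations for the instruction `u` at position `i` of a sequence of length `n`. -/
def instrOps (n i : ℕ) : Instr → List (ℕ × Op)
  | .basic a => stepOps i a (i + 1) (i + 1)
  | .pos a => stepOps i a (i + 1) (min (i + 2) n)
  | .neg a => stepOps i a (min (i + 2) n) (i + 1)
  | .jump k => stepOps i idleAction (min (i + k) n) (min (i + k) n)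
  | .bjump _ => []
  | .term => []

/-- The operations for the instructions from position `i` on. -/
def seqOps (n : ℕ) : ℕ → List Instr → List (ℕ × Op)
  | _, [] => []
  | i, u :: X => instrOps n i u ++ seqOps n (i + 1) X

theorem exec_jump_zero {X : List Instr} {i : ℕ} (h : X[i]? = some (.jump 0)) (t : ℕ)
    (M : Memory) : exec X t i M = none := by
  induction t with
  | zero => rfl
  | succ t ih =>
    rw [exec, h]
    exact ih

theorem lt_length_of_exec_eq_some {X : List Instr} {t pc : ℕ} {M M' : Memory}
    (h : exec X t pc M = some M') : pc < X.length := by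
  by_contra hpc
  cases t with
  | zero => simp [exec] at h
  | succ t =>
    rw [exec, List.getElem?_eq_none (by omega)] at h
    exact nomatch h

theorem mem_run_instrOps_of_false {s : NumState} {i : ℕ} (h : s.mem (posAddr i) = false) (n : ℕ)
    (u : Instr) : (s.run (instrOps n i u)).mem = s.mem := by
  cases u with
  | bjump k => rfl
  | term => rfl
  | _ => exact mem_run_stepOps_of_false h _ _ _

theorem mem_run_seqOps_of_false (n : ℕ) (X : List Instr) {i : ℕ} {s : NumState}
    (h : ∀ j ≥ i, s.mem (posAddr j) = false) : (s.run (seqOps n i X)).mem = s.mem := by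
  induction X generalizing i s with
  | nil => rfl
  | cons u X ih =>
    have hu := mem_run_instrOps_of_false (h i le_rfl) n u
    rw [seqOps, NumState.run_append, ih fun j hj => by rw [hu]; exact h j (by omega), hu]

section Tracks

variable {U : Set Focus} {i pc : ℕ} {M M' : Memory} {s : NumState} {X : List Instr}

theorem Tracks.instrOps_of_lt (h : Tracks U i pc M s) (hlt : i < pc) (n : ℕ) (u : Instr) :
    Tracks U (i + 1) pc M (s.run (instrOps n i u)) := by
  have hmem := mem_run_instrOps_of_false (s := s) (i := i)
    (by rw [h.pos i le_rfl, decide_eq_false hlt.ne]) n u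
  exact ⟨fun j hj => by rw [hmem, h.pos j (by omega)], fun f hf => by rw [hmem, h.reg f hf]⟩

theorem Tracks.stepOps (h : Tracks U i i M s) {a : Action} (ha : a.focus ∈ U) (j k : ℕ) :
    Tracks U (i + 1) (if a.reply M then j else k) (a.perform M) (s.run (stepOps i a j k)) := by
  classical
  have hmem := mem_run_stepOps_of_true (s := s) (i := i)
    (by rw [h.pos i le_rfl, decide_eq_true rfl]) a j k
  rw [h.reg _ ha, ← apply_ite posAddr] at hmem
  refine ⟨fun n hn => ?_, fun f hf => ?_⟩
  · rw [hmem, Function.update_of_ne (posAddr_ne_regAddr _ _), h.pos n (by omega),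
      decide_eq_false (by omega), Bool.false_or, decide_eq_decide, posAddr_injective.eq_iff,
      Action.reply]
  · rw [hmem, decide_eq_false (posAddr_ne_regAddr _ _).symm, Bool.or_false, Action.perform]
    by_cases hfa : f = a.focus
    · rw [hfa, Function.update_self, Function.update_self]
    · rw [Function.update_of_ne (regAddr_injective.ne hfa), Function.update_of_ne hfa, h.reg f hf]

theorem Tracks.exists_instrOps (h : Tracks U i i M s) {t : ℕ} {u : Instr} (hu : X[i]? = some u)
    (hu_fwd : ¬ u.IsBackwardJump) (hu_term : u ≠ .term) (hu_uses : ∀ f ∈ u.focus?, f ∈ U)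
    (idle_mem : idleAction.focus ∈ U) (hex : exec X (t + 1) i M = some M') :
    ∃ pc M₁, i < pc ∧ exec X t pc M₁ = some M' ∧
      Tracks U (i + 1) pc M₁ (s.run (instrOps X.length i u)) := by
  rw [exec, hu] at hex
  have hlt {pc : ℕ} {M₁ : Memory} (h : exec X t pc M₁ = some M') : pc < X.length :=
    lt_length_of_exec_eq_some h
  cases u with
  | basic a =>
    have htracks := h.stepOps (hu_uses _ rfl) (i + 1) (i + 1)
    rw [ite_self] at htracks
    exact ⟨i + 1, _, i.lt_succ_self, hex, htracks⟩
  | pos a =>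
    have hpc := hlt hex
    have htracks := h.stepOps (hu_uses _ rfl) (i + 1) (min (i + 2) X.length)
    refine ⟨_, _, by split <;> omega, hex, ?_⟩
    cases hr : a.reply M <;> simp_all [instrOps, Nat.le_of_lt]
  | neg a =>
    have hpc := hlt hex
    have htracks := h.stepOps (hu_uses _ rfl) (min (i + 2) X.length) (i + 1)
    refine ⟨_, _, by split <;> omega, hex, ?_⟩
    cases hr : a.reply M <;> simp_all [instrOps, Nat.le_of_lt]
  | jump k =>
    have hk : k ≠ 0 := by
      rintro rfl
      simp [exec_jump_zero hu] at hex
    have htracks := h.stepOps idle_mem (min (i + k) X.length) (min (i + k) X.length)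
    rw [ite_self, min_eq_left (hlt hex).le, idleAction, Action.perform_ident] at htracks
    refine ⟨i + k, M, by omega, hex, ?_⟩
    rwa [instrOps, min_eq_left (hlt hex).le]
  | bjump k => exact absurd trivial hu_fwd
  | term => exact absurd rfl hu_term

theorem Tracks.mem_run_seqOps (h : Tracks U i pc M s) (hi : i ≤ pc)
    (hX : ∀ u ∈ X, ¬ u.IsBackwardJump) (hU : ∀ f, Uses X f → f ∈ U)
    (idle_mem : idleAction.focus ∈ U) {t : ℕ} (hex : exec X t pc M = some M') {f : Focus}
    (hf : f ∈ U) : (s.run (seqOps X.length i (X.drop i))).mem (regAddr f) = M' f := by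
  generalize hX' : X.drop i = X'
  induction X' generalizing i s t pc M with
  | nil =>
    have hpc := lt_length_of_exec_eq_some hex
    rw [List.drop_eq_nil_iff] at hX'
    omega
  | cons u X' ih =>
    have hu : X[i]? = some u := by rw [← List.head?_drop, hX', List.head?_cons]
    have hdrop : X.drop (i + 1) = X' := by rw [← List.tail_drop, hX', List.tail_cons]
    rw [seqOps, NumState.run_append]
    rcases hi.lt_or_eq with hlt | rfl
    · exact ih (h.instrOps_of_lt hlt _ u) hlt hex hdrop
    · have hmem : u ∈ X := List.mem_of_getElem? hu
      obtain _ | t := t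
      · exact nomatch hex
      by_cases hterm : u = .term
      · subst hterm
        rw [exec, hu, Option.some_inj] at hex
        change (s.run (seqOps X.length (i + 1) X')).mem (regAddr f) = M' f
        rw [mem_run_seqOps_of_false _ _ fun j (hj : i + 1 ≤ j) =>
          (h.pos j (by omega)).trans (decide_eq_false (by omega)), ← hex]
        exact h.reg f hf
      · obtain ⟨pc, M₁, hpc, hex', htracks⟩ := h.exists_instrOps hu (hX u hmem) hterm
          (fun g hg => hU g ⟨u, hmem, hg⟩) idle_mem hex
        exact ih htracks hpc hex' hdrop

end Tracks

theorem NumState.mem_run_of_forall_ne {l : List (ℕ × Op)} {n : ℕ} (h : ∀ p ∈ l, n ≠ p.1)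
    (s : NumState) : (s.run l).mem n = s.mem n := by
  induction l generalizing s with
  | nil => rfl
  | cons p l ih =>
    exact (ih (fun q hq => h q (List.mem_cons_of_mem _ hq)) _).trans
      (Function.update_of_ne (h p List.mem_cons_self) _ _)

/-- The operations that store the first `k` input bits in the registers `in:1, …, in:k`. -/
def inputOps (k : ℕ) : List (ℕ × Op) :=
  (List.range k).map fun i => (regAddr ⟨.inp, i + 1⟩, .input)

/-- The operations that set the registers `aux1:1, …, aux1:k`. -/
def oneOps (k : ℕ) : List (ℕ × Op) :=
  (List.range k).map fun i => (regAddr ⟨.aux1, i + 1⟩, .set)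

/-- The operations that set up the initial memory in the registers `in:1, …, in:k` and
`aux1:1, …, aux1:k'` and mark the first position as the one to be executed. -/
def initOps (k k' : ℕ) : List (ℕ × Op) := inputOps k ++ oneOps k' ++ [(posAddr 0, .set)]

/-- The program for a single pass instruction sequence that uses the registers `in:1, …, in:k`
and `aux1:1, …, aux1:k'` and has its answer in `out0:1`. -/
def programOps (X : List Instr) (k k' : ℕ) : List (ℕ × Op) :=
  initOps k k' ++ seqOps X.length 0 X ++ [(regAddr ⟨.out0, 1⟩, .read)]

section Init

variable {s : NumState} {k k' : ℕ}

theorem run_inputOps_succ (s : NumState) (k : ℕ) :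
    s.run (inputOps (k + 1)) = (s.run (inputOps k)).exec (regAddr ⟨.inp, k + 1⟩, .input) := by
  rw [inputOps, List.range_succ, List.map_append, NumState.run_append]
  rfl

theorem run_oneOps_succ (s : NumState) (k : ℕ) :
    s.run (oneOps (k + 1)) = (s.run (oneOps k)).exec (regAddr ⟨.aux1, k + 1⟩, .set) := by
  rw [oneOps, List.range_succ, List.map_append, NumState.run_append]
  rfl

theorem act_run_inputOps (s : NumState) (k : ℕ) : (s.run (inputOps k)).act = s.act := by
  induction k with
  | zero => rfl
  | succ k ih => rw [run_inputOps_succ, exec_input, ih]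

theorem xs_run_inputOps (s : NumState) (k : ℕ) : (s.run (inputOps k)).xs = s.xs.drop k := by
  induction k with
  | zero => rfl
  | succ k ih => rw [run_inputOps_succ, exec_input, ih, List.tail_drop]

theorem act_run_oneOps (h : s.act = true) (k : ℕ) : (s.run (oneOps k)).act = true := by
  induction k with
  | zero => exact h
  | succ k ih => rw [run_oneOps_succ, exec_set ih, ih]

theorem mem_run_inputOps (s : NumState) {i : ℕ} (hi : i ∈ Set.Icc 1 k) :
    (s.run (inputOps k)).mem (regAddr ⟨.inp, i⟩) = s.xs.getD (i - 1) false := by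
  induction k with
  | zero => exact absurd (hi.1.trans hi.2) (by decide)
  | succ k ih =>
    simp only [run_inputOps_succ, exec_input, xs_run_inputOps]
    by_cases hik : i = k + 1
    · rw [hik, Function.update_self, List.headD_eq_head?_getD, List.head?_drop,
        List.getD_eq_getElem?_getD, Nat.add_sub_cancel]
    · rw [Function.update_of_ne (regAddr_injective.ne (by simpa using hik))]
      exact ih ⟨hi.1, Nat.lt_succ_iff.mp (lt_of_le_of_ne hi.2 hik)⟩

theorem mem_run_oneOps (h : s.act = true) {i : ℕ} (hi : i ∈ Set.Icc 1 k) :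
    (s.run (oneOps k)).mem (regAddr ⟨.aux1, i⟩) = true := by
  induction k with
  | zero => exact absurd (hi.1.trans hi.2) (by decide)
  | succ k ih =>
    simp only [run_oneOps_succ, exec_set (act_run_oneOps h k)]
    by_cases hik : i = k + 1
    · rw [hik, Function.update_self]
    · rw [Function.update_of_ne (regAddr_injective.ne (by simpa using hik))]
      exact ih ⟨hi.1, Nat.lt_succ_iff.mp (lt_of_le_of_ne hi.2 hik)⟩

theorem mem_run_inputOps_of_ne (s : NumState) {n : ℕ} (h : ∀ i, n ≠ regAddr ⟨.inp, i⟩) (k : ℕ) :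
    (s.run (inputOps k)).mem n = s.mem n := by
  refine NumState.mem_run_of_forall_ne (fun p hp => ?_) s
  obtain ⟨i, -, rfl⟩ := List.mem_map.mp hp
  exact h _

theorem mem_run_oneOps_of_ne (s : NumState) {n : ℕ} (h : ∀ i, n ≠ regAddr ⟨.aux1, i⟩) (k : ℕ) :
    (s.run (oneOps k)).mem n = s.mem n := by
  refine NumState.mem_run_of_forall_ne (fun p hp => ?_) s
  obtain ⟨i, -, rfl⟩ := List.mem_map.mp hp
  exact h _

theorem regAddr_ne_of_role_ne {f : Focus} {r : Role} (h : f.role ≠ r) (i : ℕ) :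
    regAddr f ≠ regAddr ⟨r, i⟩ :=
  regAddr_injective.ne fun hf => h (congrArg Focus.role hf)

theorem run_initOps (h : s.act = true) :
    s.run (initOps k k') =
      { (s.run (inputOps k)).run (oneOps k') with
        cond := false
        mem := Function.update ((s.run (inputOps k)).run (oneOps k')).mem (posAddr 0) true } := by
  rw [initOps, NumState.run_append, NumState.run_append]
  exact exec_set (act_run_oneOps ((act_run_inputOps s k).trans h) k') _

theorem mem_run_initOps_posAddr (h : s.act = true) (hs : ∀ n, s.mem n = false) (j : ℕ) :
    (s.run (initOps k k')).mem (posAddr j) = decide (j = 0) := by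
  simp only [run_initOps h, Function.update_apply, posAddr_injective.eq_iff]
  rw [mem_run_oneOps_of_ne _ (fun _ => posAddr_ne_regAddr _ _),
    mem_run_inputOps_of_ne _ (fun _ => posAddr_ne_regAddr _ _), hs]
  split_ifs with hj <;> simp [hj]

theorem mem_run_initOps_regAddr (h : s.act = true) (hs : ∀ n, s.mem n = false) {f : Focus}
    (hrole : f.role ≠ .inout ∧ f.role ≠ .out1) (hk : f.role = .inp → f.index ∈ Set.Icc 1 k)
    (hk' : f.role = .aux1 → f.index ∈ Set.Icc 1 k') :
    (s.run (initOps k k')).mem (regAddr f) = initMemory (inputBits s.xs) f := by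
  simp only [run_initOps h]
  rw [Function.update_of_ne (posAddr_ne_regAddr _ _).symm]
  obtain ⟨r, i⟩ := f
  cases r with
  | inp =>
    rw [mem_run_oneOps_of_ne _ (regAddr_ne_of_role_ne (by simp)), mem_run_inputOps _ (hk rfl)]
    rfl
  | aux1 =>
    rw [mem_run_oneOps ((act_run_inputOps s k).trans h) (hk' rfl)]
    rfl
  | inout => exact absurd rfl hrole.1
  | out1 => exact absurd rfl hrole.2
  | _ =>
    rw [mem_run_oneOps_of_ne _ (regAddr_ne_of_role_ne (by simp)),
      mem_run_inputOps_of_ne _ (regAddr_ne_of_role_ne (by simp)), hs]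
    rfl

end Init

theorem act_run_programOps {X : List Instr} (hX : ∀ u ∈ X, ¬ u.IsBackwardJump) {k k' : ℕ}
    (hk : ∀ i, Uses X ⟨.inp, i⟩ → i ∈ Set.Icc 1 k)
    (hk' : ∀ i, Uses X ⟨.aux1, i⟩ → i ∈ Set.Icc 1 k')
    (hrole : ∀ f, Uses X f → f.role ≠ .inout ∧ f.role ≠ .out1) {x : List Bool} {t : ℕ}
    {M : Memory} (hM : exec X t 0 (initMemory (inputBits x)) = some M) :
    ((⟨true, false, x, fun _ => false⟩ : NumState).run (programOps X k k')).act =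
      M ⟨.out0, 1⟩ := by
  set s : NumState := ⟨true, false, x, fun _ => false⟩
  have htracks : Tracks {f | Uses X f ∨ f = ⟨.out0, 1⟩} 0 0 (initMemory (inputBits x))
      (s.run (initOps k k')) := by
    refine ⟨fun j _ => mem_run_initOps_posAddr rfl (fun _ => rfl) j, ?_⟩
    rintro f (hf | rfl)
    · exact mem_run_initOps_regAddr rfl (fun _ => rfl) (hrole f hf)
        (fun hr => hk _ (by rwa [← hr])) (fun hr => hk' _ (by rwa [← hr]))
    · exact mem_run_initOps_regAddr rfl (fun _ => rfl) (by simp) nofun nofun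
  rw [programOps, NumState.run_append, NumState.run_append,
    ← htracks.mem_run_seqOps le_rfl hX (fun _ => Or.inl) (Or.inr rfl) hM (Or.inr rfl)]
  simp [NumState.run, NumState.exec, Op.exec, Op.read]

/-! ### The length of the advice -/

theorem le_length_of_uses_eq_Icc {X : List Instr} {r : Role} {k : ℕ}
    (h : {i | Uses X ⟨r, i⟩} = Set.Icc 1 k) : k ≤ X.length := by
  classical
  have hsub : Finset.Icc 1 k ⊆ ((X.filterMap Instr.focus?).map Focus.index).toFinset := by
    intro i hi
    obtain ⟨u, hu, hf⟩ : Uses X ⟨r, i⟩ := h.symm.subset (Finset.mem_Icc.mp hi)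
    rw [List.mem_toFinset, List.mem_map]
    exact ⟨⟨r, i⟩, List.mem_filterMap.mpr ⟨u, hu, hf⟩, rfl⟩
  calc k = (Finset.Icc 1 k).card := by rw [Nat.card_Icc, Nat.add_sub_cancel]
    _ ≤ ((X.filterMap Instr.focus?).map Focus.index).toFinset.card := Finset.card_le_card hsub
    _ ≤ ((X.filterMap Instr.focus?).map Focus.index).length := List.toFinset_card_le _
    _ = (X.filterMap Instr.focus?).length := List.length_map _
    _ ≤ X.length := List.length_filterMap_le _ _

theorem LowRegisterIndices.index_le_length {X : List Instr} (h : LowRegisterIndices X) {f : Focus}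
    (hf : Uses X f) : f.index ≤ X.length := by
  obtain ⟨k, hk⟩ := h f.role
  exact (hk.subset hf).2.trans (le_length_of_uses_eq_Icc hk)

theorem length_instrOps_le (n i : ℕ) (u : Instr) : (instrOps n i u).length ≤ 4 := by
  cases u <;> simp [instrOps, stepOps]

theorem length_seqOps_le (n i : ℕ) (X : List Instr) : (seqOps n i X).length ≤ 4 * X.length := by
  induction X generalizing i with
  | nil => rfl
  | cons u X ih =>
    have hu := length_instrOps_le n i u
    have hX := ih (i + 1)
    rw [seqOps, List.length_append, List.length_cons]
    omega

theorem length_programOps_le (X : List Instr) (k k' : ℕ) :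
    (programOps X k k').length ≤ k + k' + 4 * X.length + 2 := by
  have hX := length_seqOps_le X.length 0 X
  simp only [programOps, initOps, inputOps, oneOps, List.length_append, List.length_map,
    List.length_range, List.length_cons, List.length_nil]
  omega

section Addresses

variable {n i : ℕ}

theorem posAddr_lt (h : i ≤ n) : posAddr i < 8 * (n + 1) := by
  rw [posAddr]
  omega

theorem regAddr_lt {f : Focus} (h : f.index ≤ n) : regAddr f < 8 * (n + 1) := by
  have hcode := f.role.code_mem_Icc.2
  rw [regAddr]
  omega

theorem stepOps_lt {j k : ℕ} {a : Action} (hi : i ≤ n) (ha : a.focus.index ≤ n) (hj : j ≤ n)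
    (hk : k ≤ n) : ∀ p ∈ stepOps i a j k, p.1 < 8 * (n + 1) := by
  intro p hp
  simp only [stepOps, List.mem_cons, List.not_mem_nil, or_false] at hp
  rcases hp with rfl | rfl | rfl | rfl
  exacts [posAddr_lt hi, regAddr_lt ha, posAddr_lt hj, posAddr_lt hk]

theorem instrOps_lt {u : Instr} (hi : i + 1 ≤ n) (hu : ∀ f ∈ u.focus?, f.index ≤ n) :
    ∀ p ∈ instrOps n i u, p.1 < 8 * (n + 1) := by
  cases u with
  | basic a => exact stepOps_lt (by omega) (hu _ rfl) hi hi
  | pos a => exact stepOps_lt (by omega) (hu _ rfl) hi (by omega)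
  | neg a => exact stepOps_lt (by omega) (hu _ rfl) (by omega) hi
  | jump k => exact stepOps_lt (by omega) (Nat.one_le_of_lt hi) (by omega) (by omega)
  | bjump k => exact nofun
  | term => exact nofun

theorem seqOps_lt {X : List Instr} (hi : i + X.length ≤ n)
    (hX : ∀ f, Uses X f → f.index ≤ n) : ∀ p ∈ seqOps n i X, p.1 < 8 * (n + 1) := by
  induction X generalizing i with
  | nil => exact nofun
  | cons u X ih =>
    rw [List.length_cons] at hi
    intro p hp
    rcases List.mem_append.mp hp with hp | hp
    · exact instrOps_lt (by omega) (fun f hf => hX f ⟨u, List.mem_cons_self, hf⟩) p hp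
    · refine ih (by omega) (fun f hf => hX f ?_) p hp
      obtain ⟨v, hv, hvf⟩ := hf
      exact ⟨v, List.mem_cons_of_mem _ hv, hvf⟩

theorem programOps_lt {X : List Instr} (hX : X ≠ []) (hlow : LowRegisterIndices X) {k k' : ℕ}
    (hk : k ≤ X.length) (hk' : k' ≤ X.length) :
    ∀ p ∈ programOps X k k', p.1 < 8 * (X.length + 1) := by
  intro p hp
  simp only [programOps, initOps, inputOps, oneOps, List.mem_append, List.mem_map, List.mem_range,
    List.mem_cons, List.not_mem_nil, or_false] at hp
  rcases hp with (((⟨i, hi, rfl⟩ | ⟨i, hi, rfl⟩) | rfl) | hp) | rfl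
  · exact regAddr_lt (hi.trans_le hk)
  · exact regAddr_lt (hi.trans_le hk')
  · exact posAddr_lt (Nat.zero_le _)
  · exact seqOps_lt (zero_add _).le (fun _ => hlow.index_le_length) p hp
  · exact regAddr_lt (List.length_pos_iff.mpr hX)

end Addresses

theorem eight_mul_succ_le_two_pow_log (n : ℕ) : 8 * (n + 1) ≤ 2 ^ (Nat.log 2 n + 4) := by
  calc 8 * (n + 1) ≤ 8 * 2 ^ (Nat.log 2 n + 1) :=
        Nat.mul_le_mul_left 8 (Nat.lt_pow_succ_log_self one_lt_two n)
    _ = 2 ^ (Nat.log 2 n + 4) := by ring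

theorem mul_log_le (n : ℕ) :
    (6 * n + 2) * (2 * (Nat.log 2 n + 4) + 7) ≤ 120 * (n * Nat.log 2 n + 1) := by
  obtain rfl | rfl | hn : n = 0 ∨ n = 1 ∨ 2 ≤ n := by omega
  · simp
  · simp
  · have hlog : 1 ≤ Nat.log 2 n := Nat.log_pos one_lt_two hn
    nlinarith [Nat.mul_le_mul_left n hlog, Nat.mul_le_mul_right (Nat.log 2 n) hn]

/-- The advice consists of `O(n)` operations, with addresses of `O(log n)` bits. -/
theorem DecidesAt.exists_advice {Y : List Instr} {L : Language Bool} {m : ℕ}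
    (h : DecidesAt Y L m) :
    ∃ a : List Bool, a.length ≤ 120 * (LLOC Y * Nat.log 2 (LLOC Y) + 1) ∧
      ∀ x : List Bool, x.length = m → (x ∈ L ↔ evalAnswer x a = true) := by
  obtain ⟨⟨hne, hfwd⟩, hlow, huses, hdec⟩ := h
  obtain ⟨k, hk⟩ := hlow .inp
  obtain ⟨k', hk'⟩ := hlow .aux1
  have hk_le := le_length_of_uses_eq_Icc hk
  have hk'_le := le_length_of_uses_eq_Icc hk'
  refine ⟨(programOps Y k k').flatMap (encodeOp (Nat.log 2 Y.length + 4)), ?_, fun x hx => ?_⟩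
  · calc _ = (programOps Y k k').length * (2 * (Nat.log 2 Y.length + 4) + 7) := by
          simp [List.length_flatMap, length_encodeOp]
      _ ≤ (6 * Y.length + 2) * (2 * (Nat.log 2 Y.length + 4) + 7) :=
          Nat.mul_le_mul_right _ ((length_programOps_le Y k k').trans (by omega))
      _ ≤ _ := mul_log_le _
  · obtain ⟨β, hβ, hβL⟩ := hdec x hx
    obtain ⟨t, M, hM, rfl⟩ := mem_computed_iff.mp hβ
    have hrole (f : Focus) (hf : Uses Y f) : f.role ≠ .inout ∧ f.role ≠ .out1 := by
      rcases huses f hf with h | rfl | h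
      · simp [h.1]
      · simp
      · constructor <;> intro hr <;> simp [hr, Role.isAux] at h
    have hact := act_run_programOps hfwd (fun _ hi => hk.subset hi) (fun _ hi => hk'.subset hi)
      hrole hM
    rw [← hβL, evalAnswer, act_interp_flatMap_encodeOp
      (s' := ⟨true, false, x, fun _ => false⟩)
      (fun p hp => (programOps_lt hne hlow hk_le hk'_le p hp).trans_le
        (eight_mul_succ_le_two_pow_log _))
      ⟨rfl, rfl, rfl, rfl, fun _ _ => rfl⟩, hact]

/-! ### Complexity classes -/

theorem exists_shortest_decider {L : Language Bool} {m : ℕ} (h : ∃ Y, DecidesAt Y L m) :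
    ∃ Z, DecidesAt Z L m ∧ ∀ Y, DecidesAt Y L m → LLOC Z ≤ LLOC Y := by
  obtain ⟨Z, hZ, hmin⟩ := (measure LLOC).wf.has_min {Y | DecidesAt Y L m} h
  exact ⟨Z, hZ, fun Y hY => not_lt.mp (hmin Y hY)⟩

theorem mem_PNLogN_of_polynomial_deciders {L : Language Bool} {Y : ℕ → List Instr}
    {q : Polynomial ℕ} (hY : ∀ m, DecidesAt (Y m) L m ∧ LLOC (Y m) ≤ q.eval m) : L ∈ PNLogN := by
  choose Z hZ hmin using fun m => exists_shortest_decider ⟨Y m, (hY m).1⟩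
  choose a length_a_le ha using fun m => (hZ m).exists_advice
  refine ⟨⟨Y, q, hY⟩, a, ⟨120, fun m Y' hY' => (length_a_le m).trans ?_⟩, _,
    polyTimeDecidable_evalAnswer, fun x => ha _ x rfl⟩
  have hle := hmin m Y' hY'
  gcongr

theorem PNLogN_subset_PPoly : PNLogN ⊆ PPoly := by
  rintro L ⟨⟨Y, q, hY⟩, a, ⟨c, hc⟩, V, hV, hL⟩
  refine ⟨a, ⟨.C c * (q * q + 1), fun m => (hc m (Y m) (hY m).1).trans ?_⟩, V, hV, hL⟩
  have hlen := (hY m).2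
  simp only [Polynomial.eval_mul, Polynomial.eval_C, Polynomial.eval_add, Polynomial.eval_one]
  gcongr
  exact (Nat.log_le_self _ _).trans hlen

end InstrSeq

theorem mainTheorem3 (Ψ : List InstrSeq.Instr → List InstrSeq.Instr) (p : Polynomial ℕ)
    (hΨ : InstrSeq.IsTranslation Ψ)
    (hp : ∀ X, InstrSeq.IsPGLB X → InstrSeq.LowRegisterIndices X →
      InstrSeq.LLOC (Ψ X) ≤ p.eval (InstrSeq.LLOC X)) :
    InstrSeq.NP ⊆ InstrSeq.PPoly ∧ InstrSeq.NP ⊆ InstrSeq.PNLogN := by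
  have NP_subset_PNLogN : InstrSeq.NP ⊆ InstrSeq.PNLogN := by
    intro L hL
    obtain ⟨q, hq⟩ := InstrSeq.exists_pglbDecidesAt_of_mem_NP hL
    choose X hX length_X_le using hq
    refine InstrSeq.mem_PNLogN_of_polynomial_deciders (Y := fun m => Ψ (X m)) (q := p.comp q)
      fun m => ⟨(hX m).translate hΨ, ?_⟩
    rw [Polynomial.eval_comp]
    exact (hp (X m) (hX m).1 (hX m).2.1).trans (InstrSeq.monotone_eval p (length_X_le m))
  exact ⟨NP_subset_PNLogN.trans InstrSeq.PNLogN_subset_PPoly, NP_subset_PNLogN⟩
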